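/- Let $(M,g)$ be a compact connected Riemannian manifold of dimension $n\ge 3$ with Levi-Civita connection $\nabla$ and volume measure $dv_g$, let $(\bar M,\bar g)$ be a complete Riemannian manifold of dimension $m\ge 2$, and let $f:(M,g)\to(\bar M,\bar g)$ be a smooth harmonic map, that is, a critical point, for every relatively compact open $U\subset M$, of the energy $E_U(f)=\frac12\int_U e(f)\,dv_g$, $e(f)=\operatorname{trace}_g f^*\bar g$, under all smooth variations with compact support in $U$; write $E(f)=E_M(f)$. For a one-form $\theta$ put $\delta^*\theta=\frac12 L_{\theta^\#}g$ and $\delta\theta=-\operatorname{div}\theta^\#$, and for a symmetric two-form $\varphi$ put $(\delta\varphi)(Y)=-\sum_{i}(\nabla_{e_i}\varphi)(e_i,Y)$, where $(e_i)$ is a $g$-orthonormal basis. Let $f^*\bar g=\delta^*\theta+\varphi_0$ be the Berger–Ebin decomposition of the pullback metric, with $\theta$ a smooth one-form and $\varphi_0$ a smooth symmetric two-form with $\delta\varphi_0=0$. Suppose that $\theta^\#$ is an infinitesimal harmonic transformation, that is, $\Delta_S\theta=0$, where $\Delta_S=2\delta\delta^*-d\delta$ is the Sampson Laplacian. Then there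 is a constant $C\ge 0$ such that $$e(f)=-\delta\theta+C \quad\text{on } M, \qquad E(f)=\frac{C}{2}\operatorname{Vol}(M,g).$$ -/

import Mathlib

open Bundle Set MeasureTheory FiberBundle
open scoped Manifold ContDiff Topology ENNReal

noncomputable section

namespace RiemannianGeometry

section Pointwise

variable {E : Type*} [NormedAddCommGroup E] [NormedSpace ℝ E] [FiniteDimensional ℝ E]
  {H : Type*} [TopologicalSpace H] {I : ModelWithCorners ℝ E H}
  {M : Type*} [TopologicalSpace M] [ChartedSpace H M]

instance finiteDimensional_tangentSpace (x : M) : FiniteDimensional ℝ (TangentSpace I x) :=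
  inferInstanceAs (FiniteDimensional ℝ E)

variable [RiemannianBundle (fun x : M ↦ TangentSpace I x)]

variable (I) in
/-- A `g`-orthonormal basis of the tangent space at `x`. -/
def orthoBasis (x : M) :
    OrthonormalBasis (Fin (Module.finrank ℝ (TangentSpace I x))) ℝ (TangentSpace I x) :=
  stdOrthonormalBasis ℝ (TangentSpace I x)

/-- The trace, with respect to the metric `g`, of a bilinear form on the tangent space at `x`. -/
def metricTrace {x : M} (B : TangentSpace I x →L[ℝ] TangentSpace I x →L[ℝ] ℝ) : ℝ :=
  ∑ i, B (orthoBasis I x i) (orthoBasis I x i)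

/-- The vector field `θ^♯` dual by `g` to the one-form `θ`, i.e. `g(θ^♯, v) = θ(v)`. -/
def sharp (θ : Π x : M, TangentSpace I x →L[ℝ] ℝ) (x : M) : TangentSpace I x :=
  ∑ i, θ x (orthoBasis I x i) • orthoBasis I x i

theorem inner_sharp (θ : Π x : M, TangentSpace I x →L[ℝ] ℝ) (x : M) (v : TangentSpace I x) :
    inner ℝ (sharp θ x) v = θ x v := by
  conv_rhs => rw [← (orthoBasis I x).sum_repr' v]
  simp only [sharp, sum_inner, real_inner_smul_left, map_sum, map_smul, smul_eq_mul]
  exact Finset.sum_congr rfl fun i _ ↦ mul_comm _ _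

end Pointwise

section LeviCivita

variable {E : Type*} [NormedAddCommGroup E] [NormedSpace ℝ E]
  {H : Type*} [TopologicalSpace H] {I : ModelWithCorners ℝ E H}
  {M : Type*} [TopologicalSpace M] [ChartedSpace H M]
  [RiemannianBundle (fun x : M ↦ TangentSpace I x)]

/-- The right-hand side of the Koszul formula for `g(∇_X Y, Z)`, at the point `x`. -/
def koszul (X Y Z : Π x : M, TangentSpace I x) (x : M) : ℝ :=
  (1 / 2) * (mvfderiv I (fun y ↦ (inner ℝ (Y y) (Z y) : ℝ)) x (X x)
    + mvfderiv I (fun y ↦ (inner ℝ (X y) (Z y) : ℝ)) x (Y x)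
    - mvfderiv I (fun y ↦ (inner ℝ (X y) (Y y) : ℝ)) x (Z x)
    + inner ℝ (VectorField.mlieBracket I X Y x) (Z x)
    - inner ℝ (VectorField.mlieBracket I X Z x) (Y x)
    - inner ℝ (VectorField.mlieBracket I Y Z x) (X x))

variable [IsManifold I ∞ M]
  [IsContMDiffRiemannianBundle I ∞ E (fun x : M ↦ TangentSpace I x)]

theorem mdifferentiableAt_inner {X Y : Π x : M, TangentSpace I x} {x : M}
    (hX : MDiffAt (T% X) x) (hY : MDiffAt (T% Y) x) :
    MDiffAt (fun y ↦ (inner ℝ (X y) (Y y) : ℝ)) x :=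
  MDifferentiableAt.inner_bundle (IB := I) (F := E) (E := fun y : M ↦ TangentSpace I y)
    (b := fun y ↦ y) hX hY

variable [FiniteDimensional ℝ E]

theorem koszul_tensorial_left {Y Z : Π x : M, TangentSpace I x} {x : M}
    (hY : MDiffAt (T% Y) x) (hZ : MDiffAt (T% Z) x) :
    TensorialAt I E (fun X ↦ koszul X Y Z x) x where
  smul {f X} hf hX := by
    have := FiniteDimensional.complete ℝ E
    have h1 := mvfderiv_mul hf (mdifferentiableAt_inner hX hZ)
    have h2 := mvfderiv_mul hf (mdifferentiableAt_inner hX hY)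
    have e1 : (fun y ↦ (inner ℝ ((f • X) y) (Z y) : ℝ)) = f * fun y ↦ inner ℝ (X y) (Z y) := by
      ext y; simp [real_inner_smul_left]
    have e2 : (fun y ↦ (inner ℝ ((f • X) y) (Y y) : ℝ)) = f * fun y ↦ inner ℝ (X y) (Y y) := by
      ext y; simp [real_inner_smul_left]
    simp only [koszul, e1, e2, h1, h2, VectorField.mlieBracket_smul_left hf hX]
    simp [inner_add_left, real_inner_smul_left, real_inner_smul_right]
    ring
  add {X X'} hX hX' := by
    have := FiniteDimensional.complete ℝ E
    have h1 := mvfderiv_add (mdifferentiableAt_inner hX hZ) (mdifferentiableAt_inner hX' hZ)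
    have h2 := mvfderiv_add (mdifferentiableAt_inner hX hY) (mdifferentiableAt_inner hX' hY)
    have e1 : (fun y ↦ (inner ℝ ((X + X') y) (Z y) : ℝ)) =
        (fun y ↦ inner ℝ (X y) (Z y)) + fun y ↦ inner ℝ (X' y) (Z y) := by
      ext y; simp [inner_add_left]
    have e2 : (fun y ↦ (inner ℝ ((X + X') y) (Y y) : ℝ)) =
        (fun y ↦ inner ℝ (X y) (Y y)) + fun y ↦ inner ℝ (X' y) (Y y) := by
      ext y; simp [inner_add_left]
    simp only [koszul, e1, e2, h1, h2, VectorField.mlieBracket_add_left hX hX']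
    simp [inner_add_left, inner_add_right]
    ring

theorem koszul_tensorial_right {X Y : Π x : M, TangentSpace I x} {x : M}
    (hX : MDiffAt (T% X) x) (hY : MDiffAt (T% Y) x) :
    TensorialAt I E (fun Z ↦ koszul X Y Z x) x where
  smul {f Z} hf hZ := by
    have := FiniteDimensional.complete ℝ E
    have h1 := mvfderiv_mul hf (mdifferentiableAt_inner hX hZ)
    have h2 := mvfderiv_mul hf (mdifferentiableAt_inner hY hZ)
    have e1 : (fun y ↦ (inner ℝ (X y) ((f • Z) y) : ℝ)) = f * fun y ↦ inner ℝ (X y) (Z y) := by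
      ext y; simp [real_inner_smul_right]
    have e2 : (fun y ↦ (inner ℝ (Y y) ((f • Z) y) : ℝ)) = f * fun y ↦ inner ℝ (Y y) (Z y) := by
      ext y; simp [real_inner_smul_right]
    simp only [koszul, e1, e2, h1, h2, VectorField.mlieBracket_smul_right hf hZ]
    simp [inner_add_left, real_inner_smul_left, real_inner_smul_right,
      real_inner_comm (X x) (Z x), real_inner_comm (Y x) (Z x)]
    ring
  add {Z Z'} hZ hZ' := by
    have := FiniteDimensional.complete ℝ E
    have h1 := mvfderiv_add (mdifferentiableAt_inner hX hZ) (mdifferentiableAt_inner hX hZ')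
    have h2 := mvfderiv_add (mdifferentiableAt_inner hY hZ) (mdifferentiableAt_inner hY hZ')
    have e1 : (fun y ↦ (inner ℝ (X y) ((Z + Z') y) : ℝ)) =
        (fun y ↦ inner ℝ (X y) (Z y)) + fun y ↦ inner ℝ (X y) (Z' y) := by
      ext y; simp [inner_add_right]
    have e2 : (fun y ↦ (inner ℝ (Y y) ((Z + Z') y) : ℝ)) =
        (fun y ↦ inner ℝ (Y y) (Z y)) + fun y ↦ inner ℝ (Y y) (Z' y) := by
      ext y; simp [inner_add_right]
    simp only [koszul, e1, e2, h1, h2, VectorField.mlieBracket_add_right hZ hZ']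
    simp [inner_add_left, inner_add_right]
    ring

/-- For a vector field `Y` differentiable at `x`, the bilinear form `(v, w) ↦ g(∇_v Y, w)` on the
tangent space at `x`. -/
def koszulForm (Y : Π x : M, TangentSpace I x) (x : M) (hY : MDiffAt (T% Y) x) :
    TangentSpace I x →L[ℝ] TangentSpace I x →L[ℝ] ℝ :=
  TensorialAt.mkHom₂ (fun X Z ↦ koszul X Y Z x) x
    (fun _ hZ ↦ koszul_tensorial_left hY hZ) (fun _ hX ↦ koszul_tensorial_right hX hY)

theorem koszulForm_apply {X Y Z : Π x : M, TangentSpace I x} {x : M}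
    (hX : MDiffAt (T% X) x) (hY : MDiffAt (T% Y) x) (hZ : MDiffAt (T% Z) x) :
    koszulForm Y x hY (X x) (Z x) = koszul X Y Z x :=
  TensorialAt.mkHom₂_apply _ _ hX hZ

open scoped Classical in
/-- The covariant derivative `v ↦ ∇_v Y` at `x`, obtained from the Koszul formula (with the
conventional value `0` if `Y` is not differentiable at `x`). -/
def nabla (Y : Π x : M, TangentSpace I x) (x : M) : TangentSpace I x →L[ℝ] TangentSpace I x :=
  if hY : MDiffAt (T% Y) x then
    ∑ i, ((koszulForm Y x hY).flip (orthoBasis I x i)).smulRight (orthoBasis I x i)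
  else 0

theorem inner_nabla {Y : Π x : M, TangentSpace I x} {x : M} (hY : MDiffAt (T% Y) x)
    (v w : TangentSpace I x) : inner ℝ (nabla Y x v) w = koszulForm Y x hY v w := by
  conv_rhs => rw [← (orthoBasis I x).sum_repr' w]
  simp only [nabla, hY, dite_true, sum_apply,
    ContinuousLinearMap.smulRight_apply, ContinuousLinearMap.flip_apply, sum_inner,
    real_inner_smul_left, map_sum, map_smul, smul_eq_mul]
  exact Finset.sum_congr rfl fun i _ ↦ mul_comm _ _

theorem inner_nabla_apply {X Y Z : Π x : M, TangentSpace I x} {x : M}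
    (hX : MDiffAt (T% X) x) (hY : MDiffAt (T% Y) x) (hZ : MDiffAt (T% Z) x) :
    inner ℝ (nabla Y x (X x)) (Z x) = koszul X Y Z x := by
  rw [inner_nabla hY, koszulForm_apply hX hY hZ]

variable (I M) in
/-- The Levi-Civita connection of the metric `g`. -/
def leviCivita : CovariantDerivative I E (TangentSpace I : M → Type _) where
  toFun := nabla
  isCovariantDerivativeOnUniv :=
    { add := by
        intro Y Y' x hY hY' _
        have := FiniteDimensional.complete ℝ E
        ext v
        refine ext_inner_right ℝ fun w ↦ ?_
        have hs : MDiffAt (T% (Y + Y')) x := mdifferentiableAt_add_section hY hY'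
        have hv := mdifferentiableAt_extend I E v
        have hw := mdifferentiableAt_extend I E w
        rw [← extend_apply_self E v, ← extend_apply_self E w]
        have h1 := mvfderiv_add (mdifferentiableAt_inner hY hw) (mdifferentiableAt_inner hY' hw)
        have h2 := mvfderiv_add (mdifferentiableAt_inner hv hY) (mdifferentiableAt_inner hv hY')
        have e1 : (fun y ↦ (inner ℝ ((Y + Y') y) (extend E w y) : ℝ)) =
            (fun y ↦ inner ℝ (Y y) (extend E w y)) + fun y ↦ inner ℝ (Y' y) (extend E w y) := by
          ext y; simp [inner_add_left]
        have e2 : (fun y ↦ (inner ℝ (extend E v y) ((Y + Y') y) : ℝ)) =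
            (fun y ↦ inner ℝ (extend E v y) (Y y)) + fun y ↦ inner ℝ (extend E v y) (Y' y) := by
          ext y; simp [inner_add_right]
        rw [add_apply, inner_add_left, inner_nabla_apply hv hs hw,
          inner_nabla_apply hv hY hw, inner_nabla_apply hv hY' hw]
        simp only [koszul, e1, e2, h1, h2, VectorField.mlieBracket_add_left hY hY',
          VectorField.mlieBracket_add_right hY hY']
        simp [inner_add_left, inner_add_right]
        ring
      leibniz := by
        intro Y f x hY hf _
        have := FiniteDimensional.complete ℝ E
        ext v
        refine ext_inner_right ℝ fun w ↦ ?_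
        have hs : MDiffAt (T% (f • Y)) x := hf.smul_section hY
        have hv := mdifferentiableAt_extend I E v
        have hw := mdifferentiableAt_extend I E w
        have hvx := extend_apply_self E v
        have hwx := extend_apply_self E w
        rw [← hvx, ← hwx]
        have h1 := mvfderiv_mul hf (mdifferentiableAt_inner hY hw)
        have h2 := mvfderiv_mul hf (mdifferentiableAt_inner hv hY)
        have e1 : (fun y ↦ (inner ℝ ((f • Y) y) (extend E w y) : ℝ)) =
            f * fun y ↦ inner ℝ (Y y) (extend E w y) := by
          ext y; simp [real_inner_smul_left]
        have e2 : (fun y ↦ (inner ℝ (extend E v y) ((f • Y) y) : ℝ)) =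
            f * fun y ↦ inner ℝ (extend E v y) (Y y) := by
          ext y; simp [real_inner_smul_right]
        rw [add_apply, inner_add_left, inner_nabla_apply hv hs hw,
          smul_apply, real_inner_smul_left, inner_nabla_apply hv hY hw]
        simp only [koszul, e1, e2, h1, h2, VectorField.mlieBracket_smul_left hf hY,
          VectorField.mlieBracket_smul_right hf hY]
        simp [inner_add_left, real_inner_smul_left, real_inner_smul_right,
          real_inner_comm (Y x) v]
        ring }

theorem leviCivita_torsion [CompleteSpace E] : (leviCivita I M).torsion = 0 := by
  rw [CovariantDerivative.torsion_eq_zero_iff]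
  intro X Y x hX hY
  refine ext_inner_right ℝ fun w ↦ ?_
  have hw := mdifferentiableAt_extend I E w
  rw [← extend_apply_self E w, inner_sub_left]
  change inner ℝ (nabla Y x (X x)) _ - inner ℝ (nabla X x (Y x)) _ = _
  rw [inner_nabla_apply hX hY hw, inner_nabla_apply hY hX hw]
  simp only [koszul, VectorField.mlieBracket_swap_apply (V := Y) (W := X), inner_neg_left,
    real_inner_comm]
  ring

theorem leviCivita_metric {X Y Z : Π x : M, TangentSpace I x} {x : M}
    (hX : MDiffAt (T% X) x) (hY : MDiffAt (T% Y) x) (hZ : MDiffAt (T% Z) x) :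
    mvfderiv I (fun y ↦ (inner ℝ (Y y) (Z y) : ℝ)) x (X x) =
      inner ℝ (leviCivita I M Y x (X x)) (Z x) + inner ℝ (Y x) (leviCivita I M Z x (X x)) := by
  change _ = inner ℝ (nabla Y x (X x)) (Z x) + inner ℝ (Y x) (nabla Z x (X x))
  rw [real_inner_comm (nabla Z x (X x)), inner_nabla_apply hX hY hZ, inner_nabla_apply hX hZ hY]
  simp only [koszul, VectorField.mlieBracket_swap_apply (V := Z) (W := Y), inner_neg_left,
    real_inner_comm]
  ring

end LeviCivita

section Operators

variable {E : Type*} [NormedAddCommGroup E] [NormedSpace ℝ E] [FiniteDimensional ℝ E]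
  {H : Type*} [TopologicalSpace H] {I : ModelWithCorners ℝ E H}
  {M : Type*} [TopologicalSpace M] [ChartedSpace H M] [IsManifold I ∞ M]
  [RiemannianBundle (fun x : M ↦ TangentSpace I x)]
  [IsContMDiffRiemannianBundle I ∞ E (fun x : M ↦ TangentSpace I x)]

/-- `(L_ξ g)(X, Y) = ξ (g(X, Y)) - g([ξ, X], Y) - g(X, [ξ, Y])`, at the point `x`. -/
def lieDerivMetricAux (ξ X Y : Π x : M, TangentSpace I x) (x : M) : ℝ :=
  mvfderiv I (fun y ↦ (inner ℝ (X y) (Y y) : ℝ)) x (ξ x)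
    - inner ℝ (VectorField.mlieBracket I ξ X x) (Y x)
    - inner ℝ (X x) (VectorField.mlieBracket I ξ Y x)

theorem lieDerivMetricAux_comm (ξ X Y : Π x : M, TangentSpace I x) (x : M) :
    lieDerivMetricAux ξ X Y x = lieDerivMetricAux ξ Y X x := by
  simp only [lieDerivMetricAux, real_inner_comm]
  ring

theorem lieDerivMetricAux_tensorial (ξ : Π x : M, TangentSpace I x)
    {Y : Π x : M, TangentSpace I x} {x : M} (hY : MDiffAt (T% Y) x) :
    TensorialAt I E (fun X ↦ lieDerivMetricAux ξ X Y x) x where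
  smul {f X} hf hX := by
    have := FiniteDimensional.complete ℝ E
    have h1 := mvfderiv_mul hf (mdifferentiableAt_inner hX hY)
    have e1 : (fun y ↦ (inner ℝ ((f • X) y) (Y y) : ℝ)) = f * fun y ↦ inner ℝ (X y) (Y y) := by
      ext y; simp [real_inner_smul_left]
    simp only [lieDerivMetricAux, e1, h1, VectorField.mlieBracket_smul_right hf hX]
    simp [inner_add_left, real_inner_smul_left]
    ring
  add {X X'} hX hX' := by
    have := FiniteDimensional.complete ℝ E
    have h1 := mvfderiv_add (mdifferentiableAt_inner hX hY) (mdifferentiableAt_inner hX' hY)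
    have e1 : (fun y ↦ (inner ℝ ((X + X') y) (Y y) : ℝ)) =
        (fun y ↦ inner ℝ (X y) (Y y)) + fun y ↦ inner ℝ (X' y) (Y y) := by
      ext y; simp [inner_add_left]
    simp only [lieDerivMetricAux, e1, h1, VectorField.mlieBracket_add_right hX hX']
    simp [inner_add_left]
    ring

/-- The Lie derivative `L_ξ g` of the metric `g` along the vector field `ξ`. -/
def lieDerivMetric (ξ : Π x : M, TangentSpace I x) (x : M) :
    TangentSpace I x →L[ℝ] TangentSpace I x →L[ℝ] ℝ :=
  TensorialAt.mkHom₂ (fun X Y ↦ lieDerivMetricAux ξ X Y x) x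
    (fun _ hY ↦ lieDerivMetricAux_tensorial ξ hY)
    (fun X hX ↦ by
      simp only [lieDerivMetricAux_comm ξ X]
      exact lieDerivMetricAux_tensorial ξ hX)

/-- The operator `δ^*` from one-forms to symmetric two-forms, `δ^* θ = (1/2) L_ξ g`,
`ξ = θ^♯`. -/
def deltaStar (θ : Π x : M, TangentSpace I x →L[ℝ] ℝ) (x : M) :
    TangentSpace I x →L[ℝ] TangentSpace I x →L[ℝ] ℝ :=
  (1 / 2 : ℝ) • lieDerivMetric (sharp θ) x

/-- The covariant derivative `(∇_v φ)(a, b)` of a two-form `φ` which is differentiable at `x`. The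
vectors `a` and `b` are extended to differentiable vector fields; the result does not depend on the
extensions. -/
def nablaForm (φ : Π x : M, TangentSpace I x →L[ℝ] TangentSpace I x →L[ℝ] ℝ) (x : M)
    (v a b : TangentSpace I x) : ℝ :=
  mvfderiv I (fun y ↦ φ y (extend E a y) (extend E b y)) x v
    - φ x (leviCivita I M (extend E a) x v) b
    - φ x a (leviCivita I M (extend E b) x v)

/-- The divergence operator `δ` on two-forms, `(δφ)(w) = -∑ᵢ (∇_{eᵢ} φ)(eᵢ, w)`. -/
def deltaTwo (φ : Π x : M, TangentSpace I x →L[ℝ] TangentSpace I x →L[ℝ] ℝ) (x : M)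
    (w : TangentSpace I x) : ℝ :=
  -∑ i, nablaForm φ x (orthoBasis I x i) (orthoBasis I x i) w

/-- The codifferential `δ` on one-forms, the formal adjoint of `d`:
`δθ = -div θ^♯ = -∑ᵢ g(∇_{eᵢ} θ^♯, eᵢ)`. -/
def deltaOne (θ : Π x : M, TangentSpace I x →L[ℝ] ℝ) (x : M) : ℝ :=
  -∑ i, inner ℝ (leviCivita I M (sharp θ) x (orthoBasis I x i)) (orthoBasis I x i)

/-- The Sampson Laplacian `Δ_S θ = 2 δ δ^* θ - d δ θ` on one-forms. -/
def sampsonLaplacian (θ : Π x : M, TangentSpace I x →L[ℝ] ℝ) (x : M)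
    (w : TangentSpace I x) : ℝ :=
  2 * deltaTwo (deltaStar θ) x w - mvfderiv I (deltaOne θ) x w

/-- The vector field `ξ = θ^♯` is an infinitesimal harmonic transformation of `(M, g)`:
`Δ_S θ = 0`. -/
def IsInfinitesimalHarmonicTransformation (θ : Π x : M, TangentSpace I x →L[ℝ] ℝ) : Prop :=
  ∀ (x : M) (w : TangentSpace I x), sampsonLaplacian θ x w = 0

variable (I) in
/-- `θ` is a smooth section of the cotangent bundle. -/
def IsSmoothOneForm (θ : Π x : M, TangentSpace I x →L[ℝ] ℝ) : Prop :=
  ContMDiff I (I.prod 𝓘(ℝ, E →L[ℝ] ℝ)) ∞ (fun x ↦ TotalSpace.mk' (E →L[ℝ] ℝ) x (θ x))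

variable (I) in
/-- `φ` is a smooth field of symmetric bilinear forms, i.e. a smooth section of `S²M`. -/
def IsSmoothSymmTwoForm (φ : Π x : M, TangentSpace I x →L[ℝ] TangentSpace I x →L[ℝ] ℝ) : Prop :=
  ContMDiff I (I.prod 𝓘(ℝ, E →L[ℝ] E →L[ℝ] ℝ)) ∞
    (fun x ↦ TotalSpace.mk' (E →L[ℝ] E →L[ℝ] ℝ) x (φ x)) ∧
  ∀ (x : M) (v w : TangentSpace I x), φ x v w = φ x w v

end Operators

section Energy

variable {n : ℕ} {M : Type*} [TopologicalSpace M] [ChartedSpace (EuclideanSpace ℝ (Fin n)) M]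
  [RiemannianBundle (fun x : M ↦ TangentSpace (𝓡 n) x)]

/-- The coordinate vector field `∂ᵢ` of the chart at `c`, at the point with coordinates `y`. -/
def coordVector (c : M) (y : EuclideanSpace ℝ (Fin n)) (i : Fin n) :
    TangentSpace (𝓡 n) ((chartAt (EuclideanSpace ℝ (Fin n)) c).symm y) :=
  mfderiv (𝓡 n) (𝓡 n) (chartAt (EuclideanSpace ℝ (Fin n)) c).symm y
    (EuclideanSpace.single i (1 : ℝ) : EuclideanSpace ℝ (Fin n))

/-- The density `√(det gᵢⱼ)` in the chart at `c`, as a function of the coordinates. -/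
def volumeDensity (c : M) (y : EuclideanSpace ℝ (Fin n)) : ℝ :=
  Real.sqrt (Matrix.det (Matrix.of fun i j : Fin n ↦
    (inner ℝ (coordVector c y i) (coordVector c y j) : ℝ)))

variable [MeasurableSpace M]

/-- The measure `√(det gᵢⱼ) dx¹ … dxⁿ` on the domain of the chart at `c`, extended by zero to
`M`. -/
def chartVolume (c : M) : Measure M :=
  ((volume.restrict (chartAt (EuclideanSpace ℝ (Fin n)) c).target).withDensity
    (fun y ↦ ENNReal.ofReal (volumeDensity c y))).map (chartAt (EuclideanSpace ℝ (Fin n)) c).symm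

variable (n M) in
/-- The Riemannian volume measure `dv_g`. The measures `√(det gᵢⱼ) dx¹ … dxⁿ` of two charts agree on
the intersection of their domains; `dv_g` is the measure which restricts to them, i.e. the least
measure above all of them. -/
def riemannianVolume : Measure M := ⨆ c : M, chartVolume (n := n) c

variable {m : ℕ} {N : Type*} [TopologicalSpace N] [ChartedSpace (EuclideanSpace ℝ (Fin m)) N]
  [RiemannianBundle (fun x : N ↦ TangentSpace (𝓡 m) x)]

variable (n m) in
/-- The pullback metric `f^* ḡ`. -/
def pullbackMetric (f : M → N) (x : M) :
    TangentSpace (𝓡 n) x →L[ℝ] TangentSpace (𝓡 n) x →L[ℝ] ℝ :=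
  (innerSL ℝ (E := TangentSpace (𝓡 m) (f x))).bilinearComp
    (mfderiv (𝓡 n) (𝓡 m) f x) (mfderiv (𝓡 n) (𝓡 m) f x)

variable (n m) in
/-- The energy density `e(f) = trace_g (f^* ḡ)`. -/
def energyDensity (f : M → N) (x : M) : ℝ :=
  metricTrace (I := 𝓡 n) (pullbackMetric n m f x)

variable (n m) in
/-- The energy `E_U(f) = (1/2) ∫_U e(f) dv_g` of `f` on `U`. -/
def energyOn (U : Set M) (f : M → N) : ℝ :=
  (1 / 2) * ∫ x in U, energyDensity n m f x ∂(riemannianVolume n M)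

variable (n m) in
/-- The energy `E(f) = (1/2) ∫_M e(f) dv_g`. -/
def energy (f : M → N) : ℝ :=
  (1 / 2) * ∫ x, energyDensity n m f x ∂(riemannianVolume n M)

variable (n m) in
/-- A smooth map `f` is harmonic if it is a critical point of the energy `E_U`, for every relatively
compact open subset `U` of `M`, with respect to all smooth variations `F t` of `f = F 0` with
compact support in `U`. -/
def IsHarmonicMap (f : M → N) : Prop :=
  ContMDiff (𝓡 n) (𝓡 m) ∞ f ∧
  ∀ U : Set M, IsOpen U → IsCompact (closure U) →
    ∀ F : ℝ → M → N,
      ContMDiff (𝓘(ℝ, ℝ).prod (𝓡 n)) (𝓡 m) ∞ (fun p : ℝ × M ↦ F p.1 p.2) →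
      F 0 = f →
      (∃ K : Set M, IsCompact K ∧ K ⊆ U ∧ ∀ t : ℝ, ∀ x ∉ K, F t x = f x) →
      HasDerivAt (fun t ↦ energyOn n m U (F t)) 0 0

end Energy

end RiemannianGeometry

end

/-! The proof rests on the conservation law of a harmonic map: the stress-energy tensor `½ e(f) g -
f^*ḡ` is divergence free, which amounts to `δ(f^*ḡ) = -½ d e(f)`
(`IsHarmonicMap.deltaTwo_pullbackMetric`). Applying `δ` to the Berger–Ebin decomposition removes
`φ₀` and leaves `2δδ^*θ = -d e(f)`, while `Δ_S θ = 0` reads `2δδ^*θ = dδθ`. Hence `d(e(f) + δθ) =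
0`. Since `trace_g δ^*θ = -δθ` (`deltaOne_eq_neg_metricTrace`), the function `e(f) + δθ` is `trace_g
φ₀`, and on a connected manifold it is a constant `C`. Integrating, the divergence theorem
(`integral_deltaOne`) removes `δθ` and gives the energy; as the energy is nonnegative and the volume
is positive and finite, `C ≥ 0`.

The conservation law is obtained by deforming the domain, not the target, so that neither the
tension field nor the second fundamental form appears. For a field `X` with compact support in a
chart, `f` is composed with the map `y ↦ y + sin t • X y`. In coordinates the energy is the integral
of `√det G` times the `G`-trace of the pulled back form, where `G` and `H` are the matrices of `g`
and `f^*ḡ`. Differentiating under the integral gives a weak equation (`weak_of_critical`);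
integration by parts and the fundamental lemma give a pointwise one (`euler_of_weak`). It is then
evaluated at the centre of the chart in a basis that is orthonormal there (`euler_orthonormal`). The
first derivatives of `G` survive at that point, and they match the Christoffel terms in `δ(f^*ḡ)`
and the derivative of the trace.

The link between the manifold and the charts is `riemannianVolume_restrict_source`: on each chart
domain the volume measure is `√det G` times Lebesgue measure. -/

noncomputable section

set_option linter.unusedSectionVars false

namespace RiemannianGeometry

/-! ### Gram matrices, traces and densities of bilinear forms in a fixed basis. -/

section GramLinearAlgebra

variable {ι : Type*} [Fintype ι] [DecidableEq ι]
  {E : Type*} [NormedAddCommGroup E] [NormedSpace ℝ E]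

/-- The Gram matrix of a family of vectors with respect to a bilinear form. -/
def gramMatrix (b : ι → E) (G : E →L[ℝ] E →L[ℝ] ℝ) : Matrix ι ι ℝ :=
  Matrix.of fun i j ↦ G (b i) (b j)

/-- The trace of `H` relative to the inner product `G`, in the basis `b`. -/
def relTrace (b : ι → E) (G H : E →L[ℝ] E →L[ℝ] ℝ) : ℝ :=
  ∑ i, ∑ j, (gramMatrix b G)⁻¹ i j * H (b i) (b j)

/-- The density `√(det G(bᵢ, bⱼ))`. -/
def relDensity (b : ι → E) (G : E →L[ℝ] E →L[ℝ] ℝ) : ℝ :=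
  Real.sqrt (gramMatrix b G).det

/-- `G` is symmetric and positive definite. -/
structure IsInnerForm (G : E →L[ℝ] E →L[ℝ] ℝ) : Prop where
  symm : ∀ v w, G v w = G w v
  pos : ∀ v, v ≠ 0 → 0 < G v v

theorem IsInnerForm.posDef {G : E →L[ℝ] E →L[ℝ] ℝ} (hG : IsInnerForm G) {b : ι → E}
    (hb : LinearIndependent ℝ b) : (gramMatrix b G).PosDef := by
  refine Matrix.PosDef.of_dotProduct_mulVec_pos ?_ fun x hx ↦ ?_
  · ext i j
    simp [gramMatrix, hG.symm]
  · have hne : ∑ i, x i • b i ≠ 0 := fun h ↦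
      hx (funext fun i ↦ Fintype.linearIndependent_iff.1 hb x h i)
    have := hG.pos _ hne
    simp only [map_sum, map_smul, FunLike.coe_sum, Finset.sum_apply,
      FunLike.coe_smul, Pi.smul_apply, smul_eq_mul] at this
    simp only [dotProduct, Matrix.mulVec, gramMatrix, Matrix.of_apply, star_trivial,
      Finset.mul_sum] at *
    rw [Finset.sum_comm]
    refine this.trans_eq (Finset.sum_congr rfl fun i _ ↦ Finset.sum_congr rfl fun j _ ↦ ?_)
    ring

theorem IsInnerForm.det_pos {G : E →L[ℝ] E →L[ℝ] ℝ} (hG : IsInnerForm G) {b : ι → E}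
    (hb : LinearIndependent ℝ b) : 0 < (gramMatrix b G).det :=
  (hG.posDef hb).det_pos

theorem IsInnerForm.relDensity_pos {G : E →L[ℝ] E →L[ℝ] ℝ} (hG : IsInnerForm G) {b : ι → E}
    (hb : LinearIndependent ℝ b) : 0 < relDensity b G :=
  Real.sqrt_pos.2 (hG.det_pos hb)

theorem IsInnerForm.inv_symm {G : E →L[ℝ] E →L[ℝ] ℝ} (hG : IsInnerForm G) (b : ι → E)
    (i j : ι) : (gramMatrix b G)⁻¹ i j = (gramMatrix b G)⁻¹ j i := by
  have h : (gramMatrix b G).transpose = gramMatrix b G := by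
    ext i j
    simp [gramMatrix, hG.symm]
  conv_rhs => rw [← Matrix.transpose_apply (gramMatrix b G)⁻¹, Matrix.transpose_nonsing_inv, h]

theorem IsInnerForm.sum_inv_mul {G : E →L[ℝ] E →L[ℝ] ℝ} (hG : IsInnerForm G) {b : ι → E}
    (hb : LinearIndependent ℝ b) (i j : ι) :
    ∑ k, (gramMatrix b G)⁻¹ i k * G (b k) (b j) = if i = j then 1 else 0 := by
  have h := Matrix.nonsing_inv_mul (gramMatrix b G) (hG.det_pos hb).ne'.isUnit
  have := congrFun (congrFun h i) j
  rwa [Matrix.mul_apply, Matrix.one_apply] at this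

theorem gramMatrix_linear (b : Module.Basis ι ℝ E) (L : E →ₗ[ℝ] E) (G : E →L[ℝ] E →L[ℝ] ℝ) :
    gramMatrix (fun i ↦ L (b i)) G =
      (LinearMap.toMatrix b b L).transpose * gramMatrix b G * LinearMap.toMatrix b b L := by
  ext i j
  have key : ∀ i, L (b i) = ∑ k, LinearMap.toMatrix b b L k i • b k := fun i ↦ by
    simp [LinearMap.toMatrix_apply, b.sum_repr]
  simp only [gramMatrix, Matrix.of_apply, key i, key j, Matrix.mul_apply, Matrix.transpose_apply,
    map_sum, map_smul, FunLike.coe_sum, Finset.sum_apply, FunLike.coe_smul, Pi.smul_apply,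
    smul_eq_mul, Finset.sum_mul]
  refine Finset.sum_congr rfl fun i _ ↦ ?_
  rw [Finset.mul_sum]
  refine Finset.sum_congr rfl fun j _ ↦ ?_
  ring

/-- The Gram determinant is multiplied by `(det L)²`. This serves both for a change of basis and for
a change of chart. -/
theorem relDensity_linear (b : Module.Basis ι ℝ E) (L : E →ₗ[ℝ] E) (G : E →L[ℝ] E →L[ℝ] ℝ) :
    relDensity (fun i ↦ L (b i)) G = |LinearMap.det L| * relDensity b G := by
  rw [relDensity, gramMatrix_linear, Matrix.det_mul, Matrix.det_mul, Matrix.det_transpose,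
    LinearMap.det_toMatrix, mul_right_comm, ← sq, Real.sqrt_mul (sq_nonneg _), Real.sqrt_sq_eq_abs,
    relDensity]

/-- The factor does not depend on `G`, so a critical point for the density of the standard basis is
critical for the density of any other basis, in particular of one adapted to a point. -/
theorem exists_relDensity_eq_mul (b b' : Module.Basis ι ℝ E) :
    ∃ κ : ℝ, 0 < κ ∧ ∀ G : E →L[ℝ] E →L[ℝ] ℝ, relDensity b' G = κ * relDensity b G := by
  refine ⟨|LinearMap.det (b.equiv b' (Equiv.refl ι) : E →ₗ[ℝ] E)|,
    abs_pos.2 (LinearEquiv.isUnit_det' _).ne_zero, fun G ↦ ?_⟩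
  rw [← relDensity_linear]
  simp

theorem relDensity_bilinearComp (b : Module.Basis ι ℝ E) (L : E →L[ℝ] E)
    (G : E →L[ℝ] E →L[ℝ] ℝ) :
    relDensity b (G.bilinearComp L L) = |L.det| * relDensity b G :=
  relDensity_linear b L G

/-- The trace with respect to an inner product, computed in an orthonormal basis, agrees with the
trace computed from an arbitrary basis. -/
theorem sum_orthonormal_eq_relTrace {F : Type*} [NormedAddCommGroup F] [InnerProductSpace ℝ F]
    {κ : Type*} [Fintype κ] (e : OrthonormalBasis κ ℝ F) (b : Module.Basis ι ℝ E)
    (T : E ≃L[ℝ] F) (G : E →L[ℝ] E →L[ℝ] ℝ) (hG : ∀ v w, G v w = inner ℝ (T v) (T w))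
    (B : F →L[ℝ] F →L[ℝ] ℝ) :
    ∑ k, B (e k) (e k) =
      relTrace b G (B.bilinearComp (T : E →L[ℝ] F) (T : E →L[ℝ] F)) := by
  have hGi : IsInnerForm G :=
    ⟨fun v w ↦ by rw [hG, hG, real_inner_comm], fun v hv ↦ by
      rw [hG]; exact real_inner_self_pos.2 (by simpa using hv)⟩
  -- The basis of `F` dual to `T ∘ b`: the inverse Gram matrix raises the index.
  set d : ι → F := fun i ↦ ∑ j, (gramMatrix b G)⁻¹ i j • T (b j)
  have hd : ∀ i j, inner ℝ (d i) (T (b j)) = if i = j then (1 : ℝ) else 0 := fun i j ↦ by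
    simp only [d, sum_inner, real_inner_smul_left, ← hG]
    exact hGi.sum_inv_mul b.linearIndependent i j
  have hv : ∀ v : F, v = ∑ i, inner ℝ (d i) v • T (b i) := fun v ↦ by
    obtain ⟨w, rfl⟩ := T.surjective v
    have hw : T w = ∑ j, b.repr w j • T (b j) := by
      conv_lhs => rw [← b.sum_repr w]
      simp only [map_sum, map_smul]
    rw [hw]
    refine Finset.sum_congr rfl fun i _ ↦ ?_
    congr 1
    simp [inner_sum, real_inner_smul_right, hd]
  -- Only the first argument is expanded in the basis `T ∘ b`; summing over `k` then collapses `∑ ⟨e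
  -- k, d i⟩ e k` to `d i`.
  have hstep : ∀ k, B (e k) (e k) = ∑ i, B (T (b i)) (inner ℝ (e k) (d i) • e k) := fun k ↦ by
    conv_lhs => rw [hv (e k), ← hv (e k)]
    conv_lhs => enter [1]; rw [hv (e k)]
    simp only [map_sum, map_smul, FunLike.coe_sum, Finset.sum_apply, FunLike.coe_smul,
      Pi.smul_apply, smul_eq_mul, real_inner_comm]
  simp_rw [hstep]
  rw [Finset.sum_comm]
  simp only [relTrace, ← map_sum, e.sum_repr']
  refine Finset.sum_congr rfl fun i _ ↦ ?_
  simp [d]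

end GramLinearAlgebra

/-! ### Smoothness and first derivatives of the inverse Gram matrix, the trace and the density. -/

section GramCalculus

variable {ι : Type*} [Fintype ι] [DecidableEq ι]

/-- The determinant as a continuous multilinear map in the rows. -/
def detCLM (ι : Type*) [Fintype ι] [DecidableEq ι] :
    ContinuousMultilinearMap ℝ (fun _ : ι ↦ ι → ℝ) ℝ where
  toMultilinearMap := (Matrix.detRowAlternating : (ι → ℝ) [⋀^ι]→ₗ[ℝ] ℝ).toMultilinearMap
  cont := by
    change Continuous fun A : Matrix ι ι ℝ ↦ A.det
    fun_prop

/-- By multilinearity the derivative replaces one row at a time, and Cramer's rule evaluates each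
resulting determinant through the adjugate. -/
theorem detCLM_linearDeriv (A B : ι → ι → ℝ) :
    (detCLM ι).linearDeriv A B = ∑ i, ∑ j, Matrix.adjugate (Matrix.of A) j i * B i j := by
  rw [ContinuousMultilinearMap.linearDeriv_apply]
  refine Finset.sum_congr rfl fun i _ ↦ ?_
  have h : detCLM ι (Function.update A i (B i)) = ((Matrix.of A).updateRow i (B i)).det := rfl
  rw [h, ← Matrix.cramer_transpose_apply, Matrix.cramer_eq_adjugate_mulVec,
    ← Matrix.adjugate_transpose]
  simp [Matrix.mulVec, dotProduct]

theorem contDiff_det : ContDiff ℝ ∞ fun A : ι → ι → ℝ ↦ (Matrix.of A).det :=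
  (detCLM ι).contDiff

/-- By Cramer's rule an entry of the inverse is a polynomial in the entries of the matrix divided by
the determinant. -/
theorem contDiffAt_inv_entry {A : ι → ι → ℝ} (hA : (Matrix.of A).det ≠ 0) (i j : ι) :
    ContDiffAt ℝ ∞ (fun A : ι → ι → ℝ ↦ (Matrix.of A)⁻¹ i j) A := by
  have h : (fun A : ι → ι → ℝ ↦ (Matrix.of A)⁻¹ i j) = fun A ↦ ((Matrix.of A).det)⁻¹ *
      (Matrix.of (Function.update A j (Pi.single i 1))).det := by
    ext A
    rw [Matrix.inv_def, Matrix.smul_apply, Ring.inverse_eq_inv', smul_eq_mul, Matrix.adjugate_apply]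
    rfl
  rw [h]
  refine (contDiff_det.contDiffAt.inv hA).mul (contDiff_det.contDiffAt.comp A ?_)
  refine contDiffAt_pi.2 fun k ↦ ?_
  by_cases hk : k = j
  · subst hk
    simpa using contDiffAt_const
  · simp only [Function.update_of_ne hk]
    exact (contDiff_apply ℝ (ι → ℝ) k).contDiffAt

variable {E : Type*} [NormedAddCommGroup E] [NormedSpace ℝ E]
  {F : Type*} [NormedAddCommGroup F] [NormedSpace ℝ F]

theorem contDiffOn_gram {s : Set F} {G : F → E →L[ℝ] E →L[ℝ] ℝ} (hG : ContDiffOn ℝ ∞ G s)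
    (b : ι → E) : ContDiffOn ℝ ∞ (fun y i j ↦ G y (b i) (b j)) s :=
  contDiffOn_pi.2 fun _ ↦ contDiffOn_pi.2 fun _ ↦
    (hG.clm_apply contDiffOn_const).clm_apply contDiffOn_const

theorem contDiffOn_gramMatrix_inv {s : Set F} {G : F → E →L[ℝ] E →L[ℝ] ℝ}
    (hG : ContDiffOn ℝ ∞ G s) (hGi : ∀ y ∈ s, IsInnerForm (G y)) {b : ι → E}
    (hb : LinearIndependent ℝ b) (i j : ι) :
    ContDiffOn ℝ ∞ (fun y ↦ (gramMatrix b (G y))⁻¹ i j) s := fun y hy ↦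
  ContDiffAt.comp_contDiffWithinAt (g := fun A : ι → ι → ℝ ↦ (Matrix.of A)⁻¹ i j) y
    (contDiffAt_inv_entry (A := fun i j ↦ G y (b i) (b j)) ((hGi y hy).det_pos hb).ne' i j)
    (contDiffOn_gram hG b y hy)

theorem contDiffOn_relTrace {s : Set F} {G H : F → E →L[ℝ] E →L[ℝ] ℝ}
    (hG : ContDiffOn ℝ ∞ G s) (hGi : ∀ y ∈ s, IsInnerForm (G y)) (hH : ContDiffOn ℝ ∞ H s)
    {b : ι → E} (hb : LinearIndependent ℝ b) :
    ContDiffOn ℝ ∞ (fun y ↦ relTrace b (G y) (H y)) s :=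
  ContDiffOn.sum fun i _ ↦ ContDiffOn.sum fun j _ ↦
    (contDiffOn_gramMatrix_inv hG hGi hb i j).mul
      ((hH.clm_apply contDiffOn_const).clm_apply contDiffOn_const)

theorem contDiffOn_relDensity {s : Set F} {G : F → E →L[ℝ] E →L[ℝ] ℝ}
    (hG : ContDiffOn ℝ ∞ G s) (hGi : ∀ y ∈ s, IsInnerForm (G y))
    {b : ι → E} (hb : LinearIndependent ℝ b) :
    ContDiffOn ℝ ∞ (fun y ↦ relDensity b (G y)) s :=
  ContDiffOn.sqrt (contDiff_det.comp_contDiffOn (contDiffOn_gram hG b))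
    fun y hy ↦ ((hGi y hy).det_pos hb).ne'

theorem fderiv_clm_apply₂ {G : F → E →L[ℝ] E →L[ℝ] ℝ} {y : F} (hG : DifferentiableAt ℝ G y)
    (v : F) (a a' : E) : fderiv ℝ (fun z ↦ G z a a') y v = fderiv ℝ G y v a a' := by
  have h1 : DifferentiableAt ℝ (fun z ↦ G z a) y := hG.clm_apply (differentiableAt_const a)
  rw [fderiv_clm_apply h1 (differentiableAt_const a')]
  rw [fderiv_clm_apply hG (differentiableAt_const a)]
  simp

/-- Jacobi's formula for the density. -/
theorem fderiv_relDensity {G : F → E →L[ℝ] E →L[ℝ] ℝ} {y : F} (hG : DifferentiableAt ℝ G y)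
    (hGi : IsInnerForm (G y)) {b : ι → E} (hb : LinearIndependent ℝ b) (v : F) :
    fderiv ℝ (fun z ↦ relDensity b (G z)) y v =
      1 / 2 * relDensity b (G y) * relTrace b (G y) (fderiv ℝ G y v) := by
  have hent : ∀ i j, DifferentiableAt ℝ (fun z ↦ G z (b i) (b j)) y := fun i j ↦
    (hG.clm_apply (differentiableAt_const _)).clm_apply (differentiableAt_const _)
  have hA : HasFDerivAt (fun z i j ↦ G z (b i) (b j))
      (ContinuousLinearMap.pi fun i ↦ ContinuousLinearMap.pi fun j ↦
        fderiv ℝ (fun z ↦ G z (b i) (b j)) y) y :=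
    hasFDerivAt_pi.2 fun i ↦ hasFDerivAt_pi.2 fun j ↦ (hent i j).hasFDerivAt
  have hdet := ((detCLM ι).hasFDerivAt (fun i j ↦ G y (b i) (b j))).comp y hA
  have hpos := hGi.det_pos hb
  have hs := hdet.sqrt (show _ ≠ 0 from hpos.ne')
  have e : (fun z ↦ relDensity b (G z)) =
      fun z ↦ √((detCLM ι ∘ fun z i j ↦ G z (b i) (b j)) z) := rfl
  rw [e, hs.fderiv]
  simp only [FunLike.coe_smul, Pi.smul_apply, ContinuousLinearMap.comp_apply, smul_eq_mul]
  rw [detCLM_linearDeriv]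
  have e2 : (detCLM ι ∘ fun z i j ↦ G z (b i) (b j)) y = (gramMatrix b (G y)).det := rfl
  rw [e2, relDensity, relTrace]
  have hsq : √(gramMatrix b (G y)).det ≠ 0 := (Real.sqrt_pos.2 hpos).ne'
  -- The symmetry of the inverse absorbs the transposed indices of the adjugate.
  have hinv : ∀ i j, (gramMatrix b (G y)).adjugate j i =
      (gramMatrix b (G y)).det * (gramMatrix b (G y))⁻¹ i j := fun i j ↦ by
    rw [hGi.inv_symm, Matrix.inv_def, Matrix.smul_apply, Ring.inverse_eq_inv', smul_eq_mul,
      mul_inv_cancel_left₀ hpos.ne']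
  have e3 : (Matrix.of fun i j ↦ G y (b i) (b j)) = gramMatrix b (G y) := rfl
  simp only [e3, hinv, ContinuousLinearMap.pi_apply, mul_assoc, ← Finset.mul_sum]
  simp only [fderiv_clm_apply₂ hG]
  rw [← mul_assoc, ← mul_assoc]
  congr 1
  field_simp
  exact (Real.sq_sqrt hpos.le).symm

/-- The derivative of the inverse Gram matrix at a point where the basis is orthonormal. -/
theorem fderiv_gramMatrix_inv {G : F → E →L[ℝ] E →L[ℝ] ℝ} {s : Set F} (hs : IsOpen s)
    (hG : ContDiffOn ℝ ∞ G s) (hGi : ∀ y ∈ s, IsInnerForm (G y)) {b : ι → E}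
    (hb : LinearIndependent ℝ b) {y : F} (hy : y ∈ s) (hone : gramMatrix b (G y) = 1)
    (v : F) (i j : ι) :
    fderiv ℝ (fun z ↦ (gramMatrix b (G z))⁻¹ i j) y v = -fderiv ℝ G y v (b i) (b j) := by
  have hGd : DifferentiableAt ℝ G y :=
    (hG.contDiffAt (hs.mem_nhds hy)).differentiableAt (by simp)
  have hent : ∀ i j, DifferentiableAt ℝ (fun z ↦ G z (b i) (b j)) y := fun i j ↦
    (hGd.clm_apply (differentiableAt_const _)).clm_apply (differentiableAt_const _)
  have hinv : ∀ i j, DifferentiableAt ℝ (fun z ↦ (gramMatrix b (G z))⁻¹ i j) y := fun i j ↦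
    ((contDiffOn_gramMatrix_inv hG hGi hb i j).contDiffAt (hs.mem_nhds hy)).differentiableAt
      (by simp)
  -- The identity `G⁻¹ G = 1` holds near `y`; its derivative at `y`, where both factors are the
  -- identity, is `(G⁻¹)' + G' = 0`.
  have hprod : (fun z ↦ ∑ k, (gramMatrix b (G z))⁻¹ i k * G z (b k) (b j)) =ᶠ[𝓝 y]
      fun _ ↦ if i = j then 1 else 0 := by
    filter_upwards [hs.mem_nhds hy] with z hz using (hGi z hz).sum_inv_mul hb i j
  have h0 : fderiv ℝ (fun z ↦ ∑ k, (gramMatrix b (G z))⁻¹ i k * G z (b k) (b j)) y v = 0 := by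
    rw [hprod.fderiv_eq]; simp
  rw [fderiv_fun_sum fun k _ ↦ (hinv i k).fun_mul (hent k j)] at h0
  simp only [FunLike.coe_sum, Finset.sum_apply] at h0
  have h1 : ∀ k, fderiv ℝ (fun z ↦ (gramMatrix b (G z))⁻¹ i k * G z (b k) (b j)) y v =
      (if i = k then fderiv ℝ G y v (b k) (b j) else 0) +
      (if k = j then fderiv ℝ (fun z ↦ (gramMatrix b (G z))⁻¹ i k) y v else 0) := fun k ↦ by
    rw [fderiv_fun_mul (hinv i k) (hent k j)]
    have hkj : G y (b k) (b j) = (1 : Matrix ι ι ℝ) k j := by rw [← hone]; rfl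
    simp only [hone, inv_one, hkj, Matrix.one_apply, FunLike.coe_add, Pi.add_apply,
      FunLike.coe_smul, Pi.smul_apply, smul_eq_mul, fderiv_clm_apply₂ hGd]
    split_ifs <;> simp
  simp only [h1, Finset.sum_add_distrib, Finset.sum_ite_eq, Finset.sum_ite_eq', Finset.mem_univ,
    if_true] at h0
  linarith

end GramCalculus

/-! ### Integration by parts, the fundamental lemma and differentiation under the integral. -/

section CompactSupport

variable {E : Type*} [NormedAddCommGroup E] [NormedSpace ℝ E]

theorem continuous_mul_of_tsupport_subset {V : Set E} (hV : IsOpen V) {u k : E → ℝ}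
    (hu : Continuous u) (hs : tsupport u ⊆ V) (hk : ContinuousOn k V) :
    Continuous fun x ↦ u x * k x := by
  refine (hu.continuousOn.mul hk).continuous_of_tsupport_subset hV ?_
  exact (tsupport_mul_subset_left (f := u) (g := k)).trans hs

theorem tsupport_fderiv_apply_subset (u : E → ℝ) (a : E) :
    tsupport (fun x ↦ fderiv ℝ u x a) ⊆ tsupport u := by
  refine closure_minimal (fun x hx ↦ ?_) (isClosed_tsupport u)
  by_contra h
  exact hx (by simp [fderiv_of_notMem_tsupport ℝ h])

/-- Extension by zero is smooth because the open sets `V` and the complement of `K` cover the space.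
It turns functions living on a chart target into compactly supported functions on all of Euclidean
space. -/
theorem indicator_contDiff {V K : Set E} (hV : IsOpen V) (hK : IsClosed K) (hKV : K ⊆ V)
    {w : E → ℝ} (hw : ContDiffOn ℝ ∞ w V) (h0 : ∀ x ∈ V, x ∉ K → w x = 0) :
    ContDiff ℝ ∞ (V.indicator w) ∧ tsupport (V.indicator w) ⊆ K := by
  have hsupp : tsupport (V.indicator w) ⊆ K := by
    refine closure_minimal (fun x hx ↦ ?_) hK
    by_contra h
    by_cases hxV : x ∈ V
    · exact hx (by rw [indicator_of_mem hxV, h0 x hxV h])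
    · exact hx (indicator_of_notMem hxV _)
  refine ⟨contDiff_iff_contDiffAt.2 fun x ↦ ?_, hsupp⟩
  by_cases hx : x ∈ V
  · refine (hw.contDiffAt (hV.mem_nhds hx)).congr_of_eventuallyEq ?_
    filter_upwards [hV.mem_nhds hx] with z hz using indicator_of_mem hz w
  · have hx' : x ∈ (tsupport (V.indicator w))ᶜ := fun h ↦ hx (hKV (hsupp h))
    refine (contDiffAt_const (c := (0 : ℝ))).congr_of_eventuallyEq ?_
    filter_upwards [(isClosed_tsupport _).isOpen_compl.mem_nhds hx'] with z hz
    exact image_eq_zero_of_notMem_tsupport hz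

variable [FiniteDimensional ℝ E] [MeasurableSpace E] [BorelSpace E]
  {μ : Measure E} [μ.IsAddHaarMeasure]

theorem integrable_mul_of_tsupport_subset {V : Set E} (hV : IsOpen V) {u k : E → ℝ}
    (hu : Continuous u) (hc : HasCompactSupport u) (hs : tsupport u ⊆ V)
    (hk : ContinuousOn k V) : Integrable (fun x ↦ u x * k x) μ :=
  (continuous_mul_of_tsupport_subset hV hu hs hk).integrable_of_hasCompactSupport
    (hc.mul_right (f' := k))

theorem integral_fderiv_eq_zero {w : E → ℝ} (hw : ContDiff ℝ ∞ w) (hc : HasCompactSupport w)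
    (a : E) : ∫ x, fderiv ℝ w x a ∂μ = 0 := by
  have hd : Continuous fun x ↦ fderiv ℝ w x a :=
    (hw.continuous_fderiv (by simp)).clm_apply continuous_const
  have h := integral_mul_fderiv_eq_neg_fderiv_mul_of_integrable (μ := μ) (𝕜 := ℝ)
    (f := fun _ ↦ (1 : ℝ)) (g := w) (v := a) (by simp)
    (by simpa using hd.integrable_of_hasCompactSupport (hc.fderiv_apply ℝ a))
    (by simpa using hw.continuous.integrable_of_hasCompactSupport hc)
    (fun x _ ↦ differentiableAt_const _) (fun x _ ↦ hw.differentiable (by simp) x)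
  simpa using h

/-- The function `w` is controlled on `V` only; that is enough because `u`, and with it every
product involved, is supported inside `V`. -/
theorem integral_mul_fderiv_of_tsupport_subset {V : Set E} (hV : IsOpen V) {u w : E → ℝ}
    (hu : ContDiff ℝ ∞ u) (hc : HasCompactSupport u) (hs : tsupport u ⊆ V)
    (hw : ContDiffOn ℝ ∞ w V) (a : E) :
    ∫ x, fderiv ℝ u x a * w x ∂μ = -∫ x, u x * fderiv ℝ w x a ∂μ := by
  have hd : Continuous fun x ↦ fderiv ℝ u x a :=
    (hu.continuous_fderiv (by simp)).clm_apply continuous_const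
  have hw' : ContinuousOn (fun x ↦ fderiv ℝ w x a) V :=
    (hw.continuousOn_fderiv_of_isOpen hV (by simp)).clm_apply continuousOn_const
  rw [eq_neg_iff_add_eq_zero, ← eq_neg_iff_add_eq_zero.1
    (integral_mul_fderiv_eq_neg_fderiv_mul_of_integrable (μ := μ) (𝕜 := ℝ)
    (f := u) (g := w) (v := a)
    (integrable_mul_of_tsupport_subset hV hd (hc.fderiv_apply ℝ a)
      ((tsupport_fderiv_apply_subset u a).trans hs) hw.continuousOn)
    (integrable_mul_of_tsupport_subset hV hu.continuous hc hs hw')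
    (integrable_mul_of_tsupport_subset hV hu.continuous hc hs hw.continuousOn)
    (fun x _ ↦ hu.differentiable (by simp) x)
    (fun x hx ↦ (hw.contDiffAt (hV.mem_nhds (hs hx))).differentiableAt (by simp))), add_comm]

/-- The fundamental lemma of the calculus of variations, for continuous functions. -/
theorem eq_zero_of_integral_test_eq_zero {V : Set E} (hV : IsOpen V) {k : E → ℝ}
    (hk : ContinuousOn k V)
    (h : ∀ u : E → ℝ, ContDiff ℝ ∞ u → HasCompactSupport u → tsupport u ⊆ V →
      ∫ x, u x * k x ∂μ = 0) : ∀ x ∈ V, k x = 0 := by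
  have hae := hV.ae_eq_zero_of_integral_contDiff_smul_eq_zero (μ := μ)
    (hk.locallyIntegrableOn hV.measurableSet) (by simpa using h)
  have hae' : k =ᵐ[μ.restrict V] fun _ ↦ 0 := by
    rw [Filter.EventuallyEq, ae_restrict_iff' hV.measurableSet]
    exact hae
  exact Measure.eqOn_open_of_ae_eq hae' hV hk continuousOn_const

/-- Differentiation under the integral sign over a compact set. -/
theorem hasDerivAt_integral_compact {V K : Set E} (hV : IsOpen V) (hK : IsCompact K)
    (hKV : K ⊆ V) {Φ : ℝ × E → ℝ} (hΦ : ContDiffOn ℝ ∞ Φ (univ ×ˢ V)) :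
    HasDerivAt (fun t ↦ ∫ y in K, Φ (t, y) ∂μ)
      (∫ y in K, fderiv ℝ Φ (0, y) (1, 0) ∂μ) 0 := by
  have hO : IsOpen (univ ×ˢ V : Set (ℝ × E)) := isOpen_univ.prod hV
  have hf' : ContinuousOn (fun p ↦ fderiv ℝ Φ p (1, 0)) (univ ×ˢ V) :=
    (hΦ.continuousOn_fderiv_of_isOpen hO (by simp)).clm_apply continuousOn_const
  have hcpt : IsCompact (Icc (-1 : ℝ) 1 ×ˢ K) := isCompact_Icc.prod hK
  -- The time derivative is bounded on the compact set `[-1, 1] × K`, and the constant bound is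
  -- integrable over `K`.
  obtain ⟨C, hC⟩ := hcpt.exists_bound_of_continuousOn
    (hf'.mono (prod_mono (subset_univ _) hKV))
  have hslice : ∀ t : ℝ, MapsTo (fun y : E ↦ (t, y)) K (univ ×ˢ V) := fun t y hy ↦
    ⟨mem_univ _, hKV hy⟩
  have hsl : ∀ t : ℝ, ContinuousOn (fun y : E ↦ (t, y)) K := fun t ↦ by fun_prop
  refine (hasDerivAt_integral_of_dominated_loc_of_deriv_le (s := Icc (-1 : ℝ) 1)
    (bound := fun _ ↦ C) (F := fun t y ↦ Φ (t, y))
    (F' := fun t y ↦ fderiv ℝ Φ (t, y) (1, 0)) (Icc_mem_nhds (by simp) (by simp))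
    (Filter.Eventually.of_forall fun t ↦ ?_) ?_ ?_ ?_ ?_ ?_).2
  · exact (hΦ.continuousOn.comp (hsl t) (hslice t)).aestronglyMeasurable hK.measurableSet
  · exact (hΦ.continuousOn.comp (hsl 0) (hslice 0)).integrableOn_compact hK
  · exact (hf'.comp (hsl 0) (hslice 0)).aestronglyMeasurable hK.measurableSet
  · rw [ae_restrict_iff' hK.measurableSet]
    exact Filter.Eventually.of_forall fun y hy t ht ↦ hC (t, y) ⟨ht, hy⟩
  · exact integrableOn_const hK.measure_lt_top.ne
  · rw [ae_restrict_iff' hK.measurableSet]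
    refine Filter.Eventually.of_forall fun y hy t _ ↦ ?_
    have h1 : HasFDerivAt Φ (fderiv ℝ Φ (t, y)) (t, y) :=
      ((hΦ.contDiffAt (hO.mem_nhds ⟨mem_univ _, hKV hy⟩)).differentiableAt (by simp)).hasFDerivAt
    have h2 : HasDerivAt (fun t : ℝ ↦ (t, y)) ((1 : ℝ), (0 : E)) t :=
      (hasDerivAt_id t).prodMk (hasDerivAt_const t y)
    exact h1.comp_hasDerivAt t h2

end CompactSupport

/-! ### First variation of the energy under deformations of a coordinate domain. -/

section FirstVariation

variable {ι : Type*} [Fintype ι] [DecidableEq ι]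
  {E : Type*} [NormedAddCommGroup E] [NormedSpace ℝ E]

/-- The pullback of the field of bilinear forms `H` under `y ↦ y + s • X y`. -/
def pullbackShift (H : E → E →L[ℝ] E →L[ℝ] ℝ) (X : E → E) (s : ℝ) (y : E) :
    E →L[ℝ] E →L[ℝ] ℝ :=
  (H (y + s • X y)).bilinearComp (ContinuousLinearMap.id ℝ E + s • fderiv ℝ X y)
    (ContinuousLinearMap.id ℝ E + s • fderiv ℝ X y)

theorem pullbackShift_apply (H : E → E →L[ℝ] E →L[ℝ] ℝ) (X : E → E) (s : ℝ) (y a a' : E) :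
    pullbackShift H X s y a a' =
      H (y + s • X y) (a + s • fderiv ℝ X y a) (a' + s • fderiv ℝ X y a') := rfl

set_option synthInstance.maxHeartbeats 200000 in
-- This derivative is the coordinate expression of the Lie derivative `L_X H`. The parameter `sin t`
-- has the same first-order effect at `0` as `t`, but it stays in `[-1, 1]` for all real `t`.
theorem hasDerivAt_pullbackShift {H : E → E →L[ℝ] E →L[ℝ] ℝ} {X : E → E} {y : E}
    (hH : DifferentiableAt ℝ H y) (a a' : E) :
    HasDerivAt (fun t ↦ pullbackShift H X (Real.sin t) y a a')
      (fderiv ℝ H y (X y) a a' + H y (fderiv ℝ X y a) a' + H y a (fderiv ℝ X y a')) 0 := by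
  have hsin : HasDerivAt Real.sin 1 0 := by simpa using Real.hasDerivAt_sin 0
  have hlin : ∀ c w : E, HasDerivAt (fun t ↦ c + Real.sin t • w) w 0 := fun c w ↦ by
    simpa using (hsin.smul_const w).const_add c
  have h0 : y + Real.sin 0 • X y = y := by simp
  have h1 : HasDerivAt (fun t ↦ H (y + Real.sin t • X y)) (fderiv ℝ H y (X y)) 0 :=
    have hH' : HasFDerivAt H (fderiv ℝ H y) (y + Real.sin 0 • X y) := by
      rw [h0]
      exact hH.hasFDerivAt
    HasFDerivAt.comp_hasDerivAt (F := E) (l := H) (0 : ℝ) hH' (hlin y (X y))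
  have h2 := (h1.clm_apply (hlin a (fderiv ℝ X y a))).clm_apply (hlin a' (fderiv ℝ X y a'))
  simpa [pullbackShift_apply] using h2

set_option synthInstance.maxHeartbeats 200000 in
theorem contDiffOn_pullbackShift [FiniteDimensional ℝ E] {V : Set E}
    {H : E → E →L[ℝ] E →L[ℝ] ℝ} (hH : ContDiffOn ℝ ∞ H V) {X : E → E} (hX : ContDiff ℝ ∞ X)
    (hmaps : ∀ s : ℝ, |s| ≤ 1 → ∀ y ∈ V, y + s • X y ∈ V) :
    ContDiffOn ℝ ∞ (fun p : ℝ × E ↦ pullbackShift H X (Real.sin p.1) p.2) (univ ×ˢ V) := by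
  rw [contDiffOn_clm_apply]
  intro a
  rw [contDiffOn_clm_apply]
  intro a'
  simp only [pullbackShift_apply]
  have hX' : ContDiff ℝ ∞ (fderiv ℝ X) := hX.fderiv_right (by simp)
  have hs : ContDiff ℝ ∞ fun p : ℝ × E ↦ Real.sin p.1 := Real.contDiff_sin.comp contDiff_fst
  have hq : ∀ c : E, ContDiff ℝ ∞ fun p : ℝ × E ↦ c + Real.sin p.1 • fderiv ℝ X p.2 c := fun c ↦
    contDiff_const.add (hs.smul ((hX'.comp contDiff_snd).clm_apply contDiff_const))
  have hp : ContDiff ℝ ∞ fun p : ℝ × E ↦ p.2 + Real.sin p.1 • X p.2 :=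
    contDiff_snd.add (hs.smul (hX.comp contDiff_snd))
  refine ((hH.comp hp.contDiffOn fun p hp ↦ ?_).clm_apply (hq a).contDiffOn).clm_apply
    (hq a').contDiffOn
  exact hmaps _ (Real.abs_sin_le_one _) _ hp.2

section IntegralSums

variable {α : Type*} [MeasurableSpace α] {μ : Measure α}

theorem integral_add_add {p q r : α → ℝ} (hp : Integrable p μ) (hq : Integrable q μ)
    (hr : Integrable r μ) :
    ∫ y, p y + q y + r y ∂μ = ∫ y, p y ∂μ + ∫ y, q y ∂μ + ∫ y, r y ∂μ := by
  rw [← integral_add hp hq]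
  exact integral_add (hp.add hq) hr

theorem integral_sub_sub {p q r : α → ℝ} (hp : Integrable p μ) (hq : Integrable q μ)
    (hr : Integrable r μ) :
    ∫ y, p y - q y - r y ∂μ = ∫ y, p y ∂μ - ∫ y, q y ∂μ - ∫ y, r y ∂μ := by
  rw [← integral_sub hp hq]
  exact integral_sub (hp.sub hq) hr

theorem integral_sum_sum {f : ι → ι → α → ℝ} (hf : ∀ i j, Integrable (f i j) μ) :
    ∫ y, ∑ i, ∑ j, f i j y ∂μ = ∑ i, ∑ j, ∫ y, f i j y ∂μ := by
  rw [integral_finsetSum _ fun i _ ↦ integrable_finsetSum _ fun j _ ↦ hf i j]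
  exact Finset.sum_congr rfl fun i _ ↦ integral_finsetSum _ fun j _ ↦ hf i j

end IntegralSums

variable [FiniteDimensional ℝ E] [MeasurableSpace E] [BorelSpace E]
  (μ : Measure E) [μ.IsAddHaarMeasure]

/-- The support of `u` has a closed `δ`-thickening inside `V`, and for small `ε` no point is moved
by more than `δ`; points off the support do not move. -/
theorem exists_smul_maps {V : Set E} (hV : IsOpen V) {u : E → ℝ} (hu : Continuous u)
    (hc : HasCompactSupport u) (hs : tsupport u ⊆ V) (v : E) :
    ∃ ε : ℝ, 0 < ε ∧ ∀ s : ℝ, |s| ≤ 1 → ∀ y ∈ V, y + s • (u y • (ε • v)) ∈ V := by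
  obtain ⟨δ, hδ, hδV⟩ := hc.isCompact.exists_cthickening_subset_open hV hs
  obtain ⟨C, hC⟩ := hc.exists_bound_of_continuous hu
  have hC0 : 0 ≤ C := (norm_nonneg _).trans (hC 0)
  -- With `C` bounding `u`, the displacement is at most `δ C‖v‖ / (C‖v‖ + 1) ≤ δ`; the `+ 1` keeps
  -- the quotient meaningful when `C‖v‖ = 0`.
  refine ⟨δ / (C * ‖v‖ + 1), by positivity, fun s hs1 y hy ↦ ?_⟩
  by_cases hyu : y ∈ tsupport u
  · refine hδV (Metric.mem_cthickening_of_dist_le _ y δ _ hyu ?_)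
    rw [dist_eq_norm, add_sub_cancel_left, norm_smul, norm_smul, norm_smul,
      Real.norm_of_nonneg (by positivity : 0 ≤ δ / (C * ‖v‖ + 1))]
    calc ‖s‖ * (‖u y‖ * (δ / (C * ‖v‖ + 1) * ‖v‖))
        ≤ 1 * (C * (δ / (C * ‖v‖ + 1) * ‖v‖)) := by
          gcongr
          · exact hs1
          · exact hC y
      _ = δ * ((C * ‖v‖) / (C * ‖v‖ + 1)) := by ring
      _ ≤ δ * 1 := by
          gcongr
          rw [div_le_one (by positivity)]
          linarith
      _ = δ := mul_one δ
  · simpa [image_eq_zero_of_notMem_tsupport hyu] using hy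

set_option synthInstance.maxHeartbeats 200000 in
/-- The weak form of the Euler-Lagrange equation for variations of the domain. -/
theorem weak_of_critical {V : Set E} (hV : IsOpen V) {G H : E → E →L[ℝ] E →L[ℝ] ℝ}
    (hG : ContDiffOn ℝ ∞ G V) (hGi : ∀ y ∈ V, IsInnerForm (G y)) (hH : ContDiffOn ℝ ∞ H V)
    (b : Module.Basis ι ℝ E)
    (hcrit : ∀ X : E → E, ContDiff ℝ ∞ X → HasCompactSupport X → tsupport X ⊆ V →
      (∀ s : ℝ, |s| ≤ 1 → ∀ y ∈ V, y + s • X y ∈ V) →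
      HasDerivAt (fun t ↦ ∫ y in tsupport X, relDensity b (G y) *
        relTrace b (G y) (pullbackShift H X (Real.sin t) y) ∂μ) 0 0)
    (u : E → ℝ) (hu : ContDiff ℝ ∞ u) (hc : HasCompactSupport u) (hs : tsupport u ⊆ V) (v : E) :
    ∫ y, relDensity b (G y) * ∑ i, ∑ j, (gramMatrix b (G y))⁻¹ i j *
      (u y * fderiv ℝ H y v (b i) (b j) + fderiv ℝ u y (b i) * H y v (b j)
        + fderiv ℝ u y (b j) * H y (b i) v) ∂μ = 0 := by
  obtain ⟨ε, hε, hmaps⟩ := exists_smul_maps hV hu.continuous hc hs v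
  set X : E → E := fun y ↦ u y • (ε • v) with hXdef
  have hX : ContDiff ℝ ∞ X := hu.smul contDiff_const
  have hXs : tsupport X ⊆ tsupport u := closure_mono fun y hy hy' ↦ hy (by simp [X, hy'])
  have hXc : HasCompactSupport X := hc.mono' (subset_tsupport X |>.trans hXs)
  have hfX : ∀ y a, fderiv ℝ X y a = fderiv ℝ u y a • (ε • v) := fun y a ↦ by
    rw [hXdef, fderiv_smul_const (hu.differentiable (by simp) y)]
    simp
  have hΦ : ContDiffOn ℝ ∞ (fun p : ℝ × E ↦ relDensity b (G p.2) *
      relTrace b (G p.2) (pullbackShift H X (Real.sin p.1) p.2)) (univ ×ˢ V) := by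
    have hG2 : ContDiffOn ℝ ∞ (fun p : ℝ × E ↦ G p.2) (univ ×ˢ V) :=
      hG.comp contDiffOn_snd fun p hp ↦ hp.2
    exact (contDiffOn_relDensity hG2 (fun p hp ↦ hGi _ hp.2) b.linearIndependent).mul
      (contDiffOn_relTrace hG2 (fun p hp ↦ hGi _ hp.2) (contDiffOn_pullbackShift hH hX hmaps)
        b.linearIndependent)
  have hKV : tsupport X ⊆ V := hXs.trans hs
  -- The derivative at `0` computed under the integral sign must agree with the zero derivative
  -- supplied by criticality.
  have hint := (hasDerivAt_integral_compact (μ := μ) hV hXc.isCompact hKV hΦ).unique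
    (hcrit X hX hXc hKV hmaps)
  have hpt : ∀ y ∈ V, fderiv ℝ (fun p : ℝ × E ↦ relDensity b (G p.2) *
      relTrace b (G p.2) (pullbackShift H X (Real.sin p.1) p.2)) (0, y) (1, 0) =
      ε * (relDensity b (G y) * ∑ i, ∑ j, (gramMatrix b (G y))⁻¹ i j *
      (u y * fderiv ℝ H y v (b i) (b j) + fderiv ℝ u y (b i) * H y v (b j)
        + fderiv ℝ u y (b j) * H y (b i) v)) := fun y hy ↦ by
    have h1 := ((hΦ.contDiffAt ((isOpen_univ.prod hV).mem_nhds
      (⟨mem_univ (0 : ℝ), hy⟩ : ((0 : ℝ), y) ∈ univ ×ˢ V))).differentiableAt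
      (by simp)).hasFDerivAt.comp_hasDerivAt (0 : ℝ)
      ((hasDerivAt_id (0 : ℝ)).prodMk (hasDerivAt_const (0 : ℝ) y))
    have hHd : DifferentiableAt ℝ H y :=
      (hH.contDiffAt (hV.mem_nhds hy)).differentiableAt (by simp)
    have h2 : HasDerivAt (fun t : ℝ ↦ relDensity b (G y) *
        relTrace b (G y) (pullbackShift H X (Real.sin t) y)) _ 0 :=
      HasDerivAt.const_mul (relDensity b (G y)) (HasDerivAt.fun_sum fun i _ ↦
        HasDerivAt.fun_sum fun j _ ↦ HasDerivAt.const_mul ((gramMatrix b (G y))⁻¹ i j)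
          (hasDerivAt_pullbackShift hHd (b i) (b j)))
    rw [h1.unique h2, mul_left_comm]
    congr 1
    rw [Finset.mul_sum]
    refine Finset.sum_congr rfl fun i _ ↦ ?_
    rw [Finset.mul_sum]
    refine Finset.sum_congr rfl fun j _ ↦ ?_
    simp only [hfX, X, map_smul, FunLike.coe_smul, Pi.smul_apply, smul_eq_mul]
    ring
  rw [setIntegral_congr_fun hXc.isCompact.measurableSet fun y hy ↦ hpt y (hKV hy),
    integral_const_mul] at hint
  have hint' := (mul_eq_zero.1 hint).resolve_left hε.ne'
  -- For `v = 0` the field `X` vanishes and its support no longer sees that of `u`, so this case is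
  -- settled by the equation itself. Otherwise both supports coincide, and the integral over the
  -- support of `X` is the integral over the whole space.
  by_cases hv : v = 0
  · simp [hv]
  have hsub : tsupport u ⊆ tsupport X := closure_mono fun y hy hy' ↦ by
    simp only [X, smul_eq_zero, hε.ne', hv, or_false] at hy'
    exact hy hy'
  rwa [setIntegral_eq_integral_of_forall_compl_eq_zero] at hint'
  intro y hy
  have hyu : y ∉ tsupport u := fun h ↦ hy (hsub h)
  simp [image_eq_zero_of_notMem_tsupport hyu, fderiv_of_notMem_tsupport ℝ hyu]

set_option synthInstance.maxHeartbeats 200000 in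
/-- The strong form of the Euler-Lagrange equation for variations of the domain. -/
theorem euler_of_weak {V : Set E} (hV : IsOpen V) {G H : E → E →L[ℝ] E →L[ℝ] ℝ}
    (hG : ContDiffOn ℝ ∞ G V) (hGi : ∀ y ∈ V, IsInnerForm (G y)) (hH : ContDiffOn ℝ ∞ H V)
    (b : Module.Basis ι ℝ E) (v : E)
    (hweak : ∀ u : E → ℝ, ContDiff ℝ ∞ u → HasCompactSupport u → tsupport u ⊆ V →
      ∫ y, relDensity b (G y) * ∑ i, ∑ j, (gramMatrix b (G y))⁻¹ i j *
        (u y * fderiv ℝ H y v (b i) (b j) + fderiv ℝ u y (b i) * H y v (b j)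
          + fderiv ℝ u y (b j) * H y (b i) v) ∂μ = 0) :
    ∀ y ∈ V, ∑ i, ∑ j, (relDensity b (G y) * (gramMatrix b (G y))⁻¹ i j *
        fderiv ℝ H y v (b i) (b j)
      - fderiv ℝ (fun z ↦ relDensity b (G z) * (gramMatrix b (G z))⁻¹ i j * H z v (b j)) y (b i)
      - fderiv ℝ (fun z ↦ relDensity b (G z) * (gramMatrix b (G z))⁻¹ i j * H z (b i) v) y (b j))
      = 0 := by
  have hW : ∀ i j, ContDiffOn ℝ ∞ (fun z ↦ relDensity b (G z) * (gramMatrix b (G z))⁻¹ i j) V :=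
    fun i j ↦ (contDiffOn_relDensity hG hGi b.linearIndependent).mul
      (contDiffOn_gramMatrix_inv hG hGi b.linearIndependent i j)
  have hHa : ∀ a a', ContDiffOn ℝ ∞ (fun z ↦ H z a a') V := fun a a' ↦
    (hH.clm_apply contDiffOn_const).clm_apply contDiffOn_const
  have hB : ∀ i j a a', ContDiffOn ℝ ∞ (fun z ↦ relDensity b (G z) *
      (gramMatrix b (G z))⁻¹ i j * H z a a') V := fun i j a a' ↦ (hW i j).mul (hHa a a')
  have hBd : ∀ i j a a' c, ContinuousOn (fun y ↦ fderiv ℝ (fun z ↦ relDensity b (G z) *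
      (gramMatrix b (G z))⁻¹ i j * H z a a') y c) V := fun i j a a' c ↦
    ((hB i j a a').continuousOn_fderiv_of_isOpen hV (by simp)).clm_apply continuousOn_const
  have hA : ∀ i j, ContinuousOn (fun y ↦ relDensity b (G y) * (gramMatrix b (G y))⁻¹ i j *
      fderiv ℝ H y v (b i) (b j)) V := fun i j ↦
    (hW i j).continuousOn.mul ((((hH.continuousOn_fderiv_of_isOpen hV (by simp)).clm_apply
      continuousOn_const).clm_apply continuousOn_const).clm_apply continuousOn_const)
  -- Tested against `u`, the left-hand side is what the weak equation becomes once both derivatives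
  -- of `u` are moved onto the coefficients.
  refine eq_zero_of_integral_test_eq_zero (μ := μ) hV
    (continuousOn_finsetSum _ fun i _ ↦ continuousOn_finsetSum _ fun j _ ↦
      ((hA i j).sub (hBd i j v (b j) (b i))).sub (hBd i j (b i) v (b j))) fun u hu hc hs ↦ ?_
  have hud : ∀ a, Continuous fun x ↦ fderiv ℝ u x a := fun a ↦
    (hu.continuous_fderiv (by simp)).clm_apply continuous_const
  have huc : ∀ a, HasCompactSupport fun x ↦ fderiv ℝ u x a := fun a ↦ hc.fderiv_apply ℝ a
  have hus : ∀ a, tsupport (fun x ↦ fderiv ℝ u x a) ⊆ V := fun a ↦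
    (tsupport_fderiv_apply_subset u a).trans hs
  have i1 := fun i j ↦ integrable_mul_of_tsupport_subset (μ := μ) hV hu.continuous hc hs (hA i j)
  have i2 := fun i j a a' c ↦
    integrable_mul_of_tsupport_subset (μ := μ) hV hu.continuous hc hs (hBd i j a a' c)
  have i3 := fun i j a a' c ↦ integrable_mul_of_tsupport_subset (μ := μ) hV (hud c) (huc c) (hus c)
    (hB i j a a').continuousOn
  have hw := hweak u hu hc hs
  have e1 : ∀ y, relDensity b (G y) * ∑ i, ∑ j, (gramMatrix b (G y))⁻¹ i j *
        (u y * fderiv ℝ H y v (b i) (b j) + fderiv ℝ u y (b i) * H y v (b j)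
          + fderiv ℝ u y (b j) * H y (b i) v) =
      ∑ i, ∑ j, (u y * (relDensity b (G y) * (gramMatrix b (G y))⁻¹ i j *
        fderiv ℝ H y v (b i) (b j)) +
        fderiv ℝ u y (b i) * (relDensity b (G y) * (gramMatrix b (G y))⁻¹ i j * H y v (b j)) +
        fderiv ℝ u y (b j) * (relDensity b (G y) * (gramMatrix b (G y))⁻¹ i j * H y (b i) v)) :=
    fun y ↦ by
      rw [Finset.mul_sum]
      refine Finset.sum_congr rfl fun i _ ↦ ?_
      rw [Finset.mul_sum]
      refine Finset.sum_congr rfl fun j _ ↦ ?_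
      ring
  simp only [e1] at hw
  have j1 : ∀ i j, Integrable (fun y ↦ u y * (relDensity b (G y) * (gramMatrix b (G y))⁻¹ i j *
        fderiv ℝ H y v (b i) (b j)) +
        fderiv ℝ u y (b i) * (relDensity b (G y) * (gramMatrix b (G y))⁻¹ i j * H y v (b j)) +
        fderiv ℝ u y (b j) * (relDensity b (G y) * (gramMatrix b (G y))⁻¹ i j * H y (b i) v)) μ :=
    fun i j ↦ ((i1 i j).add (i3 i j v (b j) (b i))).add (i3 i j (b i) v (b j))
  have j2 : ∀ i j, Integrable (fun y ↦ u y * (relDensity b (G y) * (gramMatrix b (G y))⁻¹ i j *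
        fderiv ℝ H y v (b i) (b j)) -
      u y * fderiv ℝ (fun z ↦ relDensity b (G z) * (gramMatrix b (G z))⁻¹ i j * H z v (b j)) y (b i)
      - u y * fderiv ℝ (fun z ↦ relDensity b (G z) * (gramMatrix b (G z))⁻¹ i j * H z (b i) v)
        y (b j)) μ :=
    fun i j ↦ ((i1 i j).sub (i2 i j v (b j) (b i))).sub (i2 i j (b i) v (b j))
  rw [integral_sum_sum j1] at hw
  simp only [Finset.mul_sum, mul_sub]
  rw [integral_sum_sum j2, ← hw]
  refine Finset.sum_congr rfl fun i _ ↦ Finset.sum_congr rfl fun j _ ↦ ?_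
  rw [integral_add_add (i1 i j) (i3 i j v (b j) (b i)) (i3 i j (b i) v (b j)),
    integral_sub_sub (i1 i j) (i2 i j v (b j) (b i)) (i2 i j (b i) v (b j)),
    integral_mul_fderiv_of_tsupport_subset hV hu hc hs (hB i j v (b j)),
    integral_mul_fderiv_of_tsupport_subset hV hu hc hs (hB i j (b i) v)]
  ring

/-- The Euler-Lagrange equation for variations of the domain, at a point where the basis is
orthonormal. -/
theorem euler_orthonormal {V : Set E} (hV : IsOpen V) {G H : E → E →L[ℝ] E →L[ℝ] ℝ}
    (hG : ContDiffOn ℝ ∞ G V) (hGi : ∀ y ∈ V, IsInnerForm (G y)) (hH : ContDiffOn ℝ ∞ H V)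
    (hsymm : ∀ y a a', H y a a' = H y a' a)
    (b : Module.Basis ι ℝ E) (v : E) {y : E} (hy : y ∈ V) (hone : gramMatrix b (G y) = 1)
    (heuler : ∑ i, ∑ j, (relDensity b (G y) * (gramMatrix b (G y))⁻¹ i j *
        fderiv ℝ H y v (b i) (b j)
      - fderiv ℝ (fun z ↦ relDensity b (G z) * (gramMatrix b (G z))⁻¹ i j * H z v (b j)) y (b i)
      - fderiv ℝ (fun z ↦ relDensity b (G z) * (gramMatrix b (G z))⁻¹ i j * H z (b i) v) y (b j))
      = 0) :
    ∑ i, fderiv ℝ H y v (b i) (b i) =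
      ∑ i, ∑ j, fderiv ℝ G y (b i) (b j) (b j) * H y v (b i)
      - 2 * ∑ i, ∑ j, fderiv ℝ G y (b i) (b i) (b j) * H y v (b j)
      + 2 * ∑ i, fderiv ℝ H y (b i) v (b i) := by
  have hGd : DifferentiableAt ℝ G y := (hG.contDiffAt (hV.mem_nhds hy)).differentiableAt (by simp)
  have hHd : DifferentiableAt ℝ H y := (hH.contDiffAt (hV.mem_nhds hy)).differentiableAt (by simp)
  have hDd : DifferentiableAt ℝ (fun z ↦ relDensity b (G z)) y :=
    ((contDiffOn_relDensity hG hGi b.linearIndependent).contDiffAt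
      (hV.mem_nhds hy)).differentiableAt (by simp)
  have hgd : ∀ i j, DifferentiableAt ℝ (fun z ↦ (gramMatrix b (G z))⁻¹ i j) y := fun i j ↦
    ((contDiffOn_gramMatrix_inv hG hGi b.linearIndependent i j).contDiffAt
      (hV.mem_nhds hy)).differentiableAt (by simp)
  have hHa : ∀ a a', DifferentiableAt ℝ (fun z ↦ H z a a') y := fun a a' ↦
    (hHd.clm_apply (differentiableAt_const _)).clm_apply (differentiableAt_const _)
  have hD1 : relDensity b (G y) = 1 := by simp [relDensity, hone]
  -- At the orthonormal point the density is `1` with derivative `½ ∑ₖ G'(bₖ, bₖ)`, and the inverse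
  -- Gram matrix is the identity with derivative `-G'`. The two derivatives account for the diagonal
  -- and the off-diagonal correction.
  have hder : ∀ i j a a' c, fderiv ℝ (fun z ↦ relDensity b (G z) * (gramMatrix b (G z))⁻¹ i j *
      H z a a') y c = (if i = j then 1 / 2 * (∑ k, fderiv ℝ G y c (b k) (b k)) * H y a a' +
        fderiv ℝ H y c a a' else 0) - fderiv ℝ G y c (b i) (b j) * H y a a' := fun i j a a' c ↦ by
    rw [fderiv_fun_mul (hDd.fun_mul (hgd i j)) (hHa a a'), fderiv_fun_mul hDd (hgd i j)]
    have ht : relTrace b (G y) (fderiv ℝ G y c) = ∑ k, fderiv ℝ G y c (b k) (b k) := by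
      simp [relTrace, hone, Matrix.one_apply]
    simp only [FunLike.coe_add, Pi.add_apply, FunLike.coe_smul, Pi.smul_apply, smul_eq_mul,
      fderiv_clm_apply₂ hHd, fderiv_relDensity hGd (hGi y hy) b.linearIndependent,
      fderiv_gramMatrix_inv hV hG hGi b.linearIndependent hy hone, hD1, hone, inv_one, ht,
      Matrix.one_apply]
    split_ifs <;> ring
  simp only [hder, hD1, hone, inv_one, Matrix.one_apply, one_mul, ite_mul, zero_mul,
    Finset.sum_sub_distrib, Finset.sum_ite_eq, Finset.mem_univ, if_true,
    Finset.sum_add_distrib] at heuler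
  have hGs : ∀ c a a', fderiv ℝ G y c a a' = fderiv ℝ G y c a' a := fun c a a' ↦ by
    rw [← fderiv_clm_apply₂ hGd, ← fderiv_clm_apply₂ hGd]
    have : (fun z ↦ G z a a') =ᶠ[𝓝 y] fun z ↦ G z a' a := by
      filter_upwards [hV.mem_nhds hy] with z hz using (hGi z hz).symm a a'
    rw [this.fderiv_eq]
  have hHs : ∀ c a a', fderiv ℝ H y c a a' = fderiv ℝ H y c a' a := fun c a a' ↦ by
    rw [← fderiv_clm_apply₂ hHd, ← fderiv_clm_apply₂ hHd]
    simp only [hsymm _ a a']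
  -- The two divergence terms of the equation are mirror images under the symmetry of `G` and `H`;
  -- `s1`, `s2` and `s3` identify them, which produces the factors `2`.
  have s1 : ∑ i, ∑ j, fderiv ℝ G y (b j) (b i) (b j) * H y (b i) v =
      ∑ i, ∑ j, fderiv ℝ G y (b i) (b i) (b j) * H y v (b j) := by
    rw [Finset.sum_comm]
    refine Finset.sum_congr rfl fun i _ ↦ Finset.sum_congr rfl fun j _ ↦ ?_
    rw [hGs, hsymm]
  have s2 : ∑ i, 1 / 2 * (∑ k, fderiv ℝ G y (b i) (b k) (b k)) * H y (b i) v =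
      ∑ i, 1 / 2 * (∑ k, fderiv ℝ G y (b i) (b k) (b k)) * H y v (b i) :=
    Finset.sum_congr rfl fun i _ ↦ by rw [hsymm]
  have s3 : ∑ i, fderiv ℝ H y (b i) (b i) v = ∑ i, fderiv ℝ H y (b i) v (b i) :=
    Finset.sum_congr rfl fun i _ ↦ by rw [hHs]
  have s4 : ∑ i, ∑ j, fderiv ℝ G y (b i) (b j) (b j) * H y v (b i) =
      2 * ∑ i, 1 / 2 * (∑ k, fderiv ℝ G y (b i) (b k) (b k)) * H y v (b i) := by
    rw [Finset.mul_sum]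
    refine Finset.sum_congr rfl fun i _ ↦ ?_
    rw [← Finset.sum_mul]
    ring
  rw [s1, s2, s3] at heuler
  rw [s4]
  linarith

end FirstVariation

/-! ### Coordinate frames, and tensors read in charts. -/

section Frame

variable {n : ℕ} {M : Type*} [TopologicalSpace M] [ChartedSpace (EuclideanSpace ℝ (Fin n)) M]
  [IsManifold (𝓡 n) ∞ M]

variable (n) in
/-- The frame of the tangent bundle given by the chart at `c`. -/
def frame (c x : M) : EuclideanSpace ℝ (Fin n) →L[ℝ] TangentSpace (𝓡 n) x :=
  (trivializationAt (EuclideanSpace ℝ (Fin n)) (TangentSpace (𝓡 n)) c).symmL ℝ x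

variable (n) in
/-- The components of a tangent vector in the chart at `c`. -/
def coframe (c x : M) : TangentSpace (𝓡 n) x →L[ℝ] EuclideanSpace ℝ (Fin n) :=
  (trivializationAt (EuclideanSpace ℝ (Fin n)) (TangentSpace (𝓡 n)) c).continuousLinearMapAt ℝ x

theorem coframe_frame {c x : M} (hx : x ∈ (chartAt (EuclideanSpace ℝ (Fin n)) c).source)
    (a : EuclideanSpace ℝ (Fin n)) : coframe n c x (frame n c x a) = a :=
  (trivializationAt (EuclideanSpace ℝ (Fin n))
    (TangentSpace (𝓡 n)) c).continuousLinearMapAt_symmL (R := ℝ) (by simpa using hx) a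

theorem frame_coframe {c x : M} (hx : x ∈ (chartAt (EuclideanSpace ℝ (Fin n)) c).source)
    (v : TangentSpace (𝓡 n) x) : frame n c x (coframe n c x v) = v :=
  (trivializationAt (EuclideanSpace ℝ (Fin n))
    (TangentSpace (𝓡 n)) c).symmL_continuousLinearMapAt (R := ℝ) (by simpa using hx) v

/-- The chart frame as a linear equivalence. -/
def frameEquiv {c x : M} (hx : x ∈ (chartAt (EuclideanSpace ℝ (Fin n)) c).source) :
    EuclideanSpace ℝ (Fin n) ≃L[ℝ] TangentSpace (𝓡 n) x :=
  ContinuousLinearEquiv.equivOfInverse (frame n c x) (coframe n c x) (coframe_frame hx)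
    (frame_coframe hx)

theorem contMDiffOn_frame (c : M) (a : EuclideanSpace ℝ (Fin n)) :
    ContMDiffOn (𝓡 n) ((𝓡 n).prod 𝓘(ℝ, EuclideanSpace ℝ (Fin n))) ∞
      (fun x ↦ TotalSpace.mk' (EuclideanSpace ℝ (Fin n)) (E := TangentSpace (𝓡 n)) x
        (frame n c x a)) (chartAt (EuclideanSpace ℝ (Fin n)) c).source := by
  have h := (trivializationAt (EuclideanSpace ℝ (Fin n))
    (TangentSpace (𝓡 n) : M → Type _) c).contMDiffOn_symmL (n := ∞) (IB := 𝓡 n) (𝕜 := ℝ)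
  have h2 : ContMDiffOn (𝓡 n) ((𝓡 n).prod 𝓘(ℝ, EuclideanSpace ℝ (Fin n))) ∞
      (fun x : M ↦ TotalSpace.mk' (EuclideanSpace ℝ (Fin n))
        (E := Bundle.Trivial M (EuclideanSpace ℝ (Fin n))) x a)
      (trivializationAt (EuclideanSpace ℝ (Fin n))
        (TangentSpace (𝓡 n) : M → Type _) c).baseSet := by
    refine ContMDiff.contMDiffOn ?_
    intro x
    rw [Bundle.contMDiffAt_totalSpace]
    exact ⟨contMDiffAt_id, contMDiffAt_const⟩
  have := h.clm_bundle_apply h2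
  simpa [frame] using! this

theorem frame_mdifferentiableAt {c x : M}
    (hx : x ∈ (chartAt (EuclideanSpace ℝ (Fin n)) c).source) (a : EuclideanSpace ℝ (Fin n)) :
    MDifferentiableAt (𝓡 n) ((𝓡 n).prod 𝓘(ℝ, EuclideanSpace ℝ (Fin n)))
      (fun x ↦ TotalSpace.mk' (EuclideanSpace ℝ (Fin n)) (E := TangentSpace (𝓡 n)) x
        (frame n c x a)) x :=
  ((contMDiffOn_frame c a).contMDiffAt
    ((chartAt _ c).open_source.mem_nhds hx)).mdifferentiableAt (by simp)

/-- This ties the bundle trivialization, through which smoothness of sections is expressed, to the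
coordinate vectors that enter the volume density and the chain rule. -/
theorem mfderiv_chart_symm {c : M} {y : EuclideanSpace ℝ (Fin n)}
    (hy : y ∈ (chartAt (EuclideanSpace ℝ (Fin n)) c).target) :
    mfderiv (𝓡 n) (𝓡 n) (chartAt (EuclideanSpace ℝ (Fin n)) c).symm y =
      frame n c ((chartAt (EuclideanSpace ℝ (Fin n)) c).symm y) := by
  have h := TangentBundle.symmL_trivializationAt (I := 𝓡 n) (𝕜 := ℝ)
    ((chartAt (EuclideanSpace ℝ (Fin n)) c).map_target hy)
  rw [frame, h]
  have e : extChartAt (𝓡 n) c ((chartAt (EuclideanSpace ℝ (Fin n)) c).symm y) = y := by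
    simp [mfld_simps, (chartAt (EuclideanSpace ℝ (Fin n)) c).right_inv hy]
  rw [e]
  simp only [mfld_simps, mfderivWithin_univ]

theorem contDiffOn_comp_chart_symm {F : Type*} [NormedAddCommGroup F] [NormedSpace ℝ F] {c : M}
    {k : M → F}
    (hk : ContMDiffOn (𝓡 n) 𝓘(ℝ, F) ∞ k (chartAt (EuclideanSpace ℝ (Fin n)) c).source) :
    ContDiffOn ℝ ∞ (k ∘ (chartAt (EuclideanSpace ℝ (Fin n)) c).symm)
      (chartAt (EuclideanSpace ℝ (Fin n)) c).target := by
  rw [← contMDiffOn_iff_contDiffOn]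
  exact hk.comp contMDiffOn_chart_symm fun y hy ↦ (chartAt _ c).map_target hy

theorem mvfderiv_frame {c : M} {y : EuclideanSpace ℝ (Fin n)}
    (hy : y ∈ (chartAt (EuclideanSpace ℝ (Fin n)) c).target) {k : M → ℝ}
    (hk : MDifferentiableAt (𝓡 n) 𝓘(ℝ, ℝ) k ((chartAt (EuclideanSpace ℝ (Fin n)) c).symm y))
    (a : EuclideanSpace ℝ (Fin n)) :
    mvfderiv (𝓡 n) k ((chartAt (EuclideanSpace ℝ (Fin n)) c).symm y)
      (frame n c ((chartAt (EuclideanSpace ℝ (Fin n)) c).symm y) a) =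
      fderiv ℝ (k ∘ (chartAt (EuclideanSpace ℝ (Fin n)) c).symm) y a := by
  have h1 : MDifferentiableAt (𝓡 n) (𝓡 n) (chartAt (EuclideanSpace ℝ (Fin n)) c).symm y :=
    mdifferentiableAt_atlas_symm (chart_mem_atlas _ c) hy
  have h := mvfderiv_comp_apply (I := 𝓡 n) (I' := 𝓡 n) y hk h1 a
  rw [mfderiv_chart_symm hy] at h
  refine h.symm.trans ?_
  rw [← mfderiv_eq_fderiv]
  rfl

theorem coordVector_eq_frame {c : M} {y : EuclideanSpace ℝ (Fin n)}
    (hy : y ∈ (chartAt (EuclideanSpace ℝ (Fin n)) c).target) (i : Fin n) :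
    coordVector c y i = frame n c ((chartAt (EuclideanSpace ℝ (Fin n)) c).symm y)
      (EuclideanSpace.single i (1 : ℝ)) := by
  rw [coordVector, mfderiv_chart_symm hy]
  rfl

variable [RiemannianBundle (fun x : M ↦ TangentSpace (𝓡 n) x)]

/-- The expression of a two-form in the chart at `c`. -/
def chartForm (c : M)
    (φ : Π x : M, TangentSpace (𝓡 n) x →L[ℝ] TangentSpace (𝓡 n) x →L[ℝ] ℝ)
    (y : EuclideanSpace ℝ (Fin n)) :
    EuclideanSpace ℝ (Fin n) →L[ℝ] EuclideanSpace ℝ (Fin n) →L[ℝ] ℝ :=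
  (φ ((chartAt (EuclideanSpace ℝ (Fin n)) c).symm y)).bilinearComp
    (frame n c ((chartAt (EuclideanSpace ℝ (Fin n)) c).symm y))
    (frame n c ((chartAt (EuclideanSpace ℝ (Fin n)) c).symm y))

theorem chartForm_apply (c : M)
    (φ : Π x : M, TangentSpace (𝓡 n) x →L[ℝ] TangentSpace (𝓡 n) x →L[ℝ] ℝ)
    (y a a' : EuclideanSpace ℝ (Fin n)) :
    chartForm c φ y a a' = φ ((chartAt (EuclideanSpace ℝ (Fin n)) c).symm y)
      (frame n c ((chartAt (EuclideanSpace ℝ (Fin n)) c).symm y) a)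
      (frame n c ((chartAt (EuclideanSpace ℝ (Fin n)) c).symm y) a') := rfl

/-- Smoothness of a two-form, in terms of its components in the charts. -/
def HasSmoothComponents
    (φ : Π x : M, TangentSpace (𝓡 n) x →L[ℝ] TangentSpace (𝓡 n) x →L[ℝ] ℝ) : Prop :=
  ∀ (c : M) (a a' : EuclideanSpace ℝ (Fin n)), ContMDiffOn (𝓡 n) 𝓘(ℝ, ℝ) ∞
    (fun x ↦ φ x (frame n c x a) (frame n c x a'))
    (chartAt (EuclideanSpace ℝ (Fin n)) c).source

set_option synthInstance.maxHeartbeats 200000 in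
theorem HasSmoothComponents.contDiffOn
    {φ : Π x : M, TangentSpace (𝓡 n) x →L[ℝ] TangentSpace (𝓡 n) x →L[ℝ] ℝ}
    (hφ : HasSmoothComponents φ) (c : M) :
    ContDiffOn ℝ ∞ (chartForm c φ) (chartAt (EuclideanSpace ℝ (Fin n)) c).target := by
  rw [contDiffOn_clm_apply]
  intro a
  rw [contDiffOn_clm_apply]
  intro a'
  exact contDiffOn_comp_chart_symm (hφ c a a')

theorem IsSmoothSymmTwoForm.hasSmoothComponents
    {φ : Π x : M, TangentSpace (𝓡 n) x →L[ℝ] TangentSpace (𝓡 n) x →L[ℝ] ℝ}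
    (hφ : IsSmoothSymmTwoForm (𝓡 n) φ) : HasSmoothComponents φ := by
  intro c a a' x hx
  have h := ContMDiffOn.clm_bundle_apply₂ (F₃ := ℝ) (E₃ := Bundle.Trivial M ℝ)
    hφ.1.contMDiffOn (contMDiffOn_frame c a) (contMDiffOn_frame c a')
  exact ((Bundle.contMDiffWithinAt_totalSpace).1 (h x hx)).2

section Metric

variable (n M) in
/-- The metric as a two-form. -/
def metricForm (x : M) : TangentSpace (𝓡 n) x →L[ℝ] TangentSpace (𝓡 n) x →L[ℝ] ℝ :=
  innerSL ℝ (E := TangentSpace (𝓡 n) x)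

theorem metricForm_apply (x : M) (v w : TangentSpace (𝓡 n) x) :
    metricForm n M x v w = inner ℝ v w := rfl

variable [IsContMDiffRiemannianBundle (𝓡 n) ∞ (EuclideanSpace ℝ (Fin n))
    (fun x : M ↦ TangentSpace (𝓡 n) x)]

theorem hasSmoothComponents_metricForm : HasSmoothComponents (metricForm n M) := fun c a a' ↦
  ContMDiffOn.inner_bundle (IB := 𝓡 n) (F := EuclideanSpace ℝ (Fin n))
    (E := fun y : M ↦ TangentSpace (𝓡 n) y) (b := fun y ↦ y)
    (contMDiffOn_frame c a) (contMDiffOn_frame c a')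

theorem isInnerForm_chartForm_metricForm {c : M} {y : EuclideanSpace ℝ (Fin n)}
    (hy : y ∈ (chartAt (EuclideanSpace ℝ (Fin n)) c).target) :
    IsInnerForm (chartForm c (metricForm n M) y) := by
  refine ⟨fun v w ↦ ?_, fun v hv ↦ ?_⟩
  · simp only [chartForm_apply, metricForm_apply]
    exact real_inner_comm _ _
  have hx := (chartAt (EuclideanSpace ℝ (Fin n)) c).map_target hy
  refine (real_inner_self_pos (x := frame n c _ v)).2 fun h ↦ hv ?_
  rw [← coframe_frame hx v, h, map_zero]

theorem metricTrace_eq_relTrace {c : M} {y : EuclideanSpace ℝ (Fin n)}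
    (hy : y ∈ (chartAt (EuclideanSpace ℝ (Fin n)) c).target)
    (φ : Π x : M, TangentSpace (𝓡 n) x →L[ℝ] TangentSpace (𝓡 n) x →L[ℝ] ℝ)
    (b : Module.Basis (Fin n) ℝ (EuclideanSpace ℝ (Fin n))) :
    metricTrace (φ ((chartAt (EuclideanSpace ℝ (Fin n)) c).symm y)) =
      relTrace b (chartForm c (metricForm n M) y) (chartForm c φ y) :=
  sum_orthonormal_eq_relTrace (orthoBasis (𝓡 n) _) b
    (frameEquiv ((chartAt (EuclideanSpace ℝ (Fin n)) c).map_target hy))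
    (chartForm c (metricForm n M) y) (fun _ _ ↦ rfl) _

/-- The orthonormal bases are chosen separately at each point and need not vary smoothly. The
formula `∑ G^{ij} φ_{ij}` replaces them by the coordinate frame, where smoothness is visible. -/
theorem contMDiff_metricTrace
    {φ : Π x : M, TangentSpace (𝓡 n) x →L[ℝ] TangentSpace (𝓡 n) x →L[ℝ] ℝ}
    (hφ : HasSmoothComponents φ) :
    ContMDiff (𝓡 n) 𝓘(ℝ, ℝ) ∞ fun x ↦ metricTrace (φ x) := by
  intro c
  set b := (EuclideanSpace.basisFun (Fin n) ℝ).toBasis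
  have h1 : ContMDiffOn (𝓡 n) 𝓘(ℝ, ℝ) ∞
      (fun y ↦ relTrace b (chartForm c (metricForm n M) y) (chartForm c φ y))
      (chartAt (EuclideanSpace ℝ (Fin n)) c).target :=
    (contDiffOn_relTrace (hasSmoothComponents_metricForm.contDiffOn c)
      (fun y hy ↦ isInnerForm_chartForm_metricForm hy) (hφ.contDiffOn c)
      b.linearIndependent).contMDiffOn
  have h2 := h1.comp (contMDiffOn_chart (I := 𝓡 n) (n := ∞) (x := c))
    fun x hx ↦ (chartAt _ c).map_source hx
  refine (h2.contMDiffAt ((chartAt _ c).open_source.mem_nhds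
    (mem_chart_source _ c))).congr_of_eventuallyEq ?_
  filter_upwards [(chartAt (EuclideanSpace ℝ (Fin n)) c).open_source.mem_nhds
    (mem_chart_source _ c)] with x hx
  have := metricTrace_eq_relTrace ((chartAt (EuclideanSpace ℝ (Fin n)) c).map_source hx) φ b
  rw [(chartAt (EuclideanSpace ℝ (Fin n)) c).left_inv hx] at this
  exact this

end Metric

section Pullback

variable {m : ℕ} {N : Type*} [TopologicalSpace N] [ChartedSpace (EuclideanSpace ℝ (Fin m)) N]
  [IsManifold (𝓡 m) ∞ N] [RiemannianBundle (fun x : N ↦ TangentSpace (𝓡 m) x)]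
  [IsContMDiffRiemannianBundle (𝓡 m) ∞ (EuclideanSpace ℝ (Fin m))
    (fun x : N ↦ TangentSpace (𝓡 m) x)]

theorem pullbackMetric_apply (f : M → N) (x : M) (v w : TangentSpace (𝓡 n) x) :
    pullbackMetric n m f x v w = metricForm m N (f x) (mfderiv (𝓡 n) (𝓡 m) f x v)
      (mfderiv (𝓡 n) (𝓡 m) f x w) := rfl

/-- The tangent map of `f` carries the smooth frame fields to smooth sections along `f`, whose inner
products are smooth. -/
theorem hasSmoothComponents_pullbackMetric {f : M → N} (hf : ContMDiff (𝓡 n) (𝓡 m) ∞ f) :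
    HasSmoothComponents (pullbackMetric n m f) := fun c a a' ↦ by
  have ht : ContMDiff (𝓡 n).tangent (𝓡 m).tangent ∞ (tangentMap (𝓡 n) (𝓡 m) f) :=
    hf.contMDiff_tangentMap (by simp)
  have hs : ∀ a, ContMDiffOn (𝓡 n) ((𝓡 m).prod 𝓘(ℝ, EuclideanSpace ℝ (Fin m))) ∞
      (fun x ↦ TotalSpace.mk' (EuclideanSpace ℝ (Fin m)) (E := fun y : N ↦ TangentSpace (𝓡 m) y)
        (f x) (mfderiv (𝓡 n) (𝓡 m) f x (frame n c x a)))
      (chartAt (EuclideanSpace ℝ (Fin n)) c).source := fun a ↦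
    ht.comp_contMDiffOn (contMDiffOn_frame c a)
  exact ContMDiffOn.inner_bundle (IB := 𝓡 m) (F := EuclideanSpace ℝ (Fin m))
    (E := fun y : N ↦ TangentSpace (𝓡 m) y) (b := f) (hs a) (hs a')

theorem contMDiff_energyDensity
    [IsContMDiffRiemannianBundle (𝓡 n) ∞ (EuclideanSpace ℝ (Fin n))
      (fun x : M ↦ TangentSpace (𝓡 n) x)] {f : M → N} (hf : ContMDiff (𝓡 n) (𝓡 m) ∞ f) :
    ContMDiff (𝓡 n) 𝓘(ℝ, ℝ) ∞ (energyDensity n m f) :=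
  contMDiff_metricTrace (hasSmoothComponents_pullbackMetric hf)

end Pullback

end Frame

/-! ### The Riemannian volume measure in charts. -/

section Volume

variable {n : ℕ} {M : Type*} [TopologicalSpace M] [ChartedSpace (EuclideanSpace ℝ (Fin n)) M]
  [IsManifold (𝓡 n) ∞ M] [RiemannianBundle (fun x : M ↦ TangentSpace (𝓡 n) x)]

variable (n) in
/-- The standard basis of Euclidean space. -/
def stdBasis : Module.Basis (Fin n) ℝ (EuclideanSpace ℝ (Fin n)) :=
  (EuclideanSpace.basisFun (Fin n) ℝ).toBasis

theorem volumeDensity_eq_relDensity {c : M} {y : EuclideanSpace ℝ (Fin n)}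
    (hy : y ∈ (chartAt (EuclideanSpace ℝ (Fin n)) c).target) :
    volumeDensity c y = relDensity (stdBasis n) (chartForm c (metricForm n M) y) := by
  rw [volumeDensity, relDensity]
  congr 2
  ext i j
  simp only [Matrix.of_apply, gramMatrix, coordVector_eq_frame hy, chartForm_apply,
    metricForm_apply, stdBasis, OrthonormalBasis.coe_toBasis, EuclideanSpace.basisFun_apply]

/-- Its determinant is the Jacobian in the change of variables between two charts, written so as to
match the transformation of the Gram matrix. -/
theorem fderiv_chart_transition {c c' : M} {y : EuclideanSpace ℝ (Fin n)}
    (hy : y ∈ (chartAt (EuclideanSpace ℝ (Fin n)) c).target)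
    (hy' : (chartAt (EuclideanSpace ℝ (Fin n)) c).symm y ∈
      (chartAt (EuclideanSpace ℝ (Fin n)) c').source) :
    HasFDerivAt (chartAt (EuclideanSpace ℝ (Fin n)) c' ∘
        (chartAt (EuclideanSpace ℝ (Fin n)) c).symm)
      ((coframe n c' ((chartAt (EuclideanSpace ℝ (Fin n)) c).symm y)).comp
        (frame n c ((chartAt (EuclideanSpace ℝ (Fin n)) c).symm y))) y := by
  have h1 : MDifferentiableAt (𝓡 n) (𝓡 n) (chartAt (EuclideanSpace ℝ (Fin n)) c).symm y :=
    mdifferentiableAt_atlas_symm (chart_mem_atlas _ c) hy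
  have h2 : MDifferentiableAt (𝓡 n) (𝓡 n) (chartAt (EuclideanSpace ℝ (Fin n)) c')
      ((chartAt (EuclideanSpace ℝ (Fin n)) c).symm y) :=
    mdifferentiableAt_atlas (chart_mem_atlas _ c') hy'
  have h3 := mfderiv_comp y h2 h1
  have h4 : mfderiv (𝓡 n) (𝓡 n) (chartAt (EuclideanSpace ℝ (Fin n)) c')
      ((chartAt (EuclideanSpace ℝ (Fin n)) c).symm y) =
      coframe n c' ((chartAt (EuclideanSpace ℝ (Fin n)) c).symm y) := by
    rw [coframe, TangentBundle.continuousLinearMapAt_trivializationAt hy']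
    simp only [mfld_simps]
  rw [h4, mfderiv_chart_symm hy, mfderiv_eq_fderiv] at h3
  have h5 := (mdifferentiableAt_iff_differentiableAt.1 (h2.comp y h1)).hasFDerivAt
  exact h3 ▸ h5

theorem chartForm_transition
    (φ : Π x : M, TangentSpace (𝓡 n) x →L[ℝ] TangentSpace (𝓡 n) x →L[ℝ] ℝ)
    {c c' : M} {y : EuclideanSpace ℝ (Fin n)}
    (hy' : (chartAt (EuclideanSpace ℝ (Fin n)) c).symm y ∈
      (chartAt (EuclideanSpace ℝ (Fin n)) c').source) :
    chartForm c φ y = (chartForm c' φ (chartAt (EuclideanSpace ℝ (Fin n)) c'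
      ((chartAt (EuclideanSpace ℝ (Fin n)) c).symm y))).bilinearComp
      ((coframe n c' ((chartAt (EuclideanSpace ℝ (Fin n)) c).symm y)).comp
        (frame n c ((chartAt (EuclideanSpace ℝ (Fin n)) c).symm y)))
      ((coframe n c' ((chartAt (EuclideanSpace ℝ (Fin n)) c).symm y)).comp
        (frame n c ((chartAt (EuclideanSpace ℝ (Fin n)) c).symm y))) := by
  ext a a'
  simp only [ContinuousLinearMap.bilinearComp_apply, chartForm_apply,
    ContinuousLinearMap.comp_apply]
  rw [(chartAt (EuclideanSpace ℝ (Fin n)) c').left_inv hy']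
  rw [frame_coframe hy', frame_coframe hy']

theorem volumeDensity_transition {c c' : M} {y : EuclideanSpace ℝ (Fin n)}
    (hy : y ∈ (chartAt (EuclideanSpace ℝ (Fin n)) c).target)
    (hy' : (chartAt (EuclideanSpace ℝ (Fin n)) c).symm y ∈
      (chartAt (EuclideanSpace ℝ (Fin n)) c').source) :
    volumeDensity c y = |((coframe n c' ((chartAt (EuclideanSpace ℝ (Fin n)) c).symm y)).comp
        (frame n c ((chartAt (EuclideanSpace ℝ (Fin n)) c).symm y))).det| *
      volumeDensity c' (chartAt (EuclideanSpace ℝ (Fin n)) c'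
        ((chartAt (EuclideanSpace ℝ (Fin n)) c).symm y)) := by
  rw [volumeDensity_eq_relDensity hy, volumeDensity_eq_relDensity
    ((chartAt (EuclideanSpace ℝ (Fin n)) c').map_source hy'), chartForm_transition _ hy',
    relDensity_bilinearComp]

section

variable [IsContMDiffRiemannianBundle (𝓡 n) ∞ (EuclideanSpace ℝ (Fin n))
    (fun x : M ↦ TangentSpace (𝓡 n) x)]

theorem continuousOn_volumeDensity (c : M) : ContinuousOn (fun y ↦ volumeDensity (n := n) c y)
    (chartAt (EuclideanSpace ℝ (Fin n)) c).target :=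
  (contDiffOn_relDensity (hasSmoothComponents_metricForm.contDiffOn c)
    (fun _ hy ↦ isInnerForm_chartForm_metricForm hy)
      (stdBasis n).linearIndependent).continuousOn.congr fun _ hy ↦ volumeDensity_eq_relDensity hy

theorem volumeDensity_pos {c : M} {y : EuclideanSpace ℝ (Fin n)}
    (hy : y ∈ (chartAt (EuclideanSpace ℝ (Fin n)) c).target) : 0 < volumeDensity c y := by
  rw [volumeDensity_eq_relDensity hy]
  exact (isInnerForm_chartForm_metricForm hy).relDensity_pos (stdBasis n).linearIndependent

end

variable [MeasurableSpace M] [BorelSpace M]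

theorem measurableSet_chart_symm_preimage (c : M) {S : Set M} (hS : MeasurableSet S) :
    MeasurableSet ((chartAt (EuclideanSpace ℝ (Fin n)) c).symm ⁻¹' S ∩
      (chartAt (EuclideanSpace ℝ (Fin n)) c).target) := by
  have h : Measurable ((chartAt (EuclideanSpace ℝ (Fin n)) c).target.domRestrict
      (chartAt (EuclideanSpace ℝ (Fin n)) c).symm) :=
    (chartAt (EuclideanSpace ℝ (Fin n)) c).continuousOn_symm.domRestrict.measurable
  have h2 := MeasurableSet.subtype_image
    (chartAt (EuclideanSpace ℝ (Fin n)) c).open_target.measurableSet (h hS)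
  convert h2 using 1
  ext y
  simp [and_comm]

theorem aemeasurable_chart_symm (c : M) :
    AEMeasurable (chartAt (EuclideanSpace ℝ (Fin n)) c).symm
      ((volume.restrict (chartAt (EuclideanSpace ℝ (Fin n)) c).target).withDensity
        (fun y ↦ ENNReal.ofReal (volumeDensity c y))) :=
  ((chartAt (EuclideanSpace ℝ (Fin n)) c).continuousOn_symm.aemeasurable
    (chartAt (EuclideanSpace ℝ (Fin n)) c).open_target.measurableSet).mono_ac
    (withDensity_absolutelyContinuous _ _)

theorem chartVolume_apply (c : M) {S : Set M} (hS : MeasurableSet S) :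
    chartVolume (n := n) c S = ∫⁻ y in (chartAt (EuclideanSpace ℝ (Fin n)) c).symm ⁻¹' S ∩
      (chartAt (EuclideanSpace ℝ (Fin n)) c).target, ENNReal.ofReal (volumeDensity c y) := by
  rw [chartVolume, Measure.map_apply_of_aemeasurable (aemeasurable_chart_symm c) hS,
    withDensity_apply', Measure.restrict_restrict'
      (chartAt (EuclideanSpace ℝ (Fin n)) c).open_target.measurableSet]

theorem chartVolume_inter_source (c : M) {S : Set M} (hS : MeasurableSet S) :
    chartVolume (n := n) c S =
      chartVolume (n := n) c (S ∩ (chartAt (EuclideanSpace ℝ (Fin n)) c).source) := by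
  rw [chartVolume_apply c hS, chartVolume_apply c (hS.inter (chartAt _ c).open_source.measurableSet)]
  congr 2
  ext y
  simp only [mem_inter_iff, mem_preimage]
  exact ⟨fun h ↦ ⟨⟨h.1, (chartAt _ c).map_target h.2⟩, h.2⟩, fun h ↦ ⟨h.1.1, h.2⟩⟩

/-- Change of variables: the Jacobian of the transition map is exactly the factor by which the two
densities differ. -/
theorem chartVolume_eq_of_subset {c c' : M} {S : Set M} (hS : MeasurableSet S)
    (hc : S ⊆ (chartAt (EuclideanSpace ℝ (Fin n)) c).source)
    (hc' : S ⊆ (chartAt (EuclideanSpace ℝ (Fin n)) c').source) :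
    chartVolume (n := n) c S = chartVolume (n := n) c' S := by
  set e := chartAt (EuclideanSpace ℝ (Fin n)) c with he
  set e' := chartAt (EuclideanSpace ℝ (Fin n)) c' with he'
  rw [chartVolume_apply c hS, chartVolume_apply c' hS]
  have himg : e'.symm ⁻¹' S ∩ e'.target = (e' ∘ e.symm) '' (e.symm ⁻¹' S ∩ e.target) := by
    ext z
    constructor
    · rintro ⟨hz, hzt⟩
      refine ⟨e (e'.symm z), ⟨?_, e.map_source (hc hz)⟩, ?_⟩
      · rw [mem_preimage, e.left_inv (hc hz)]
        exact hz
      · simp [e.left_inv (hc hz), e'.right_inv hzt]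
    · rintro ⟨y, ⟨hy, hyt⟩, rfl⟩
      refine ⟨?_, e'.map_source (hc' hy)⟩
      rw [mem_preimage, Function.comp_apply, e'.left_inv (hc' hy)]
      exact hy
  have hinj : InjOn (e' ∘ e.symm) (e.symm ⁻¹' S ∩ e.target) := by
    rintro y ⟨hy, hyt⟩ z ⟨hz, hzt⟩ h
    exact e.symm.injOn hyt hzt (e'.injOn (hc' hy) (hc' hz) h)
  rw [himg, lintegral_image_eq_lintegral_abs_det_fderiv_mul volume
    (measurableSet_chart_symm_preimage c hS)
    (fun y hy ↦ (fderiv_chart_transition hy.2 (hc' hy.1)).hasFDerivWithinAt) hinj]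
  refine setLIntegral_congr_fun (measurableSet_chart_symm_preimage c hS) fun y hy ↦ ?_
  simp only
  rw [volumeDensity_transition hy.2 (hc' hy.1), ENNReal.ofReal_mul (abs_nonneg _)]
  rfl

/-- By compactness finitely many chart domains cover `M`. Cut into disjoint pieces, they carry a
measure glued from the chart measures; agreement on overlaps makes it dominate every chart measure,
so it is their supremum. -/
theorem riemannianVolume_restrict_source [CompactSpace M] (c : M) :
    (riemannianVolume n M).restrict (chartAt (EuclideanSpace ℝ (Fin n)) c).source =
      chartVolume (n := n) c := by
  obtain ⟨t, ht⟩ := isCompact_univ.elim_nhds_subcover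
    (fun x : M ↦ (chartAt (EuclideanSpace ℝ (Fin n)) x).source)
    fun x _ ↦ chart_source_mem_nhds _ x
  have htne : (t : Set M).Nonempty := by
    obtain ⟨x, hx, -⟩ := mem_iUnion₂.1 (ht.2 (mem_univ c))
    exact ⟨x, hx⟩
  obtain ⟨d, hd⟩ := t.countable_toSet.exists_eq_range htne
  set U : ℕ → Set M := fun i ↦ (chartAt (EuclideanSpace ℝ (Fin n)) (d i)).source
  have hU : ∀ i, MeasurableSet (U i) := fun i ↦ (chartAt _ (d i)).open_source.measurableSet
  have hUu : ⋃ i, U i = univ := by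
    refine eq_univ_of_forall fun x ↦ ?_
    obtain ⟨z, hz, hxz⟩ := mem_iUnion₂.1 (ht.2 (mem_univ x))
    obtain ⟨i, hi⟩ : z ∈ range d := hd ▸ hz
    exact mem_iUnion.2 ⟨i, by simpa only [U, hi] using hxz⟩
  -- Each piece lies in the domain of one chosen chart, and the pieces partition `M`.
  set A : ℕ → Set M := disjointed U
  have hA : ∀ i, MeasurableSet (A i) := MeasurableSet.disjointed hU
  have hAu : ⋃ i, A i = univ := by rw [iUnion_disjointed, hUu]
  have hAd : Pairwise fun i j ↦ Disjoint (A i) (A j) := disjoint_disjointed U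
  have hsplit : ∀ (ν : Measure M) {S : Set M}, MeasurableSet S → ν S = ∑' i, ν (S ∩ A i) := by
    intro ν S hS
    rw [← measure_iUnion (fun i j hij ↦ (hAd hij).mono inter_subset_right inter_subset_right)
      (fun i ↦ hS.inter (hA i)), ← inter_iUnion, hAu, inter_univ]
  have hle : ∀ (c' : M) (S : Set M), MeasurableSet S →
      chartVolume (n := n) c' S ≤ ∑' i, chartVolume (n := n) (d i) (S ∩ A i) := fun c' S hS ↦ by
    rw [hsplit _ hS]
    refine ENNReal.tsum_le_tsum fun i ↦ ?_
    rw [chartVolume_inter_source c' (hS.inter (hA i)), chartVolume_eq_of_subset (c' := d i)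
      ((hS.inter (hA i)).inter (chartAt _ c').open_source.measurableSet) inter_subset_right
      (fun x hx ↦ disjointed_subset U i hx.1.2)]
    exact measure_mono inter_subset_left
  have hν : ∀ S : Set M, MeasurableSet S →
      riemannianVolume n M S = ∑' i, chartVolume (n := n) (d i) (S ∩ A i) := by
    intro S hS
    refine le_antisymm ?_ ?_
    -- The glued measure is an upper bound of the chart measures, hence bounds their supremum.
    · set ν := Measure.sum fun i ↦ (chartVolume (n := n) (d i)).restrict (A i)
      have hνS : ∀ S, MeasurableSet S → ν S = ∑' i, chartVolume (n := n) (d i) (S ∩ A i) :=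
        fun S hS ↦ by
          rw [Measure.sum_apply _ hS]
          exact tsum_congr fun i ↦ Measure.restrict_apply hS
      have hmle : riemannianVolume n M ≤ ν := iSup_le fun c' ↦ Measure.le_iff.2 fun S hS ↦ by
        rw [hνS S hS]
        exact hle c' S hS
      rw [← hνS S hS]
      exact hmle S
    · rw [hsplit _ hS]
      exact ENNReal.tsum_le_tsum fun i ↦
        (le_iSup (fun c' : M ↦ chartVolume (n := n) c') (d i) : _ ≤ riemannianVolume n M) _
  ext S hS
  have hSc := hS.inter (chartAt (EuclideanSpace ℝ (Fin n)) c).open_source.measurableSet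
  rw [Measure.restrict_apply hS, hν _ hSc, chartVolume_inter_source c hS, hsplit _ hSc]
  refine tsum_congr fun i ↦ chartVolume_eq_of_subset (hSc.inter (hA i))
    (fun x hx ↦ disjointed_subset U i hx.2) fun x hx ↦ hx.1.2

variable [IsContMDiffRiemannianBundle (𝓡 n) ∞ (EuclideanSpace ℝ (Fin n))
    (fun x : M ↦ TangentSpace (𝓡 n) x)]

theorem riemannianVolume_image [CompactSpace M] [T2Space M] (c : M)
    {K : Set (EuclideanSpace ℝ (Fin n))} (hK : IsCompact K)
    (hKt : K ⊆ (chartAt (EuclideanSpace ℝ (Fin n)) c).target) :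
    riemannianVolume n M ((chartAt (EuclideanSpace ℝ (Fin n)) c).symm '' K) =
      ∫⁻ y in K, ENNReal.ofReal (volumeDensity c y) := by
  set e := chartAt (EuclideanSpace ℝ (Fin n)) c
  have hK' : MeasurableSet (e.symm '' K) :=
    (hK.image_of_continuousOn (e.continuousOn_symm.mono hKt)).isClosed.measurableSet
  have hsub : e.symm '' K ⊆ e.source := by
    rintro _ ⟨y, hy, rfl⟩
    exact e.map_target (hKt hy)
  have hpre : e.symm ⁻¹' (e.symm '' K) ∩ e.target = K := by
    ext y
    refine ⟨fun ⟨⟨z, hz, hzy⟩, hy⟩ ↦ ?_, fun hy ↦ ⟨⟨y, hy, rfl⟩, hKt hy⟩⟩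
    rwa [← e.symm.injOn (hKt hz) hy hzy]
  have h1 : riemannianVolume n M (e.symm '' K) = chartVolume (n := n) c (e.symm '' K) := by
    rw [← riemannianVolume_restrict_source c, Measure.restrict_apply hK',
      inter_eq_self_of_subset_left hsub]
  rw [h1, chartVolume_apply c hK', hpre]

/-- The passage from integrals on the manifold to integrals in coordinates, used for the energy and
for the divergence theorem. Compactness of `K` makes its image closed in the Hausdorff space `M`,
hence measurable. -/
theorem setIntegral_image [CompactSpace M] [T2Space M] (c : M)
    {K : Set (EuclideanSpace ℝ (Fin n))} (hK : IsCompact K)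
    (hKt : K ⊆ (chartAt (EuclideanSpace ℝ (Fin n)) c).target) {k : M → ℝ} (hk : Continuous k) :
    ∫ x in (chartAt (EuclideanSpace ℝ (Fin n)) c).symm '' K, k x ∂(riemannianVolume n M) =
      ∫ y in K, volumeDensity c y * k ((chartAt (EuclideanSpace ℝ (Fin n)) c).symm y) := by
  set e := chartAt (EuclideanSpace ℝ (Fin n)) c
  have hK' : MeasurableSet (e.symm '' K) :=
    (hK.image_of_continuousOn (e.continuousOn_symm.mono hKt)).isClosed.measurableSet
  have hsub : e.symm '' K ⊆ e.source := by
    rintro _ ⟨y, hy, rfl⟩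
    exact e.map_target (hKt hy)
  have hpre : e.symm ⁻¹' (e.symm '' K) ∩ e.target = K := by
    ext y
    refine ⟨fun ⟨⟨z, hz, hzy⟩, hy⟩ ↦ ?_, fun hy ↦ ⟨⟨y, hy, rfl⟩, hKt hy⟩⟩
    rwa [← e.symm.injOn (hKt hz) hy hzy]
  have h1 : (riemannianVolume n M).restrict (e.symm '' K) =
      (chartVolume (n := n) c).restrict (e.symm '' K) := by
    rw [← riemannianVolume_restrict_source c, Measure.restrict_restrict hK',
      inter_eq_self_of_subset_left hsub]
  have hmeas : AEMeasurable (fun y ↦ ENNReal.ofReal (volumeDensity c y))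
      (volume.restrict K) :=
    (((continuousOn_volumeDensity c).mono hKt).aemeasurable hK.measurableSet).ennreal_ofReal
  rw [h1, chartVolume, setIntegral_map hK' hk.aestronglyMeasurable (aemeasurable_chart_symm c),
    restrict_withDensity', Measure.restrict_restrict' e.open_target.measurableSet, hpre,
    integral_withDensity_eq_integral_toReal_smul₀ hmeas
      (Filter.Eventually.of_forall fun y ↦ ENNReal.ofReal_lt_top)]
  refine setIntegral_congr_fun hK.measurableSet fun y hy ↦ ?_
  simp only [ENNReal.toReal_ofReal (volumeDensity_pos (hKt hy)).le, smul_eq_mul]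
  rfl

theorem isFiniteMeasure_riemannianVolume [CompactSpace M] [T2Space M] :
    IsFiniteMeasure (riemannianVolume n M) := by
  have : IsLocallyFiniteMeasure (riemannianVolume n M) := by
    refine ⟨fun x ↦ ?_⟩
    set e := chartAt (EuclideanSpace ℝ (Fin n)) x
    obtain ⟨K, hKn, hK, hKt⟩ := exists_mem_nhds_isCompact_mapsTo
      (f := id) (continuous_id) (e.open_target.mem_nhds (mem_chart_target _ x))
    refine ⟨e.symm '' K, ?_, ?_⟩
    · have := e.symm.image_mem_nhds (x := e x) (mem_chart_target _ x) hKn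
      rwa [e.left_inv (mem_chart_source _ x)] at this
    · rw [riemannianVolume_image x hK hKt]
      obtain ⟨C, hC⟩ := hK.exists_bound_of_continuousOn
        ((continuousOn_volumeDensity x).mono hKt)
      refine (setLIntegral_mono measurable_const fun y hy ↦ ENNReal.ofReal_le_ofReal
        ((le_abs_self _).trans (hC y hy))).trans_lt ?_
      rw [setLIntegral_const]
      exact ENNReal.mul_lt_top ENNReal.ofReal_lt_top hK.measure_lt_top
  infer_instance

/-- A compact neighbourhood inside a chart target has positive Lebesgue measure, and the density is
positive on it. This makes it possible to read off the sign of `C` from the energy. -/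
theorem riemannianVolume_univ_pos [CompactSpace M] [T2Space M] [Nonempty M] :
    0 < riemannianVolume n M univ := by
  obtain ⟨x⟩ := ‹Nonempty M›
  set e := chartAt (EuclideanSpace ℝ (Fin n)) x
  obtain ⟨K, hKn, hK, hKt⟩ := exists_mem_nhds_isCompact_mapsTo
      (f := id) (continuous_id) (e.open_target.mem_nhds (mem_chart_target _ x))
  refine lt_of_lt_of_le ?_ (measure_mono (subset_univ (e.symm '' K)))
  rw [riemannianVolume_image x hK hKt, pos_iff_ne_zero]
  intro h
  rw [lintegral_eq_zero_iff' (((continuousOn_volumeDensity x).mono hKt).aemeasurable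
    hK.measurableSet).ennreal_ofReal, Filter.EventuallyEq, ae_restrict_iff' hK.measurableSet] at h
  have h0 : volume K = 0 := by
    refine measure_mono_null (fun y hy ↦ ?_) h
    simp only [mem_compl_iff, mem_ofPred_eq, not_forall]
    exact ⟨hy, by simpa using volumeDensity_pos (hKt hy)⟩
  exact (Measure.measure_pos_of_mem_nhds volume hKn).ne' h0

end Volume

/-! ### Raising an index with the inverse Gram matrix. -/

section SharpCoord

variable {ι : Type*} [Fintype ι] [DecidableEq ι]
  {E : Type*} [NormedAddCommGroup E] [NormedSpace ℝ E]

theorem IsInnerForm.eq_sum_inv {G : E →L[ℝ] E →L[ℝ] ℝ} (hG : IsInnerForm G)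
    (b : Module.Basis ι ℝ E) {v : E} {l : E → ℝ} (hv : ∀ w, G v w = l w) :
    v = ∑ i, (∑ j, (gramMatrix b G)⁻¹ i j * l (b j)) • b i := by
  conv_lhs => rw [← b.sum_repr v]
  refine Finset.sum_congr rfl fun i _ ↦ ?_
  congr 1
  have h : ∀ j, l (b j) = ∑ k, b.repr v k * G (b j) (b k) := fun j ↦ by
    rw [← hv, hG.symm]
    conv_lhs => rw [← b.sum_repr v]
    simp only [map_sum, map_smul, smul_eq_mul]
  simp only [h, Finset.mul_sum]
  rw [Finset.sum_comm]
  have h2 : ∀ k, ∑ j, (gramMatrix b G)⁻¹ i j * (b.repr v k * G (b j) (b k)) =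
      if i = k then b.repr v k else 0 := fun k ↦ by
    have := hG.sum_inv_mul b.linearIndependent i k
    calc _ = b.repr v k * ∑ j, (gramMatrix b G)⁻¹ i j * G (b j) (b k) := by
          rw [Finset.mul_sum]
          exact Finset.sum_congr rfl fun j _ ↦ by ring
      _ = _ := by rw [this]; simp
  simp [h2]

/-- `∑ G^{ij} G(A bᵢ, bⱼ)` is the trace of `A`. -/
theorem IsInnerForm.relTrace_comp {G : E →L[ℝ] E →L[ℝ] ℝ} (hG : IsInnerForm G)
    (b : Module.Basis ι ℝ E) (A : E →L[ℝ] E) :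
    ∑ i, ∑ j, (gramMatrix b G)⁻¹ i j * G (A (b i)) (b j) = ∑ i, b.repr (A (b i)) i := by
  refine Finset.sum_congr rfl fun i _ ↦ ?_
  have h := congrArg (fun v ↦ b.repr v i)
    (hG.eq_sum_inv b (v := A (b i)) (l := fun w ↦ G (A (b i)) w) fun w ↦ rfl)
  simp only [map_sum, map_smul, Module.Basis.repr_self, Finsupp.coe_finsetSum, Finset.sum_apply,
    Finsupp.smul_single, smul_eq_mul, mul_one, Finsupp.single_apply, Finset.sum_ite_eq',
    Finset.mem_univ, if_true] at h
  exact h.symm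

end SharpCoord

/-! ### Vector fields, Lie brackets, Christoffel symbols and Lie derivatives in charts. -/

section ChartFields

variable {n : ℕ} {M : Type*} [TopologicalSpace M] [ChartedSpace (EuclideanSpace ℝ (Fin n)) M]
  [IsManifold (𝓡 n) ∞ M]

theorem contMDiffOn_frame_apply {c : M} {A : M → EuclideanSpace ℝ (Fin n)}
    (hA : ContMDiffOn (𝓡 n) 𝓘(ℝ, EuclideanSpace ℝ (Fin n)) ∞ A
      (chartAt (EuclideanSpace ℝ (Fin n)) c).source) :
    ContMDiffOn (𝓡 n) ((𝓡 n).prod 𝓘(ℝ, EuclideanSpace ℝ (Fin n))) ∞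
      (fun x ↦ TotalSpace.mk' (EuclideanSpace ℝ (Fin n)) (E := TangentSpace (𝓡 n)) x
        (frame n c x (A x))) (chartAt (EuclideanSpace ℝ (Fin n)) c).source := by
  have h := (trivializationAt (EuclideanSpace ℝ (Fin n))
    (TangentSpace (𝓡 n) : M → Type _) c).contMDiffOn_symmL (n := ∞) (IB := 𝓡 n) (𝕜 := ℝ)
  have h2 : ContMDiffOn (𝓡 n) ((𝓡 n).prod 𝓘(ℝ, EuclideanSpace ℝ (Fin n))) ∞
      (fun x : M ↦ TotalSpace.mk' (EuclideanSpace ℝ (Fin n))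
        (E := Bundle.Trivial M (EuclideanSpace ℝ (Fin n))) x (A x))
      (trivializationAt (EuclideanSpace ℝ (Fin n))
        (TangentSpace (𝓡 n) : M → Type _) c).baseSet := by
    intro x hx
    rw [Bundle.contMDiffWithinAt_totalSpace]
    exact ⟨contMDiffWithinAt_id, hA x (by simpa using hx)⟩
  have := h.clm_bundle_apply h2
  simpa [frame] using! this

/-- Differentiability of a vector field at a point. -/
abbrev FieldDifferentiableAt (X : Π x : M, TangentSpace (𝓡 n) x) (x : M) : Prop :=
  MDifferentiableAt (𝓡 n) ((𝓡 n).prod 𝓘(ℝ, EuclideanSpace ℝ (Fin n)))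
    (fun x ↦ TotalSpace.mk' (EuclideanSpace ℝ (Fin n)) (E := TangentSpace (𝓡 n)) x (X x)) x

/-- The components of a vector field in the chart at `c`. -/
def chartField (c : M) (X : Π x : M, TangentSpace (𝓡 n) x) (y : EuclideanSpace ℝ (Fin n)) :
    EuclideanSpace ℝ (Fin n) :=
  coframe n c ((chartAt (EuclideanSpace ℝ (Fin n)) c).symm y)
    (X ((chartAt (EuclideanSpace ℝ (Fin n)) c).symm y))

theorem frame_chartField {c : M} {y : EuclideanSpace ℝ (Fin n)}
    (hy : y ∈ (chartAt (EuclideanSpace ℝ (Fin n)) c).target)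
    (X : Π x : M, TangentSpace (𝓡 n) x) :
    frame n c ((chartAt (EuclideanSpace ℝ (Fin n)) c).symm y) (chartField c X y) =
      X ((chartAt (EuclideanSpace ℝ (Fin n)) c).symm y) :=
  frame_coframe ((chartAt _ c).map_target hy) _

theorem chartField_frame {c : M} {y : EuclideanSpace ℝ (Fin n)}
    (hy : y ∈ (chartAt (EuclideanSpace ℝ (Fin n)) c).target) (a : EuclideanSpace ℝ (Fin n)) :
    chartField c (fun x ↦ frame n c x a) y = a :=
  coframe_frame ((chartAt _ c).map_target hy) _

/-- The Lie bracket computed in a chart. -/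
theorem mlieBracket_chart {c : M} {y : EuclideanSpace ℝ (Fin n)}
    (hy : y ∈ (chartAt (EuclideanSpace ℝ (Fin n)) c).target)
    {X Y : Π x : M, TangentSpace (𝓡 n) x}
    (hX : FieldDifferentiableAt X ((chartAt (EuclideanSpace ℝ (Fin n)) c).symm y))
    (hY : FieldDifferentiableAt Y ((chartAt (EuclideanSpace ℝ (Fin n)) c).symm y)) :
    VectorField.mlieBracket (𝓡 n) X Y ((chartAt (EuclideanSpace ℝ (Fin n)) c).symm y) =
      frame n c ((chartAt (EuclideanSpace ℝ (Fin n)) c).symm y)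
        (VectorField.lieBracket ℝ (chartField c X) (chartField c Y) y) := by
  set e := chartAt (EuclideanSpace ℝ (Fin n)) c with he
  have hsm : ContMDiffAt (𝓡 n) (𝓡 n) ∞ e.symm y :=
    (contMDiffOn_chart_symm (I := 𝓡 n) (n := ∞) (x := c)).contMDiffAt (e.open_target.mem_nhds hy)
  -- The pullback of a field by the inverse chart is its coordinate expression, so naturality of the
  -- bracket under pullback gives the claim.
  have hpb : ∀ (V : Π x : M, TangentSpace (𝓡 n) x) {z}, z ∈ e.target →
      VectorField.mpullback (𝓡 n) (𝓡 n) e.symm V z = chartField c V z := fun V z hz ↦ by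
    rw [VectorField.mpullback_apply, mfderiv_chart_symm hz]
    have h : ContinuousLinearMap.inverse (frame n c (e.symm z)) = coframe n c (e.symm z) :=
      ContinuousLinearMap.inverse_eq
        (ContinuousLinearMap.ext fun v ↦ frame_coframe (e.map_target hz) v)
        (ContinuousLinearMap.ext fun v ↦ coframe_frame (e.map_target hz) v)
    exact DFunLike.congr_fun h _
  have h2le : (2 : ℕ∞ω) ≤ (∞ : ℕ∞ω) := ENat.LEInfty.out
  have : IsManifold (𝓡 n) (minSmoothness ℝ 2) M := by
    rw [minSmoothness_of_isRCLikeNormedField]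
    exact IsManifold.of_le h2le
  have h := VectorField.mpullback_mlieBracket (n := ∞) hX hY hsm
    (by rw [minSmoothness_of_isRCLikeNormedField]; exact h2le)
  rw [hpb _ hy] at h
  have hev : ∀ V : Π x : M, TangentSpace (𝓡 n) x,
      VectorField.mpullback (𝓡 n) (𝓡 n) e.symm V =ᶠ[𝓝 y] chartField c V := fun V ↦ by
    filter_upwards [e.open_target.mem_nhds hy] with z hz using hpb V hz
  have h2 := (hev X).mlieBracket_vectorField_eq (hev Y)
  have h3 : VectorField.mlieBracket (𝓡 n) (chartField c X) (chartField c Y) y =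
      VectorField.lieBracket ℝ (chartField c X) (chartField c Y) y := by
    have := VectorField.mlieBracketWithin_eq_lieBracketWithin (𝕜 := ℝ)
      (V := chartField c X) (W := chartField c Y) (s := univ)
    rw [VectorField.lieBracketWithin_univ] at this
    exact (congrFun VectorField.mlieBracketWithin_univ.symm y).trans (congrFun this y)
  rw [← h3, ← h2, ← h]
  exact (frame_chartField hy _).symm

/-- A frame field has constant components, so of the bracket `DY(X) - DX(Y)` only the second term
remains. -/
theorem mlieBracket_frame {c : M} {y : EuclideanSpace ℝ (Fin n)}
    (hy : y ∈ (chartAt (EuclideanSpace ℝ (Fin n)) c).target)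
    {X : Π x : M, TangentSpace (𝓡 n) x}
    (hX : FieldDifferentiableAt X ((chartAt (EuclideanSpace ℝ (Fin n)) c).symm y))
    (a : EuclideanSpace ℝ (Fin n)) :
    VectorField.mlieBracket (𝓡 n) X (fun x ↦ frame n c x a)
      ((chartAt (EuclideanSpace ℝ (Fin n)) c).symm y) =
      -frame n c ((chartAt (EuclideanSpace ℝ (Fin n)) c).symm y)
        (fderiv ℝ (chartField c X) y a) := by
  rw [mlieBracket_chart hy hX (frame_mdifferentiableAt ((chartAt _ c).map_target hy) a)]
  have hev : chartField c (fun x ↦ frame n c x a) =ᶠ[𝓝 y] fun _ ↦ a := by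
    filter_upwards [(chartAt _ c).open_target.mem_nhds hy] with z hz using chartField_frame hz a
  rw [VectorField.lieBracket_eq]
  beta_reduce
  rw [hev.fderiv_eq, chartField_frame hy, fderiv_const_apply]
  simp

theorem mlieBracket_frame_frame {c : M} {y : EuclideanSpace ℝ (Fin n)}
    (hy : y ∈ (chartAt (EuclideanSpace ℝ (Fin n)) c).target) (a a' : EuclideanSpace ℝ (Fin n)) :
    VectorField.mlieBracket (𝓡 n) (fun x ↦ frame n c x a) (fun x ↦ frame n c x a')
      ((chartAt (EuclideanSpace ℝ (Fin n)) c).symm y) = 0 := by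
  rw [mlieBracket_frame hy (frame_mdifferentiableAt ((chartAt _ c).map_target hy) a)]
  have hev : chartField c (fun x ↦ frame n c x a) =ᶠ[𝓝 y] fun _ ↦ a := by
    filter_upwards [(chartAt _ c).open_target.mem_nhds hy] with z hz using chartField_frame hz a
  rw [hev.fderiv_eq, fderiv_const_apply]
  simp

variable [RiemannianBundle (fun x : M ↦ TangentSpace (𝓡 n) x)]

theorem mdifferentiableAt_of_hasSmoothComponents
    {φ : Π x : M, TangentSpace (𝓡 n) x →L[ℝ] TangentSpace (𝓡 n) x →L[ℝ] ℝ}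
    (hφ : HasSmoothComponents φ) {c x : M}
    (hx : x ∈ (chartAt (EuclideanSpace ℝ (Fin n)) c).source) (a a' : EuclideanSpace ℝ (Fin n)) :
    MDifferentiableAt (𝓡 n) 𝓘(ℝ, ℝ) (fun x ↦ φ x (frame n c x a) (frame n c x a')) x :=
  ((hφ c a a').contMDiffAt ((chartAt _ c).open_source.mem_nhds hx)).mdifferentiableAt (by simp)

theorem mvfderiv_form_frame
    {φ : Π x : M, TangentSpace (𝓡 n) x →L[ℝ] TangentSpace (𝓡 n) x →L[ℝ] ℝ}
    (hφ : HasSmoothComponents φ) {c : M} {y : EuclideanSpace ℝ (Fin n)}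
    (hy : y ∈ (chartAt (EuclideanSpace ℝ (Fin n)) c).target) (a a' v : EuclideanSpace ℝ (Fin n)) :
    mvfderiv (𝓡 n) (fun x ↦ φ x (frame n c x a) (frame n c x a'))
      ((chartAt (EuclideanSpace ℝ (Fin n)) c).symm y)
      (frame n c ((chartAt (EuclideanSpace ℝ (Fin n)) c).symm y) v) =
      fderiv ℝ (chartForm c φ) y v a a' := by
  rw [mvfderiv_frame hy (mdifferentiableAt_of_hasSmoothComponents hφ
    ((chartAt _ c).map_target hy) a a')]
  exact fderiv_clm_apply₂ (((hφ.contDiffOn c).contDiffAt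
    ((chartAt _ c).open_target.mem_nhds hy)).differentiableAt (by simp)) v a a'

variable [IsContMDiffRiemannianBundle (𝓡 n) ∞ (EuclideanSpace ℝ (Fin n))
    (fun x : M ↦ TangentSpace (𝓡 n) x)]

theorem mvfderiv_inner_frame {c : M} {y : EuclideanSpace ℝ (Fin n)}
    (hy : y ∈ (chartAt (EuclideanSpace ℝ (Fin n)) c).target) (a a' v : EuclideanSpace ℝ (Fin n)) :
    mvfderiv (𝓡 n) (fun x ↦ (inner ℝ (frame n c x a) (frame n c x a') : ℝ))
      ((chartAt (EuclideanSpace ℝ (Fin n)) c).symm y)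
      (frame n c ((chartAt (EuclideanSpace ℝ (Fin n)) c).symm y) v) =
      fderiv ℝ (chartForm c (metricForm n M)) y v a a' :=
  mvfderiv_form_frame hasSmoothComponents_metricForm hy a a' v

/-- The Christoffel symbols of the first kind. -/
theorem inner_leviCivita_frame {c : M} {y : EuclideanSpace ℝ (Fin n)}
    (hy : y ∈ (chartAt (EuclideanSpace ℝ (Fin n)) c).target) (v a w : EuclideanSpace ℝ (Fin n)) :
    (inner ℝ (leviCivita (𝓡 n) M (fun x ↦ frame n c x a)
        ((chartAt (EuclideanSpace ℝ (Fin n)) c).symm y)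
        (frame n c ((chartAt (EuclideanSpace ℝ (Fin n)) c).symm y) v))
      (frame n c ((chartAt (EuclideanSpace ℝ (Fin n)) c).symm y) w) : ℝ) =
      1 / 2 * (fderiv ℝ (chartForm c (metricForm n M)) y v a w
        + fderiv ℝ (chartForm c (metricForm n M)) y a v w
        - fderiv ℝ (chartForm c (metricForm n M)) y w v a) := by
  have hd := fun a ↦ frame_mdifferentiableAt (c := c) ((chartAt _ c).map_target hy) a
  have h := inner_nabla_apply (X := fun x ↦ frame n c x v) (Y := fun x ↦ frame n c x a)
    (Z := fun x ↦ frame n c x w) (hd v) (hd a) (hd w)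
  change inner ℝ (nabla _ _ _) _ = _
  rw [h, koszul, mvfderiv_inner_frame hy, mvfderiv_inner_frame hy, mvfderiv_inner_frame hy,
    mlieBracket_frame_frame hy, mlieBracket_frame_frame hy, mlieBracket_frame_frame hy]
  simp

/-- Tensoriality allows evaluation on the frame fields, whose brackets with `X` are minus the
derivatives of the components of `X`. -/
theorem chartForm_lieDerivMetric {c : M} {y : EuclideanSpace ℝ (Fin n)}
    (hy : y ∈ (chartAt (EuclideanSpace ℝ (Fin n)) c).target)
    {X : Π x : M, TangentSpace (𝓡 n) x}
    (hX : FieldDifferentiableAt X ((chartAt (EuclideanSpace ℝ (Fin n)) c).symm y))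
    (a a' : EuclideanSpace ℝ (Fin n)) :
    chartForm c (lieDerivMetric X) y a a' =
      fderiv ℝ (chartForm c (metricForm n M)) y (chartField c X y) a a'
      + chartForm c (metricForm n M) y (fderiv ℝ (chartField c X) y a) a'
      + chartForm c (metricForm n M) y a (fderiv ℝ (chartField c X) y a') := by
  have hd := fun a ↦ frame_mdifferentiableAt (c := c) ((chartAt _ c).map_target hy) a
  have h : lieDerivMetric X ((chartAt (EuclideanSpace ℝ (Fin n)) c).symm y) (frame n c _ a)
      (frame n c _ a') = _ := TensorialAt.mkHom₂_apply _ _ (hd a) (hd a')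
  rw [chartForm_apply, h, lieDerivMetricAux, mlieBracket_frame hy hX, mlieBracket_frame hy hX,
    ← frame_chartField hy X, mvfderiv_inner_frame hy, chartForm_apply, chartForm_apply,
    metricForm_apply, metricForm_apply, inner_neg_left, inner_neg_right]
  ring

/-- `δθ = -trace_g δ^*θ`. -/
theorem deltaOne_eq_neg_metricTrace {θ : Π x : M, TangentSpace (𝓡 n) x →L[ℝ] ℝ} {x : M}
    (hθ : FieldDifferentiableAt (sharp θ) x) :
    deltaOne θ x = -metricTrace (deltaStar θ x) := by
  rw [deltaOne, metricTrace]
  congr 1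
  refine Finset.sum_congr rfl fun i _ ↦ ?_
  set v := orthoBasis (𝓡 n) x i
  have hv := mdifferentiableAt_extend (𝓡 n) (EuclideanSpace ℝ (Fin n)) v
  have hvx := extend_apply_self (EuclideanSpace ℝ (Fin n)) v
  -- With equal first and last arguments, the Koszul formula reduces to `½ (ξ|v|² - 2 g([ξ, v], v))`
  -- for `ξ = θ^♯`, which is half of `(L_ξ g)(v, v)`.
  have h1 : inner ℝ (leviCivita (𝓡 n) M (sharp θ) x v) v =
      koszul (extend (EuclideanSpace ℝ (Fin n)) v) (sharp θ)
        (extend (EuclideanSpace ℝ (Fin n)) v) x := by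
    rw [← inner_nabla_apply hv hθ hv, hvx]
    rfl
  have h2 : lieDerivMetric (sharp θ) x v v = lieDerivMetricAux (sharp θ)
      (extend (EuclideanSpace ℝ (Fin n)) v) (extend (EuclideanSpace ℝ (Fin n)) v) x :=
    TensorialAt.mkHom₂_apply_eq_extend _ _ _ _
  rw [h1, deltaStar, FunLike.coe_smul, Pi.smul_apply, FunLike.coe_smul, Pi.smul_apply, h2, koszul,
    lieDerivMetricAux, VectorField.mlieBracket_swap_apply (V := sharp θ)]
  simp only [VectorField.mlieBracket_self, hvx, inner_neg_left, inner_neg_right, smul_eq_mul,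
    Pi.zero_apply, inner_zero_left, real_inner_comm]
  ring

section OneForms

variable {θ : Π x : M, TangentSpace (𝓡 n) x →L[ℝ] ℝ}

/-- The pointwise orthonormal bases that define `θ^♯` give no smoothness; the characterization
`g(θ^♯, ·) = θ` yields its components as `∑ⱼ G^{ij} θⱼ`. -/
theorem contDiffOn_chartField_sharp (hθ : IsSmoothOneForm (𝓡 n) θ) (c : M) :
    ContDiffOn ℝ ∞ (chartField c (sharp θ)) (chartAt (EuclideanSpace ℝ (Fin n)) c).target := by
  have hcomp : ∀ a, ContDiffOn ℝ ∞ (fun y ↦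
      θ ((chartAt (EuclideanSpace ℝ (Fin n)) c).symm y)
        (frame n c ((chartAt (EuclideanSpace ℝ (Fin n)) c).symm y) a))
      (chartAt (EuclideanSpace ℝ (Fin n)) c).target := fun a ↦ by
    have h : ContMDiffOn (𝓡 n) 𝓘(ℝ, ℝ) ∞ (fun x ↦ θ x (frame n c x a))
        (chartAt (EuclideanSpace ℝ (Fin n)) c).source := fun x hx ↦ by
      have h := ContMDiffOn.clm_bundle_apply (F₂ := ℝ) (E₂ := Bundle.Trivial M ℝ)
        (ContMDiff.contMDiffOn hθ) (contMDiffOn_frame c a)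
      exact ((Bundle.contMDiffWithinAt_totalSpace).1 (h x hx)).2
    exact contDiffOn_comp_chart_symm h
  have hsum : ContDiffOn ℝ ∞ (fun y ↦ ∑ i, (∑ j,
      (gramMatrix (stdBasis n) (chartForm c (metricForm n M) y))⁻¹ i j *
      θ ((chartAt (EuclideanSpace ℝ (Fin n)) c).symm y)
        (frame n c ((chartAt (EuclideanSpace ℝ (Fin n)) c).symm y) (stdBasis n j))) • stdBasis n i)
      (chartAt (EuclideanSpace ℝ (Fin n)) c).target :=
    ContDiffOn.sum fun i _ ↦ (ContDiffOn.sum fun j _ ↦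
      (contDiffOn_gramMatrix_inv (hasSmoothComponents_metricForm.contDiffOn c)
        (fun y hy ↦ isInnerForm_chartForm_metricForm hy) (stdBasis n).linearIndependent i j).mul
        (hcomp _)).smul contDiffOn_const
  refine hsum.congr fun y hy ↦ ?_
  refine (isInnerForm_chartForm_metricForm hy).eq_sum_inv (stdBasis n)
    (l := fun w ↦ θ ((chartAt (EuclideanSpace ℝ (Fin n)) c).symm y)
        (frame n c ((chartAt (EuclideanSpace ℝ (Fin n)) c).symm y) w)) fun w ↦ ?_
  rw [chartForm_apply, frame_chartField hy, metricForm_apply, inner_sharp]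

/-- Needed because the covariant derivative takes the value `0` at points where a field is not
differentiable; it ensures that `δθ` is the true codifferential. -/
theorem mdifferentiableAt_sharp (hθ : IsSmoothOneForm (𝓡 n) θ) (x : M) :
    FieldDifferentiableAt (sharp θ) x := by
  have h1 : ContMDiffOn (𝓡 n) 𝓘(ℝ, EuclideanSpace ℝ (Fin n)) ∞
      (fun z ↦ chartField x (sharp θ) (chartAt (EuclideanSpace ℝ (Fin n)) x z))
      (chartAt (EuclideanSpace ℝ (Fin n)) x).source :=
    (contDiffOn_chartField_sharp hθ x).contMDiffOn.comp
      (contMDiffOn_chart (I := 𝓡 n) (n := ∞) (x := x)) fun z hz ↦ (chartAt _ x).map_source hz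
  have h2 := ((contMDiffOn_frame_apply h1).contMDiffAt
    ((chartAt _ x).open_source.mem_nhds (mem_chart_source _ x))).mdifferentiableAt
    (by simp : (∞ : WithTop ℕ∞) ≠ 0)
  refine h2.congr_of_eventuallyEq ?_
  filter_upwards [(chartAt (EuclideanSpace ℝ (Fin n)) x).open_source.mem_nhds
    (mem_chart_source _ x)] with z hz
  have := frame_chartField ((chartAt (EuclideanSpace ℝ (Fin n)) x).map_source hz) (sharp θ)
  rw [(chartAt (EuclideanSpace ℝ (Fin n)) x).left_inv hz] at this
  rw [this]

end OneForms

end ChartFields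

/-! ### The codifferential in charts and the divergence theorem. -/

section Divergence

variable {n : ℕ} {M : Type*} [TopologicalSpace M] [ChartedSpace (EuclideanSpace ℝ (Fin n)) M]
  [IsManifold (𝓡 n) ∞ M] [RiemannianBundle (fun x : M ↦ TangentSpace (𝓡 n) x)]

theorem hasSmoothComponents_of_chartForm
    {φ : Π x : M, TangentSpace (𝓡 n) x →L[ℝ] TangentSpace (𝓡 n) x →L[ℝ] ℝ}
    (h : ∀ (c : M) (a a' : EuclideanSpace ℝ (Fin n)), ContDiffOn ℝ ∞
      (fun y ↦ chartForm c φ y a a') (chartAt (EuclideanSpace ℝ (Fin n)) c).target) :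
    HasSmoothComponents φ := fun c a a' ↦ by
  refine ((h c a a').contMDiffOn.comp (contMDiffOn_chart (I := 𝓡 n) (n := ∞) (x := c))
    fun x hx ↦ (chartAt _ c).map_source hx).congr fun x hx ↦ ?_
  simp only [Function.comp_apply, chartForm_apply]
  rw [(chartAt (EuclideanSpace ℝ (Fin n)) c).left_inv hx]

theorem sharp_sum {ι : Type*} (s : Finset ι) (η : ι → Π x : M, TangentSpace (𝓡 n) x →L[ℝ] ℝ)
    (x : M) : sharp (fun x ↦ ∑ i ∈ s, η i x) x = ∑ i ∈ s, sharp (η i) x := by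
  refine ext_inner_right ℝ fun v ↦ ?_
  rw [inner_sharp, sum_inner]
  simp only [inner_sharp, FunLike.coe_sum, Finset.sum_apply]

variable [IsContMDiffRiemannianBundle (𝓡 n) ∞ (EuclideanSpace ℝ (Fin n))
    (fun x : M ↦ TangentSpace (𝓡 n) x)] {θ : Π x : M, TangentSpace (𝓡 n) x →L[ℝ] ℝ}

theorem chartForm_deltaStar (hθ : IsSmoothOneForm (𝓡 n) θ) {c : M} {y : EuclideanSpace ℝ (Fin n)}
    (hy : y ∈ (chartAt (EuclideanSpace ℝ (Fin n)) c).target) (a a' : EuclideanSpace ℝ (Fin n)) :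
    chartForm c (deltaStar θ) y a a' = 1 / 2 *
      (fderiv ℝ (chartForm c (metricForm n M)) y (chartField c (sharp θ) y) a a'
      + chartForm c (metricForm n M) y (fderiv ℝ (chartField c (sharp θ)) y a) a'
      + chartForm c (metricForm n M) y a (fderiv ℝ (chartField c (sharp θ)) y a')) := by
  rw [← chartForm_lieDerivMetric hy (mdifferentiableAt_sharp hθ _)]
  rfl

set_option synthInstance.maxHeartbeats 200000 in
theorem hasSmoothComponents_deltaStar (hθ : IsSmoothOneForm (𝓡 n) θ) :
    HasSmoothComponents (deltaStar θ) := by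
  refine hasSmoothComponents_of_chartForm fun c a a' ↦ ?_
  have ho := (chartAt (EuclideanSpace ℝ (Fin n)) c).open_target
  have hG := (hasSmoothComponents_metricForm (n := n) (M := M)).contDiffOn c
  have hX := contDiffOn_chartField_sharp hθ c
  have hG' := hG.fderiv_of_isOpen ho (m := ∞) le_rfl
  have hX' := hX.fderiv_of_isOpen ho (m := ∞) le_rfl
  refine (contDiffOn_const.mul ((((hG'.clm_apply hX).clm_apply contDiffOn_const).clm_apply
    contDiffOn_const).add ((hG.clm_apply (hX'.clm_apply contDiffOn_const)).clm_apply
    contDiffOn_const) |>.add ((hG.clm_apply contDiffOn_const).clm_apply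
    (hX'.clm_apply contDiffOn_const)))).congr fun y hy ↦ chartForm_deltaStar hθ hy a a'

theorem contMDiff_deltaOne (hθ : IsSmoothOneForm (𝓡 n) θ) :
    ContMDiff (𝓡 n) 𝓘(ℝ, ℝ) ∞ (deltaOne θ) := by
  have h : deltaOne θ = fun x ↦ -metricTrace (deltaStar θ x) :=
    funext fun x ↦ deltaOne_eq_neg_metricTrace (mdifferentiableAt_sharp hθ x)
  rw [h]
  exact (contMDiff_metricTrace (hasSmoothComponents_deltaStar hθ)).neg

/-- The components of the vector density `√(det g) θ^♯` in the chart at `c`. -/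
def fluxDensity (θ : Π x : M, TangentSpace (𝓡 n) x →L[ℝ] ℝ) (c : M) (i : Fin n)
    (y : EuclideanSpace ℝ (Fin n)) : ℝ :=
  relDensity (stdBasis n) (chartForm c (metricForm n M) y) *
    (stdBasis n).repr (chartField c (sharp θ) y) i

theorem contDiffOn_repr {F : Type*} [NormedAddCommGroup F] [NormedSpace ℝ F]
    {X : F → EuclideanSpace ℝ (Fin n)} {s : Set F} (hX : ContDiffOn ℝ ∞ X s) (i : Fin n) :
    ContDiffOn ℝ ∞ (fun y ↦ (stdBasis n).repr (X y) i) s :=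
  (LinearMap.toContinuousLinearMap ((stdBasis n).coord i)).contDiff.comp_contDiffOn hX

theorem contDiffOn_fluxDensity (hθ : IsSmoothOneForm (𝓡 n) θ) (c : M) (i : Fin n) :
    ContDiffOn ℝ ∞ (fluxDensity θ c i) (chartAt (EuclideanSpace ℝ (Fin n)) c).target :=
  (contDiffOn_relDensity (hasSmoothComponents_metricForm.contDiffOn c)
    (fun _ hy ↦ isInnerForm_chartForm_metricForm hy) (stdBasis n).linearIndependent).mul
    (contDiffOn_repr (contDiffOn_chartField_sharp hθ c) i)

/-- The divergence in a chart. -/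
theorem volumeDensity_mul_deltaOne (hθ : IsSmoothOneForm (𝓡 n) θ) {c : M}
    {y : EuclideanSpace ℝ (Fin n)} (hy : y ∈ (chartAt (EuclideanSpace ℝ (Fin n)) c).target) :
    volumeDensity c y * deltaOne θ ((chartAt (EuclideanSpace ℝ (Fin n)) c).symm y) =
      -∑ i, fderiv ℝ (fluxDensity θ c i) y (stdBasis n i) := by
  set b := stdBasis n with hb
  set G := chartForm c (metricForm n M) with hGdef
  set X := chartField c (sharp θ) with hXdef
  have hn := (chartAt (EuclideanSpace ℝ (Fin n)) c).open_target.mem_nhds hy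
  have hGi : IsInnerForm (G y) := isInnerForm_chartForm_metricForm hy
  have hGd : DifferentiableAt ℝ G y :=
    ((hasSmoothComponents_metricForm.contDiffOn c).contDiffAt hn).differentiableAt (by simp)
  have hXd : DifferentiableAt ℝ X y :=
    ((contDiffOn_chartField_sharp hθ c).contDiffAt hn).differentiableAt (by simp)
  have hDd : DifferentiableAt ℝ (fun z ↦ relDensity b (G z)) y :=
    ((contDiffOn_relDensity (hasSmoothComponents_metricForm.contDiffOn c)
      (fun _ hy ↦ isInnerForm_chartForm_metricForm hy) b.linearIndependent).contDiffAt
        hn).differentiableAt (by simp)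
  set ℓ : Fin n → EuclideanSpace ℝ (Fin n) →L[ℝ] ℝ := fun i ↦
    LinearMap.toContinuousLinearMap (b.coord i) with hl
  -- The product rule splits the divergence of the flux into a trace of `DX` and a derivative of the
  -- density. By Jacobi's formula (`hdens`) the second is half the trace of the derivative of `G`
  -- along `X`; together they form the trace of `δ^*θ`.
  have hflux : ∀ i, fderiv ℝ (fluxDensity θ c i) y (b i) =
      relDensity b (G y) * b.repr (fderiv ℝ X y (b i)) i +
      b.repr (X y) i * fderiv ℝ (fun z ↦ relDensity b (G z)) y (b i) := fun i ↦ by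
    have h1 : HasFDerivAt (fun z ↦ ℓ i (X z)) ((ℓ i).comp (fderiv ℝ X y)) y :=
      (ℓ i).hasFDerivAt.comp y hXd.hasFDerivAt
    have h2 := (hDd.hasFDerivAt.mul h1).fderiv
    have h3 : fluxDensity θ c i = fun z ↦ relDensity b (G z) * ℓ i (X z) := rfl
    rw [h3]
    refine (congrArg (fun L : EuclideanSpace ℝ (Fin n) →L[ℝ] ℝ ↦ L (b i)) h2).trans ?_
    rfl
  have hdens : ∑ i, b.repr (X y) i * fderiv ℝ (fun z ↦ relDensity b (G z)) y (b i) =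
      1 / 2 * relDensity b (G y) * relTrace b (G y) (fderiv ℝ G y (X y)) := by
    rw [← fderiv_relDensity hGd hGi b.linearIndependent]
    conv_rhs => rw [← b.sum_repr (X y)]
    simp only [map_sum, map_smul, smul_eq_mul]
  simp only [hflux, Finset.sum_add_distrib]
  rw [hdens, ← Finset.mul_sum, ← hGi.relTrace_comp b,
    deltaOne_eq_neg_metricTrace (mdifferentiableAt_sharp hθ _), metricTrace_eq_relTrace hy _ b,
    volumeDensity_eq_relDensity hy]
  have hsym : ∑ i, ∑ j, (gramMatrix b (G y))⁻¹ i j * G y (b i) (fderiv ℝ X y (b j)) =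
      ∑ i, ∑ j, (gramMatrix b (G y))⁻¹ i j * G y (fderiv ℝ X y (b i)) (b j) := by
    rw [Finset.sum_comm]
    refine Finset.sum_congr rfl fun i _ ↦ Finset.sum_congr rfl fun j _ ↦ ?_
    rw [hGi.inv_symm, hGi.symm]
  have htr : relTrace b (G y) (chartForm c (deltaStar θ) y) =
      1 / 2 * relTrace b (G y) (fderiv ℝ G y (X y)) +
      ∑ i, ∑ j, (gramMatrix b (G y))⁻¹ i j * G y (fderiv ℝ X y (b i)) (b j) := by
    have : relTrace b (G y) (chartForm c (deltaStar θ) y) =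
        1 / 2 * (relTrace b (G y) (fderiv ℝ G y (X y)) +
        ∑ i, ∑ j, (gramMatrix b (G y))⁻¹ i j * G y (fderiv ℝ X y (b i)) (b j) +
        ∑ i, ∑ j, (gramMatrix b (G y))⁻¹ i j * G y (b i) (fderiv ℝ X y (b j))) := by
      simp only [relTrace, chartForm_deltaStar hθ hy, ← Finset.sum_add_distrib, Finset.mul_sum]
      refine Finset.sum_congr rfl fun i _ ↦ Finset.sum_congr rfl fun j _ ↦ ?_
      ring
    rw [this, hsym]
    ring
  rw [← hb, ← hGdef, htr]
  ring

/-- Additivity is read off in a chart, where the flux density is linear in the form; the positive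
volume density is then cancelled. -/
theorem deltaOne_sum {ι : Type*} (s : Finset ι)
    (η : ι → Π x : M, TangentSpace (𝓡 n) x →L[ℝ] ℝ) (hη : ∀ i, IsSmoothOneForm (𝓡 n) (η i))
    (hs : IsSmoothOneForm (𝓡 n) (fun x ↦ ∑ i ∈ s, η i x)) (x : M) :
    deltaOne (fun x ↦ ∑ i ∈ s, η i x) x = ∑ i ∈ s, deltaOne (η i) x := by
  set e := chartAt (EuclideanSpace ℝ (Fin n)) x
  have hy : e x ∈ e.target := mem_chart_target _ x
  have hD := (volumeDensity_pos (n := n) hy).ne'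
  have key : ∀ k, fluxDensity (fun x ↦ ∑ i ∈ s, η i x) x k =
      fun y ↦ ∑ i ∈ s, fluxDensity (η i) x k y := fun k ↦ by
    ext y
    simp only [fluxDensity, chartField, sharp_sum, map_sum, Finsupp.coe_finsetSum,
      Finset.sum_apply, Finset.mul_sum]
  have h := volumeDensity_mul_deltaOne hs hy
  simp only [key] at h
  have hd : ∀ k, fderiv ℝ (fun y ↦ ∑ i ∈ s, fluxDensity (η i) x k y) (e x) =
      ∑ i ∈ s, fderiv ℝ (fluxDensity (η i) x k) (e x) := fun k ↦
    fderiv_fun_sum fun i _ ↦ ((contDiffOn_fluxDensity (hη i) x k).contDiffAt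
      (e.open_target.mem_nhds hy)).differentiableAt (by simp)
  simp only [hd, FunLike.coe_sum, Finset.sum_apply] at h
  rw [Finset.sum_comm, ← Finset.sum_neg_distrib] at h
  have h2 := fun i ↦ volumeDensity_mul_deltaOne (hη i) hy
  simp only [← h2, ← Finset.mul_sum] at h
  have h3 := mul_left_cancel₀ hD h
  have hx : e.symm (e x) = x := e.left_inv (mem_chart_source _ x)
  rwa [hx] at h3

theorem deltaOne_eq_zero_of_eventually (hθ : IsSmoothOneForm (𝓡 n) θ) {x : M}
    (h : ∀ᶠ z in 𝓝 x, θ z = 0) : deltaOne θ x = 0 := by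
  set e := chartAt (EuclideanSpace ℝ (Fin n)) x
  have hy : e x ∈ e.target := mem_chart_target _ x
  have hx : e.symm (e x) = x := e.left_inv (mem_chart_source _ x)
  have hev : ∀ i, fluxDensity θ x i =ᶠ[𝓝 (e x)] fun _ ↦ 0 := fun i ↦ by
    have ht : Filter.Tendsto e.symm (𝓝 (e x)) (𝓝 x) := by
      have := e.continuousAt_symm hy
      rwa [ContinuousAt, hx] at this
    filter_upwards [ht.eventually h] with y hyz
    have h0 : sharp θ (e.symm y) = 0 := by
      refine ext_inner_right ℝ fun v ↦ ?_
      rw [inner_sharp, hyz, inner_zero_left]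
      rfl
    have h1 : chartField x (sharp θ) y = 0 := by
      rw [chartField, h0, map_zero]
    rw [fluxDensity, h1]
    simp
  have h2 := volumeDensity_mul_deltaOne hθ hy
  simp only [(hev _).fderiv_eq] at h2
  rw [hx] at h2
  simpa [(volumeDensity_pos (n := n) hy).ne'] using h2

variable [MeasurableSpace M] [BorelSpace M] [CompactSpace M] [T2Space M]

/-- In the chart the integrand is a Euclidean divergence of functions vanishing off `K`; extended by
zero, their partial derivatives integrate to `0`. -/
theorem integral_deltaOne_of_tsupport (hθ : IsSmoothOneForm (𝓡 n) θ) (c : M)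
    {K : Set (EuclideanSpace ℝ (Fin n))} (hK : IsCompact K)
    (hKt : K ⊆ (chartAt (EuclideanSpace ℝ (Fin n)) c).target)
    (h0 : ∀ x ∉ (chartAt (EuclideanSpace ℝ (Fin n)) c).symm '' K, θ x = 0) :
    ∫ x, deltaOne θ x ∂(riemannianVolume n M) = 0 := by
  set e := chartAt (EuclideanSpace ℝ (Fin n)) c with he
  have hcl : IsClosed (e.symm '' K) :=
    (hK.image_of_continuousOn (e.continuousOn_symm.mono hKt)).isClosed
  have hz : ∀ x ∉ e.symm '' K, deltaOne θ x = 0 := fun x hx ↦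
    deltaOne_eq_zero_of_eventually hθ (by
      filter_upwards [hcl.isOpen_compl.mem_nhds hx] with z hz using h0 z hz)
  rw [← setIntegral_eq_integral_of_forall_compl_eq_zero hz,
    setIntegral_image c hK hKt (contMDiff_deltaOne hθ).continuous]
  have hzero : ∀ i, ∀ y ∈ e.target, y ∉ K → fluxDensity θ c i y = 0 := fun i y hy hyK ↦ by
    have hx : e.symm y ∉ e.symm '' K := by
      rintro ⟨z, hz, hzy⟩
      exact hyK (e.symm.injOn (hKt hz) hy hzy ▸ hz)
    have hs : sharp θ (e.symm y) = 0 := by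
      refine ext_inner_right ℝ fun v ↦ ?_
      rw [inner_sharp, h0 _ hx, inner_zero_left]
      rfl
    have h1 : chartField c (sharp θ) y = 0 := by
      rw [chartField, hs, map_zero]
    rw [fluxDensity, h1]
    simp
  have hind := fun i ↦ indicator_contDiff e.open_target hK.isClosed hKt
    (contDiffOn_fluxDensity hθ c i) (hzero i)
  set W : Fin n → EuclideanSpace ℝ (Fin n) → ℝ := fun i ↦ e.target.indicator (fluxDensity θ c i)
  have hWc : ∀ i, HasCompactSupport (W i) := fun i ↦
    hK.of_isClosed_subset (isClosed_tsupport _) (hind i).2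
  have hcongr : ∀ y ∈ K, volumeDensity c y * deltaOne θ (e.symm y) =
      -∑ i, fderiv ℝ (W i) y (stdBasis n i) := fun y hy ↦ by
    rw [volumeDensity_mul_deltaOne hθ (hKt hy)]
    congr 1
    refine Finset.sum_congr rfl fun i _ ↦ ?_
    have hev : fluxDensity θ c i =ᶠ[𝓝 y] W i := by
      filter_upwards [e.open_target.mem_nhds (hKt hy)] with z hz
      exact (indicator_of_mem hz _).symm
    rw [hev.fderiv_eq]
  refine (setIntegral_congr_fun hK.measurableSet hcongr).trans ?_
  rw [setIntegral_eq_integral_of_forall_compl_eq_zero]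
  · rw [integral_neg, integral_finsetSum]
    · rw [Finset.sum_eq_zero fun i _ ↦
        integral_fderiv_eq_zero (hind i).1 (hWc i) (stdBasis n i), neg_zero]
    · intro i _
      refine Continuous.integrable_of_hasCompactSupport
        (((hind i).1.continuous_fderiv (by simp)).clm_apply continuous_const) ?_
      exact (hWc i).mono' ((subset_tsupport _).trans (tsupport_fderiv_apply_subset _ _))
  · intro y hy
    rw [neg_eq_zero]
    refine Finset.sum_eq_zero fun i _ ↦ ?_
    refine image_eq_zero_of_notMem_tsupport
      (f := fun y ↦ fderiv ℝ (W i) y (stdBasis n i)) fun hyt ↦ hy ?_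
    exact (hind i).2 (tsupport_fderiv_apply_subset _ _ hyt)

/-- The divergence theorem on a closed manifold. -/
theorem integral_deltaOne (hθ : IsSmoothOneForm (𝓡 n) θ) :
    ∫ x, deltaOne θ x ∂(riemannianVolume n M) = 0 := by
  obtain ⟨t, ht⟩ := isCompact_univ.elim_nhds_subcover
    (fun x : M ↦ (chartAt (EuclideanSpace ℝ (Fin n)) x).source)
    fun x _ ↦ chart_source_mem_nhds _ x
  -- A partition of unity writes `θ` as a finite sum of forms, each supported in one chart.
  obtain ⟨ρ, hρ⟩ := SmoothPartitionOfUnity.exists_isSubordinate (𝓡 n) (isClosed_univ (X := M))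
    (fun i : t ↦ (chartAt (EuclideanSpace ℝ (Fin n)) (i : M)).source)
    (fun i ↦ (chartAt _ (i : M)).open_source) (fun x hx ↦ by
      obtain ⟨z, hz, hxz⟩ := mem_iUnion₂.1 (ht.2 hx)
      exact mem_iUnion.2 ⟨⟨z, hz⟩, hxz⟩)
  set η : t → Π x : M, TangentSpace (𝓡 n) x →L[ℝ] ℝ := fun i x ↦ ρ i x • θ x with hη_def
  have hη : ∀ i, IsSmoothOneForm (𝓡 n) (η i) := fun i ↦
    ContMDiff.smul_section (ρ i).contMDiff hθ
  have hsum : (fun x ↦ ∑ i, η i x) = θ := by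
    funext x
    have h1 := ρ.sum_eq_one (mem_univ x)
    rw [finsum_eq_sum_of_fintype] at h1
    simp only [hη_def, ← Finset.sum_smul, h1, one_smul]
  have hd : ∀ x, deltaOne θ x = ∑ i, deltaOne (η i) x := fun x ↦ by
    rw [← deltaOne_sum Finset.univ η hη (by rwa [hsum]), hsum]
  have := isFiniteMeasure_riemannianVolume (n := n) (M := M)
  simp only [hd]
  rw [integral_finsetSum]
  · refine Finset.sum_eq_zero fun i _ ↦ ?_
    have hsub : tsupport (ρ i) ⊆ (chartAt (EuclideanSpace ℝ (Fin n)) (i : M)).source := hρ i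
    refine integral_deltaOne_of_tsupport (hη i) (i : M)
      (K := chartAt (EuclideanSpace ℝ (Fin n)) (i : M) '' tsupport (ρ i)) ?_ ?_ ?_
    · exact (isClosed_tsupport _).isCompact.image_of_continuousOn
        ((chartAt _ (i : M)).continuousOn.mono hsub)
    · rintro _ ⟨x, hx, rfl⟩
      exact (chartAt _ (i : M)).map_source (hsub hx)
    · intro x hx
      have : ρ i x = 0 := by
        refine image_eq_zero_of_notMem_tsupport fun hxt ↦ hx ?_
        exact ⟨_, ⟨x, hxt, rfl⟩, (chartAt _ (i : M)).left_inv (hsub hxt)⟩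
      simp only [hη_def, this, zero_smul]
  · intro i _
    exact (contMDiff_deltaOne (hη i)).continuous.integrable_of_hasCompactSupport
      (HasCompactSupport.of_compactSpace _)

end Divergence

/-! ### Harmonic maps are critical for deformations of the domain. -/

section DomainVariations

variable {n : ℕ} {M : Type*} [TopologicalSpace M] [ChartedSpace (EuclideanSpace ℝ (Fin n)) M]
  [IsManifold (𝓡 n) ∞ M] [RiemannianBundle (fun x : M ↦ TangentSpace (𝓡 n) x)]
  {m : ℕ} {N : Type*} [TopologicalSpace N] [ChartedSpace (EuclideanSpace ℝ (Fin m)) N]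
  [IsManifold (𝓡 m) ∞ N] [RiemannianBundle (fun x : N ↦ TangentSpace (𝓡 m) x)]

theorem pullbackMetric_congr {f g : M → N} {x : M} (h : f =ᶠ[𝓝 x] g) :
    pullbackMetric n m f x = pullbackMetric n m g x := by
  -- The target fibres over `f x` and `g x` are different types; stated over the model spaces, the
  -- equalities of base points and of derivatives can be substituted.
  have key : ∀ (p q : N) (A A' : EuclideanSpace ℝ (Fin n) →L[ℝ] EuclideanSpace ℝ (Fin m)),
      p = q → A = A' → ∀ v w : EuclideanSpace ℝ (Fin n),
      metricForm m N p (A v) (A w) = metricForm m N q (A' v) (A' w) := by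
    rintro p q A A' rfl rfl v w
    rfl
  ext v w
  exact key (f x) (g x) (mfderiv (𝓡 n) (𝓡 m) f x) (mfderiv (𝓡 n) (𝓡 m) g x) h.eq_of_nhds
    h.mfderiv_eq v w

/-- The pullback of the metric of `N` under a map from Euclidean space. -/
def coordPullback (k : EuclideanSpace ℝ (Fin n) → N) (y a a' : EuclideanSpace ℝ (Fin n)) : ℝ :=
  metricForm m N (k y) (mfderiv (𝓡 n) (𝓡 m) k y a) (mfderiv (𝓡 n) (𝓡 m) k y a')

theorem coordPullback_congr {k k' : EuclideanSpace ℝ (Fin n) → N} {y : EuclideanSpace ℝ (Fin n)}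
    (h : k =ᶠ[𝓝 y] k') : coordPullback (m := m) k y = coordPullback (m := m) k' y := by
  have key : ∀ (p q : N) (A A' : EuclideanSpace ℝ (Fin n) →L[ℝ] EuclideanSpace ℝ (Fin m)),
      p = q → A = A' → ∀ v w : EuclideanSpace ℝ (Fin n),
      metricForm m N p (A v) (A w) = metricForm m N q (A' v) (A' w) := by
    rintro p q A A' rfl rfl v w
    rfl
  ext v w
  exact key (k y) (k' y) (mfderiv (𝓡 n) (𝓡 m) k y) (mfderiv (𝓡 n) (𝓡 m) k' y) h.eq_of_nhds
    h.mfderiv_eq v w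

theorem chartForm_pullbackMetric {g : M → N} {c : M} {y : EuclideanSpace ℝ (Fin n)}
    (hy : y ∈ (chartAt (EuclideanSpace ℝ (Fin n)) c).target)
    (hg : MDifferentiableAt (𝓡 n) (𝓡 m) g ((chartAt (EuclideanSpace ℝ (Fin n)) c).symm y))
    (a a' : EuclideanSpace ℝ (Fin n)) :
    chartForm c (pullbackMetric n m g) y a a' =
      coordPullback (m := m) (g ∘ (chartAt (EuclideanSpace ℝ (Fin n)) c).symm) y a a' := by
  have h1 : MDifferentiableAt (𝓡 n) (𝓡 n) (chartAt (EuclideanSpace ℝ (Fin n)) c).symm y :=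
    mdifferentiableAt_atlas_symm (chart_mem_atlas _ c) hy
  have h := mfderiv_comp y hg h1
  rw [mfderiv_chart_symm hy] at h
  rw [coordPullback, h]
  rfl

theorem coordPullback_comp {k : EuclideanSpace ℝ (Fin n) → N}
    {Ψ : EuclideanSpace ℝ (Fin n) → EuclideanSpace ℝ (Fin n)} {y : EuclideanSpace ℝ (Fin n)}
    (hk : MDifferentiableAt (𝓡 n) (𝓡 m) k (Ψ y)) (hΨ : DifferentiableAt ℝ Ψ y)
    (a a' : EuclideanSpace ℝ (Fin n)) :
    coordPullback (m := m) (k ∘ Ψ) y a a' =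
      coordPullback (m := m) k (Ψ y) (fderiv ℝ Ψ y a) (fderiv ℝ Ψ y a') := by
  have h := mfderiv_comp (I := 𝓡 n) (I' := 𝓡 n) (I'' := 𝓡 m) y hk hΨ.mdifferentiableAt
  rw [mfderiv_eq_fderiv] at h
  rw [coordPullback, h]
  rfl

open scoped Classical in
/-- The deformation of the identity of `M` which is `y ↦ y + s • X y` in the chart at `c`. -/
def chartShift (c : M) (X : EuclideanSpace ℝ (Fin n) → EuclideanSpace ℝ (Fin n)) (s : ℝ)
    (x : M) : M :=
  if x ∈ (chartAt (EuclideanSpace ℝ (Fin n)) c).source then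
    (chartAt (EuclideanSpace ℝ (Fin n)) c).symm (chartAt (EuclideanSpace ℝ (Fin n)) c x +
      s • X (chartAt (EuclideanSpace ℝ (Fin n)) c x))
  else x

variable {c : M} {X : EuclideanSpace ℝ (Fin n) → EuclideanSpace ℝ (Fin n)}

theorem chartShift_of_notMem (s : ℝ) {x : M}
    (hx : x ∉ (chartAt (EuclideanSpace ℝ (Fin n)) c).symm '' tsupport X) :
    chartShift c X s x = x := by
  rw [chartShift]
  split_ifs with h
  · have : X (chartAt (EuclideanSpace ℝ (Fin n)) c x) = 0 :=
      image_eq_zero_of_notMem_tsupport fun ht ↦ hx ⟨_, ht, (chartAt _ c).left_inv h⟩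
    rw [this, smul_zero, add_zero, (chartAt _ c).left_inv h]
  · rfl

theorem chartShift_zero : chartShift c X 0 = id := by
  ext x
  rw [chartShift]
  split_ifs with h
  · rw [zero_smul, add_zero, (chartAt _ c).left_inv h, id]
  · rfl

theorem chartShift_symm (s : ℝ) {y : EuclideanSpace ℝ (Fin n)}
    (hy : y ∈ (chartAt (EuclideanSpace ℝ (Fin n)) c).target) :
    chartShift c X s ((chartAt (EuclideanSpace ℝ (Fin n)) c).symm y) =
      (chartAt (EuclideanSpace ℝ (Fin n)) c).symm (y + s • X y) := by
  rw [chartShift, if_pos ((chartAt _ c).map_target hy), (chartAt _ c).right_inv hy]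

theorem isCompact_chart_image (hXc : HasCompactSupport X)
    (hXs : tsupport X ⊆ (chartAt (EuclideanSpace ℝ (Fin n)) c).target) :
    IsCompact ((chartAt (EuclideanSpace ℝ (Fin n)) c).symm '' tsupport X) :=
  hXc.isCompact.image_of_continuousOn ((chartAt _ c).continuousOn_symm.mono hXs)

/-- Two open sets cover `M`: the chart domain, where the map is given by its coordinate formula, and
the complement of the compact image of the support, where it is the identity. The bound `|sin| ≤ 1`
keeps the formula in the chart target for every real `t`. -/
theorem contMDiff_chartShift [T2Space M] (hX : ContDiff ℝ ∞ X) (hXc : HasCompactSupport X)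
    (hXs : tsupport X ⊆ (chartAt (EuclideanSpace ℝ (Fin n)) c).target)
    (hmaps : ∀ s : ℝ, |s| ≤ 1 → ∀ y ∈ (chartAt (EuclideanSpace ℝ (Fin n)) c).target,
      y + s • X y ∈ (chartAt (EuclideanSpace ℝ (Fin n)) c).target) :
    ContMDiff (𝓘(ℝ, ℝ).prod (𝓡 n)) (𝓡 n) ∞
      (fun p : ℝ × M ↦ chartShift c X (Real.sin p.1) p.2) := by
  set e := chartAt (EuclideanSpace ℝ (Fin n)) c with he
  intro p
  by_cases hp : p.2 ∈ e.source
  · have h1 : ContMDiffAt (𝓘(ℝ, ℝ).prod (𝓡 n)) 𝓘(ℝ, EuclideanSpace ℝ (Fin n)) ∞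
        (fun p : ℝ × M ↦ e p.2) p :=
      ((contMDiffOn_chart (I := 𝓡 n) (n := ∞) (x := c)).contMDiffAt
        (e.open_source.mem_nhds hp)).comp p contMDiffAt_snd
    have h2 : ContMDiffAt (𝓘(ℝ, ℝ).prod (𝓡 n)) 𝓘(ℝ, EuclideanSpace ℝ (Fin n)) ∞
        (fun p : ℝ × M ↦ X (e p.2)) p := hX.contMDiff.contMDiffAt.comp p h1
    have h3 : ContMDiffAt (𝓘(ℝ, ℝ).prod (𝓡 n)) 𝓘(ℝ, ℝ) ∞
        (fun p : ℝ × M ↦ Real.sin p.1) p :=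
      Real.contDiff_sin.contMDiff.contMDiffAt.comp p contMDiffAt_fst
    have h4 : ContMDiffAt (𝓘(ℝ, ℝ).prod (𝓡 n)) 𝓘(ℝ, EuclideanSpace ℝ (Fin n)) ∞
        (fun p : ℝ × M ↦ e p.2 + Real.sin p.1 • X (e p.2)) p := h1.add (h3.smul h2)
    have hmem : e p.2 + Real.sin p.1 • X (e p.2) ∈ e.target :=
      hmaps _ (Real.abs_sin_le_one _) _ (e.map_source hp)
    have h5 := ((contMDiffOn_chart_symm (I := 𝓡 n) (n := ∞) (x := c)).contMDiffAt
      (e.open_target.mem_nhds hmem)).comp p h4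
    refine h5.congr_of_eventuallyEq ?_
    filter_upwards [(e.open_source.preimage continuous_snd).mem_nhds hp] with q hq
    exact if_pos hq
  · have hK := (isCompact_chart_image (c := c) hXc hXs).isClosed
    have hpK : p.2 ∉ e.symm '' tsupport X := by
      rintro ⟨y, hy, hyp⟩
      exact hp (hyp ▸ e.map_target (hXs hy))
    refine contMDiffAt_snd.congr_of_eventuallyEq ?_
    filter_upwards [(hK.isOpen_compl.preimage continuous_snd).mem_nhds hpK] with q hq
    exact chartShift_of_notMem _ hq

theorem chartForm_pullback_chartShift {f : M → N} (hf : ContMDiff (𝓡 n) (𝓡 m) ∞ f)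
    (hX : ContDiff ℝ ∞ X) {s : ℝ}
    (hs : ContMDiff (𝓡 n) (𝓡 n) ∞ (chartShift c X s))
    (hmaps : ∀ y ∈ (chartAt (EuclideanSpace ℝ (Fin n)) c).target,
      y + s • X y ∈ (chartAt (EuclideanSpace ℝ (Fin n)) c).target)
    {y : EuclideanSpace ℝ (Fin n)} (hy : y ∈ (chartAt (EuclideanSpace ℝ (Fin n)) c).target) :
    chartForm c (pullbackMetric n m (f ∘ chartShift c X s)) y =
      pullbackShift (chartForm c (pullbackMetric n m f)) X s y := by
  set e := chartAt (EuclideanSpace ℝ (Fin n)) c with he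
  have hXd : DifferentiableAt ℝ X y := hX.contDiffAt.differentiableAt (by simp)
  have hΨ : HasFDerivAt (fun z ↦ z + s • X z)
      (ContinuousLinearMap.id ℝ _ + s • fderiv ℝ X y) y :=
    (hasFDerivAt_id y).add (hXd.hasFDerivAt.const_smul s)
  ext a a'
  rw [chartForm_pullbackMetric hy ((hf.comp hs).mdifferentiable (by simp) _), pullbackShift_apply,
    chartForm_pullbackMetric (hmaps y hy) (hf.mdifferentiable (by simp) _)]
  have hev : (f ∘ chartShift c X s) ∘ e.symm =ᶠ[𝓝 y] (f ∘ e.symm) ∘ fun z ↦ z + s • X z := by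
    filter_upwards [e.open_target.mem_nhds hy] with z hz
    simp only [Function.comp_apply]
    rw [chartShift_symm s hz]
  have hk : MDifferentiableAt (𝓡 n) (𝓡 m) (f ∘ e.symm) (y + s • X y) :=
    (hf.mdifferentiable (by simp) _).comp _
      (mdifferentiableAt_atlas_symm (chart_mem_atlas _ c) (hmaps y hy))
  rw [coordPullback_congr hev, coordPullback_comp (Ψ := fun z ↦ z + s • X z) hk
    hΨ.differentiableAt, hΨ.fderiv]
  rfl

variable [IsContMDiffRiemannianBundle (𝓡 n) ∞ (EuclideanSpace ℝ (Fin n))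
    (fun x : M ↦ TangentSpace (𝓡 n) x)]
  [IsContMDiffRiemannianBundle (𝓡 m) ∞ (EuclideanSpace ℝ (Fin m))
    (fun x : N ↦ TangentSpace (𝓡 m) x)]
  [MeasurableSpace M] [BorelSpace M] [CompactSpace M] [T2Space M]

/-- A harmonic map on a closed manifold is critical for the variations of the domain which are
supported in a chart. -/
theorem IsHarmonicMap.hasDerivAt_chart {f : M → N} (hf : IsHarmonicMap n m f)
    (b : Module.Basis (Fin n) ℝ (EuclideanSpace ℝ (Fin n)))
    (hX : ContDiff ℝ ∞ X) (hXc : HasCompactSupport X)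
    (hXs : tsupport X ⊆ (chartAt (EuclideanSpace ℝ (Fin n)) c).target)
    (hmaps : ∀ s : ℝ, |s| ≤ 1 → ∀ y ∈ (chartAt (EuclideanSpace ℝ (Fin n)) c).target,
      y + s • X y ∈ (chartAt (EuclideanSpace ℝ (Fin n)) c).target) :
    HasDerivAt (fun t ↦ ∫ y in tsupport X, relDensity b (chartForm c (metricForm n M) y) *
        relTrace b (chartForm c (metricForm n M) y)
          (pullbackShift (chartForm c (pullbackMetric n m f)) X (Real.sin t) y)) 0 0 := by
  set e := chartAt (EuclideanSpace ℝ (Fin n)) c with he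
  set F : ℝ → M → N := fun t ↦ f ∘ chartShift c X (Real.sin t) with hF
  set K := e.symm '' tsupport X with hKdef
  have hK : IsCompact K := isCompact_chart_image hXc hXs
  have hsm := contMDiff_chartShift hX hXc hXs hmaps
  have hst : ∀ t : ℝ, ContMDiff (𝓡 n) (𝓡 n) ∞ (chartShift c X (Real.sin t)) := fun t ↦
    hsm.comp (contMDiff_const.prodMk contMDiff_id)
  have hFt : ∀ t, ContMDiff (𝓡 n) (𝓡 m) ∞ (F t) := fun t ↦ hf.1.comp (hst t)
  -- As `M` is compact, the whole of `M` is an admissible domain of variation.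
  have hcrit := hf.2 univ isOpen_univ isClosed_closure.isCompact F (hf.1.comp hsm)
    (by simp only [hF, Real.sin_zero, chartShift_zero]; rfl)
    ⟨K, hK, subset_univ _, fun t x hx ↦ by
      simp only [hF, Function.comp_apply, chartShift_of_notMem _ hx]⟩
  obtain ⟨κ, hκ, hκb⟩ := exists_relDensity_eq_mul b (stdBasis n)
  have := isFiniteMeasure_riemannianVolume (n := n) (M := M)
  -- The energy is an affine function of the coordinate integral: off `K` the map is unchanged, and
  -- on `K` the volume density is `κ` times the density in the basis `b`.
  have hsplit : ∀ t, energyOn n m univ (F t) = 1 / 2 * (κ * (∫ y in tsupport X,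
      relDensity b (chartForm c (metricForm n M) y) *
        relTrace b (chartForm c (metricForm n M) y)
          (pullbackShift (chartForm c (pullbackMetric n m f)) X (Real.sin t) y)) +
      ∫ x in Kᶜ, energyDensity n m f x ∂(riemannianVolume n M)) := fun t ↦ by
    have hcont := (contMDiff_energyDensity (hFt t)).continuous
    rw [energyOn, setIntegral_univ, ← integral_add_compl hK.isClosed.measurableSet
      (hcont.integrable_of_hasCompactSupport (HasCompactSupport.of_compactSpace _)),
      setIntegral_image c hXc.isCompact hXs hcont, ← integral_const_mul]
    congr 2
    · refine setIntegral_congr_fun hXc.isCompact.measurableSet fun y hy ↦ ?_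
      rw [volumeDensity_eq_relDensity (hXs hy), hκb, energyDensity,
        metricTrace_eq_relTrace (hXs hy) _ b, chartForm_pullback_chartShift hf.1 hX (hst t)
          (hmaps _ (Real.abs_sin_le_one t)) (hXs hy), mul_assoc]
    · refine setIntegral_congr_fun hK.isClosed.isOpen_compl.measurableSet fun x hx ↦ ?_
      simp only [energyDensity]
      rw [pullbackMetric_congr (g := f)]
      filter_upwards [hK.isClosed.isOpen_compl.mem_nhds hx] with z hz
      simp only [hF, Function.comp_apply, chartShift_of_notMem _ hz]
  have h := ((hcrit.const_mul 2).sub_const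
    (∫ x in Kᶜ, energyDensity n m f x ∂(riemannianVolume n M))).const_mul κ⁻¹
  simp only [mul_zero] at h
  refine h.congr_of_eventuallyEq (Filter.Eventually.of_forall fun t ↦ ?_)
  simp only [hsplit]
  field_simp
  ring

end DomainVariations

/-! ### The divergence of a two-form at the centre of a chart, and the conservation law. -/

section TwoForms

variable {n : ℕ} {M : Type*} [TopologicalSpace M] [ChartedSpace (EuclideanSpace ℝ (Fin n)) M]
  [IsManifold (𝓡 n) ∞ M] [RiemannianBundle (fun x : M ↦ TangentSpace (𝓡 n) x)]
  [IsContMDiffRiemannianBundle (𝓡 n) ∞ (EuclideanSpace ℝ (Fin n))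
    (fun x : M ↦ TangentSpace (𝓡 n) x)]
  {φ ψ : Π x : M, TangentSpace (𝓡 n) x →L[ℝ] TangentSpace (𝓡 n) x →L[ℝ] ℝ}

/-- The extension of a vector used to define `∇φ` has constant components near `c` in the chart at
`c`; thus `∇φ` can be computed on frame fields. -/
theorem extend_eventuallyEq_frame {c : M} (v : TangentSpace (𝓡 n) c) :
    ∀ᶠ x in 𝓝 c, extend (EuclideanSpace ℝ (Fin n)) v x = frame n c x (coframe n c c v) := by
  filter_upwards [(trivializationAt (EuclideanSpace ℝ (Fin n))
      (TangentSpace (𝓡 n) : M → Type _) c).open_baseSet.mem_nhds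
      (mem_baseSet_trivializationAt _ _ c)] with x hx
  rw [coframe, frame, Bundle.Trivialization.continuousLinearMapAt_apply,
    Bundle.Trivialization.coe_linearMapAt_of_mem _ (mem_baseSet_trivializationAt _ _ c),
    FiberBundle.extend, Bundle.Trivialization.symmL_apply _ hx]

theorem mvfderiv_congr {k k' : M → ℝ} {x : M} (h : k =ᶠ[𝓝 x] k') :
    mvfderiv (𝓡 n) k x = mvfderiv (𝓡 n) k' x := by
  ext v
  exact DFunLike.congr_fun (h.mfderiv_eq (I := 𝓡 n) (I' := 𝓘(ℝ, ℝ))) v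

theorem form_extend_eventuallyEq {c : M} (a a' : TangentSpace (𝓡 n) c) :
    (fun x ↦ φ x (extend (EuclideanSpace ℝ (Fin n)) a x)
      (extend (EuclideanSpace ℝ (Fin n)) a' x)) =ᶠ[𝓝 c]
    fun x ↦ φ x (frame n c x (coframe n c c a)) (frame n c x (coframe n c c a')) := by
  filter_upwards [extend_eventuallyEq_frame a, extend_eventuallyEq_frame a'] with x h h'
  rw [h, h']

theorem leviCivita_extend {c : M} (a : TangentSpace (𝓡 n) c) :
    leviCivita (𝓡 n) M (extend (EuclideanSpace ℝ (Fin n)) a) c =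
      leviCivita (𝓡 n) M (fun x ↦ frame n c x (coframe n c c a)) c :=
  (leviCivita (𝓡 n) M).isCovariantDerivativeOnUniv.congr_of_eventuallyEq
    (mdifferentiableAt_extend (𝓡 n) _ a) (frame_mdifferentiableAt (mem_chart_source _ c) _)
    Filter.univ_mem (extend_eventuallyEq_frame a)

theorem deltaTwo_add (hφ : HasSmoothComponents φ) (hψ : HasSmoothComponents ψ) (c : M)
    (w : TangentSpace (𝓡 n) c) :
    deltaTwo (fun x ↦ φ x + ψ x) c w = deltaTwo φ c w + deltaTwo ψ c w := by
  rw [deltaTwo, deltaTwo, deltaTwo, ← neg_add, ← Finset.sum_add_distrib]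
  congr 1
  refine Finset.sum_congr rfl fun i _ ↦ ?_
  have hd : ∀ {φ : Π x : M, TangentSpace (𝓡 n) x →L[ℝ] TangentSpace (𝓡 n) x →L[ℝ] ℝ},
      HasSmoothComponents φ → ∀ a a' : TangentSpace (𝓡 n) c,
      MDifferentiableAt (𝓡 n) 𝓘(ℝ, ℝ) (fun x ↦ φ x (extend (EuclideanSpace ℝ (Fin n)) a x)
        (extend (EuclideanSpace ℝ (Fin n)) a' x)) c := fun hφ a a' ↦ by
    exact (mdifferentiableAt_of_hasSmoothComponents hφ (mem_chart_source _ c) _ _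
      ).congr_of_eventuallyEq (form_extend_eventuallyEq a a')
  have h := mvfderiv_add (hd hφ (orthoBasis (𝓡 n) c i) w) (hd hψ (orthoBasis (𝓡 n) c i) w)
  have h2 : mvfderiv (𝓡 n) (fun x ↦ (φ x + ψ x)
      (extend (EuclideanSpace ℝ (Fin n)) (orthoBasis (𝓡 n) c i) x)
      (extend (EuclideanSpace ℝ (Fin n)) w x)) c (orthoBasis (𝓡 n) c i) = _ :=
    congrArg (fun L : TangentSpace (𝓡 n) c →L[ℝ] ℝ ↦ L (orthoBasis (𝓡 n) c i)) h
  rw [nablaForm, h2]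
  simp only [nablaForm, FunLike.coe_add, Pi.add_apply]
  ring

/-- An orthonormal basis of the tangent space at `c`, read in the chart at `c`. -/
theorem exists_orthonormal_frame (c : M) :
    ∃ (ε : Fin (Module.finrank ℝ (TangentSpace (𝓡 n) c)) ≃ Fin n)
      (b : Module.Basis (Fin n) ℝ (EuclideanSpace ℝ (Fin n))),
      ∀ i, frame n c c (b (ε i)) = orthoBasis (𝓡 n) c i := by
  -- The orthonormal basis is indexed by the dimension of the tangent space, the coordinates by `Fin
  -- n`; `ε` relabels one as the other.
  have hfr : Module.finrank ℝ (TangentSpace (𝓡 n) c) = n :=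
    (finrank_euclideanSpace_fin (𝕜 := ℝ) (n := n) :)
  refine ⟨finCongr hfr, ((orthoBasis (𝓡 n) c).toBasis.reindex (finCongr hfr)).map
    (frameEquiv (mem_chart_source _ c)).symm.toLinearEquiv, fun i ↦ ?_⟩
  rw [Module.Basis.map_apply, Module.Basis.reindex_apply, Equiv.symm_apply_apply,
    OrthonormalBasis.coe_toBasis]
  exact frame_coframe (mem_chart_source _ c) _

theorem chart_symm_self (c : M) : (chartAt (EuclideanSpace ℝ (Fin n)) c).symm
    (chartAt (EuclideanSpace ℝ (Fin n)) c c) = c :=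
  (chartAt _ c).left_inv (mem_chart_source _ c)

theorem chartForm_center (c : M) (a a' : EuclideanSpace ℝ (Fin n)) :
    chartForm c φ (chartAt (EuclideanSpace ℝ (Fin n)) c c) a a' =
      φ c (frame n c c a) (frame n c c a') := by
  rw [chartForm_apply, chart_symm_self]

theorem inner_leviCivita_frame_center (c : M) (v a w : EuclideanSpace ℝ (Fin n)) :
    (inner ℝ (leviCivita (𝓡 n) M (fun x ↦ frame n c x a) c (frame n c c v))
      (frame n c c w) : ℝ) =
      1 / 2 * (fderiv ℝ (chartForm c (metricForm n M))
          (chartAt (EuclideanSpace ℝ (Fin n)) c c) v a w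
        + fderiv ℝ (chartForm c (metricForm n M)) (chartAt (EuclideanSpace ℝ (Fin n)) c c) a v w
        - fderiv ℝ (chartForm c (metricForm n M))
          (chartAt (EuclideanSpace ℝ (Fin n)) c c) w v a) := by
  have h := inner_leviCivita_frame (mem_chart_target (EuclideanSpace ℝ (Fin n)) c) v a w
  rw [chart_symm_self] at h
  exact h

theorem nablaForm_frame (hφ : HasSmoothComponents φ) (c : M)
    (v a a' : EuclideanSpace ℝ (Fin n)) :
    nablaForm φ c (frame n c c v) (frame n c c a) (frame n c c a') =
      fderiv ℝ (chartForm c φ) (chartAt (EuclideanSpace ℝ (Fin n)) c c) v a a'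
      - φ c (leviCivita (𝓡 n) M (fun x ↦ frame n c x a) c (frame n c c v)) (frame n c c a')
      - φ c (frame n c c a)
        (leviCivita (𝓡 n) M (fun x ↦ frame n c x a') c (frame n c c v)) := by
  have h := mvfderiv_form_frame hφ (mem_chart_target (EuclideanSpace ℝ (Fin n)) c) a a' v
  rw [chart_symm_self] at h
  rw [nablaForm, mvfderiv_congr (form_extend_eventuallyEq _ _), leviCivita_extend,
    leviCivita_extend, coframe_frame (mem_chart_source _ c),
    coframe_frame (mem_chart_source _ c), h]

section OrthonormalFrame

variable {c : M} {ε : Fin (Module.finrank ℝ (TangentSpace (𝓡 n) c)) ≃ Fin n}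
  {b : Module.Basis (Fin n) ℝ (EuclideanSpace ℝ (Fin n))}

theorem gramMatrix_orthonormal_frame (hb : ∀ i, frame n c c (b (ε i)) = orthoBasis (𝓡 n) c i) :
    gramMatrix b (chartForm c (metricForm n M) (chartAt (EuclideanSpace ℝ (Fin n)) c c)) = 1 := by
  ext i j
  obtain ⟨i, rfl⟩ := ε.surjective i
  obtain ⟨j, rfl⟩ := ε.surjective j
  rw [gramMatrix, Matrix.of_apply, chartForm_center, hb, hb, metricForm_apply,
    OrthonormalBasis.inner_eq_ite, Matrix.one_apply]
  simp only [EmbeddingLike.apply_eq_iff_eq]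

theorem sum_inner_orthonormal_frame (hb : ∀ i, frame n c c (b (ε i)) = orthoBasis (𝓡 n) c i)
    (ℓ : TangentSpace (𝓡 n) c →L[ℝ] ℝ) (z : TangentSpace (𝓡 n) c) :
    ℓ z = ∑ k, inner ℝ z (frame n c c (b k)) * ℓ (frame n c c (b k)) := by
  conv_lhs => rw [← (orthoBasis (𝓡 n) c).sum_repr' z]
  rw [← ε.sum_comp, map_sum]
  refine Finset.sum_congr rfl fun k _ ↦ ?_
  rw [map_smul, hb, smul_eq_mul, real_inner_comm]

theorem deltaTwo_frame (hb : ∀ i, frame n c c (b (ε i)) = orthoBasis (𝓡 n) c i)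
    (hφ : HasSmoothComponents φ) (w : EuclideanSpace ℝ (Fin n)) :
    deltaTwo φ c (frame n c c w) = -∑ i,
      (fderiv ℝ (chartForm c φ) (chartAt (EuclideanSpace ℝ (Fin n)) c c) (b i) (b i) w
      - ∑ k, inner ℝ (leviCivita (𝓡 n) M (fun x ↦ frame n c x (b i)) c (frame n c c (b i)))
          (frame n c c (b k)) *
          chartForm c φ (chartAt (EuclideanSpace ℝ (Fin n)) c c) (b k) w
      - ∑ k, inner ℝ (leviCivita (𝓡 n) M (fun x ↦ frame n c x w) c (frame n c c (b i)))
          (frame n c c (b k)) *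
          chartForm c φ (chartAt (EuclideanSpace ℝ (Fin n)) c c) (b i) (b k)) := by
  rw [deltaTwo, ← ε.sum_comp]
  congr 1
  refine Finset.sum_congr rfl fun i _ ↦ ?_
  rw [← hb, nablaForm_frame hφ]
  simp only [chartForm_center]
  exact congrArg₂ (· - ·) (congrArg₂ (· - ·) rfl
    (sum_inner_orthonormal_frame hb ((φ c).flip (frame n c c w)) _))
    (sum_inner_orthonormal_frame hb (φ c (frame n c c (b (ε i)))) _)

/-- Product rule for `∑ G^{ij} φ_{ij}`: the frame is orthonormal at `c` only, so the derivative of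
the inverse Gram matrix contributes the second sum. -/
theorem mvfderiv_metricTrace_frame (hb : ∀ i, frame n c c (b (ε i)) = orthoBasis (𝓡 n) c i)
    (hφ : HasSmoothComponents φ) (w : EuclideanSpace ℝ (Fin n)) :
    mvfderiv (𝓡 n) (fun x ↦ metricTrace (φ x)) c (frame n c c w) =
      ∑ i, fderiv ℝ (chartForm c φ) (chartAt (EuclideanSpace ℝ (Fin n)) c c) w (b i) (b i)
      - ∑ i, ∑ j, fderiv ℝ (chartForm c (metricForm n M))
          (chartAt (EuclideanSpace ℝ (Fin n)) c c) w (b i) (b j) *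
          chartForm c φ (chartAt (EuclideanSpace ℝ (Fin n)) c c) (b i) (b j) := by
  set e := chartAt (EuclideanSpace ℝ (Fin n)) c with he
  set G := chartForm c (metricForm n M) with hG
  have hy : e c ∈ e.target := mem_chart_target _ c
  have hone := gramMatrix_orthonormal_frame hb
  rw [← he, ← hG] at hone
  have hm := mvfderiv_frame hy (k := fun x ↦ metricTrace (φ x))
    ((contMDiff_metricTrace hφ).mdifferentiable (by simp) _) w
  rw [chart_symm_self] at hm
  have hev : (fun x ↦ metricTrace (φ x)) ∘ e.symm =ᶠ[𝓝 (e c)]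
      fun y ↦ ∑ i, ∑ j, (gramMatrix b (G y))⁻¹ i j * chartForm c φ y (b i) (b j) := by
    filter_upwards [e.open_target.mem_nhds hy] with y hy'
    exact metricTrace_eq_relTrace hy' φ b
  have hGs : ContDiffOn ℝ ∞ G e.target := hasSmoothComponents_metricForm.contDiffOn c
  have hGi : ∀ y ∈ e.target, IsInnerForm (G y) := fun y hy ↦ isInnerForm_chartForm_metricForm hy
  have hHd : DifferentiableAt ℝ (chartForm c φ) (e c) :=
    ((hφ.contDiffOn c).contDiffAt (e.open_target.mem_nhds hy)).differentiableAt (by simp)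
  have h1 : ∀ i j, DifferentiableAt ℝ (fun y ↦ (gramMatrix b (G y))⁻¹ i j) (e c) := fun i j ↦
    ((contDiffOn_gramMatrix_inv hGs hGi b.linearIndependent i j).contDiffAt
      (e.open_target.mem_nhds hy)).differentiableAt (by simp)
  have h2 : ∀ i j, DifferentiableAt ℝ (fun y ↦ chartForm c φ y (b i) (b j)) (e c) := fun i j ↦
    (hHd.clm_apply (differentiableAt_const _)).clm_apply (differentiableAt_const _)
  have h3 := HasFDerivAt.fun_sum fun i (_ : i ∈ Finset.univ) ↦
    HasFDerivAt.fun_sum fun j (_ : j ∈ Finset.univ) ↦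
      (h1 i j).hasFDerivAt.fun_mul (h2 i j).hasFDerivAt
  rw [hm, hev.fderiv_eq, h3.fderiv]
  simp only [FunLike.coe_sum, Finset.sum_apply, FunLike.coe_add, Pi.add_apply, FunLike.coe_smul,
    Pi.smul_apply, smul_eq_mul, Finset.sum_add_distrib]
  simp only [fderiv_clm_apply₂ hHd, fderiv_gramMatrix_inv e.open_target hGs hGi
    b.linearIndependent hy hone, hone, inv_one, Matrix.one_apply, ite_mul, one_mul, zero_mul,
    Finset.sum_ite_eq, Finset.mem_univ, if_true, mul_neg, Finset.sum_neg_distrib]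
  rw [← sub_eq_add_neg]
  congr 1
  exact Finset.sum_congr rfl fun i _ ↦ Finset.sum_congr rfl fun j _ ↦ mul_comm _ _

end OrthonormalFrame

variable {m : ℕ} {N : Type*} [TopologicalSpace N] [ChartedSpace (EuclideanSpace ℝ (Fin m)) N]
  [IsManifold (𝓡 m) ∞ N] [RiemannianBundle (fun x : N ↦ TangentSpace (𝓡 m) x)]
  [IsContMDiffRiemannianBundle (𝓡 m) ∞ (EuclideanSpace ℝ (Fin m))
    (fun x : N ↦ TangentSpace (𝓡 m) x)]
  [MeasurableSpace M] [BorelSpace M] [CompactSpace M] [T2Space M]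

/-- The stress-energy tensor of a harmonic map is divergence free. -/
theorem IsHarmonicMap.deltaTwo_pullbackMetric {f : M → N} (hf : IsHarmonicMap n m f) (c : M)
    (w : TangentSpace (𝓡 n) c) :
    deltaTwo (pullbackMetric n m f) c w =
      -(1 / 2) * mvfderiv (𝓡 n) (energyDensity n m f) c w := by
  obtain ⟨ε, b, hb⟩ := exists_orthonormal_frame (n := n) c
  obtain ⟨w, rfl⟩ : ∃ a, frame n c c a = w := ⟨_, frame_coframe (mem_chart_source _ c) w⟩
  have hH : HasSmoothComponents (pullbackMetric n m f) := hasSmoothComponents_pullbackMetric hf.1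
  have hG : HasSmoothComponents (metricForm n M) :=
    hasSmoothComponents_metricForm (n := n) (M := M)
  have hy : chartAt (EuclideanSpace ℝ (Fin n)) c c ∈
    (chartAt (EuclideanSpace ℝ (Fin n)) c).target := mem_chart_target _ c
  have ho := (chartAt (EuclideanSpace ℝ (Fin n)) c).open_target
  have hGi : ∀ y ∈ (chartAt (EuclideanSpace ℝ (Fin n)) c).target,
    IsInnerForm (chartForm c (metricForm n M) y) := fun y hy ↦ isInnerForm_chartForm_metricForm hy
  have hsymm : ∀ y a a', chartForm c (pullbackMetric n m f) y a a' =
      chartForm c (pullbackMetric n m f) y a' a := fun y a a' ↦ by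
    rw [chartForm_apply, chartForm_apply, pullbackMetric_apply, pullbackMetric_apply,
      metricForm_apply, metricForm_apply]
    exact real_inner_comm _ _
  have hGsymm : ∀ v a a', fderiv ℝ (chartForm c (metricForm n M))
      (chartAt (EuclideanSpace ℝ (Fin n)) c c) v a a' = fderiv ℝ (chartForm c (metricForm n M))
      (chartAt (EuclideanSpace ℝ (Fin n)) c c) v a' a := fun v a a' ↦ by
    have hd := ((hG.contDiffOn c).contDiffAt (ho.mem_nhds hy)).differentiableAt (by simp)
    rw [← fderiv_clm_apply₂ hd, ← fderiv_clm_apply₂ hd]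
    have hz : ∀ z, chartForm c (metricForm n M) z a a' = chartForm c (metricForm n M) z a' a :=
      fun z ↦ by
        rw [chartForm_apply, chartForm_apply, metricForm_apply, metricForm_apply]
        exact real_inner_comm _ _
    simp only [hz]
  -- The Euler–Lagrange equation at the centre of the chart, from criticality through the weak and
  -- the strong form.
  have heuler := euler_orthonormal ho (hG.contDiffOn c) hGi (hH.contDiffOn c) hsymm b w hy
    (gramMatrix_orthonormal_frame hb) (euler_of_weak volume ho (hG.contDiffOn c) hGi
      (hH.contDiffOn c) b w (fun u hu hc hs ↦ weak_of_critical volume ho (hG.contDiffOn c) hGi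
        (hH.contDiffOn c) b (fun X hX hXc hXs hmaps ↦ hf.hasDerivAt_chart b hX hXc hXs hmaps)
        u hu hc hs w) _ hy)
  have htr := mvfderiv_metricTrace_frame hb hH w
  rw [deltaTwo_frame hb hH]
  simp only [inner_leviCivita_frame_center]
  change _ = -(1 / 2) * mvfderiv (𝓡 n) (fun x ↦ metricTrace (pullbackMetric n m f x)) c _
  rw [htr, heuler]
  have hHd := ((hH.contDiffOn c).contDiffAt (ho.mem_nhds hy)).differentiableAt (by simp)
  have hH'symm : ∀ v a a', fderiv ℝ (chartForm c (pullbackMetric n m f))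
      (chartAt (EuclideanSpace ℝ (Fin n)) c c) v a a' = fderiv ℝ
      (chartForm c (pullbackMetric n m f))
      (chartAt (EuclideanSpace ℝ (Fin n)) c c) v a' a := fun v a a' ↦ by
    rw [← fderiv_clm_apply₂ hHd, ← fderiv_clm_apply₂ hHd]
    simp only [hsymm _ a a']
  have hHsymm := hsymm (chartAt (EuclideanSpace ℝ (Fin n)) c c)
  clear heuler htr hsymm hHd hG hH hGi hy ho
  -- What remains is an algebraic identity in the symmetric forms `H`, `G'` and `H'` at one point.
  generalize chartAt (EuclideanSpace ℝ (Fin n)) c c = y at *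
  generalize fderiv ℝ (chartForm c (metricForm n M)) y = G' at *
  generalize fderiv ℝ (chartForm c (pullbackMetric n m f)) y = H' at *
  generalize chartForm c (pullbackMetric n m f) y = H at *
  have h1 : ∑ i, H' (b i) (b i) w = ∑ i, H' (b i) w (b i) :=
    Finset.sum_congr rfl fun i _ ↦ hH'symm _ _ _
  -- The Christoffel term from the contracted slot reproduces the metric derivatives in the
  -- Euler–Lagrange equation.
  have h2 : ∑ i, ∑ k, 1 / 2 * (G' (b i) (b i) (b k) + G' (b i) (b i) (b k)
      - G' (b k) (b i) (b i)) * H (b k) w =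
      ∑ i, ∑ j, G' (b i) (b i) (b j) * H w (b j)
        - 1 / 2 * ∑ i, ∑ j, G' (b i) (b j) (b j) * H w (b i) := by
    rw [Finset.sum_comm (f := fun i j ↦ G' (b i) (b j) (b j) * H w (b i))]
    simp only [Finset.mul_sum, ← Finset.sum_sub_distrib]
    refine Finset.sum_congr rfl fun i _ ↦ Finset.sum_congr rfl fun j _ ↦ ?_
    rw [hHsymm (b j) w]
    ring
  have h4 : ∑ i, ∑ k, G' (b k) (b i) w * H (b i) (b k) =
      ∑ i, ∑ k, G' (b i) w (b k) * H (b i) (b k) := by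
    rw [Finset.sum_comm]
    refine Finset.sum_congr rfl fun i _ ↦ Finset.sum_congr rfl fun j _ ↦ ?_
    rw [hHsymm (b j), hGsymm (b i) (b j) w]
  -- In the other slot, the part of the Christoffel symbol that is skew in `i` and `k` cancels
  -- against the symmetric `H`; what is left matches the correction in the derivative of the trace.
  have h3 : ∑ i, ∑ k, 1 / 2 * (G' (b i) w (b k) + G' w (b i) (b k)
      - G' (b k) (b i) w) * H (b i) (b k) =
      1 / 2 * ∑ i, ∑ j, G' w (b i) (b j) * H (b i) (b j) := by
    have : ∑ i, ∑ k, 1 / 2 * (G' (b i) w (b k) + G' w (b i) (b k)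
        - G' (b k) (b i) w) * H (b i) (b k) =
        1 / 2 * ∑ i, ∑ k, G' (b i) w (b k) * H (b i) (b k)
        + 1 / 2 * ∑ i, ∑ j, G' w (b i) (b j) * H (b i) (b j)
        - 1 / 2 * ∑ i, ∑ k, G' (b k) (b i) w * H (b i) (b k) := by
      simp only [Finset.mul_sum, ← Finset.sum_sub_distrib, ← Finset.sum_add_distrib]
      refine Finset.sum_congr rfl fun i _ ↦ Finset.sum_congr rfl fun j _ ↦ ?_
      ring
    rw [this, h4]
    ring
  rw [Finset.sum_sub_distrib, Finset.sum_sub_distrib, h1, h2, h3]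
  ring

end TwoForms

/-! ### Functions with zero differential on a connected manifold. -/

section Constancy

variable {n : ℕ} {M : Type*} [TopologicalSpace M] [ChartedSpace (EuclideanSpace ℝ (Fin n)) M]
  [IsManifold (𝓡 n) ∞ M]

/-- The function is constant on coordinate balls, hence locally constant, and connectedness does the
rest. -/
theorem exists_const_of_mvfderiv_eq_zero [ConnectedSpace M] {k : M → ℝ}
    (hk : ContMDiff (𝓡 n) 𝓘(ℝ, ℝ) ∞ k) (h0 : ∀ x, mvfderiv (𝓡 n) k x = 0) :
    ∃ C, ∀ x, k x = C := by
  have hloc : IsLocallyConstant k := by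
    rw [IsLocallyConstant.iff_eventually_eq]
    intro x
    set e := chartAt (EuclideanSpace ℝ (Fin n)) x
    obtain ⟨r, hr, hrt⟩ := Metric.isOpen_iff.1 e.open_target (e x) (mem_chart_target _ x)
    have hkd : ContDiffOn ℝ ∞ (k ∘ e.symm) e.target := contDiffOn_comp_chart_symm hk.contMDiffOn
    have hzero : ∀ y ∈ Metric.ball (e x) r, fderiv ℝ (k ∘ e.symm) y = 0 := fun y hy ↦ by
      ext a
      rw [← mvfderiv_frame (hrt hy) (hk.mdifferentiable (by simp) _), h0]
      rfl
    have hev : ∀ᶠ z in 𝓝 x, z ∈ e.source ∧ e z ∈ Metric.ball (e x) r :=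
      Filter.Eventually.and (e.open_source.mem_nhds (mem_chart_source _ x))
        ((e.continuousAt (mem_chart_source _ x)).eventually (Metric.ball_mem_nhds _ hr))
    filter_upwards [hev] with z ⟨hz, hzr⟩
    have := Metric.isOpen_ball.is_const_of_fderiv_eq_zero (convex_ball (e x) r).isPreconnected
      ((hkd.mono hrt).differentiableOn (by simp)) hzero hzr (Metric.mem_ball_self hr)
    simpa only [Function.comp_apply, e.left_inv hz, e.left_inv (mem_chart_source _ x)] using this
  obtain ⟨x⟩ := (inferInstance : Nonempty M)
  exact ⟨k x, fun y ↦ hloc.apply_eq_of_preconnectedSpace y x⟩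

end Constancy

/-! ### The decomposition of the pullback metric. -/

section BergerEbin

variable {n m : ℕ}
  {M : Type*} [TopologicalSpace M] [T2Space M] [CompactSpace M]
  [ChartedSpace (EuclideanSpace ℝ (Fin n)) M] [IsManifold (𝓡 n) ∞ M]
  [RiemannianBundle (fun x : M ↦ TangentSpace (𝓡 n) x)]
  [IsContMDiffRiemannianBundle (𝓡 n) ∞ (EuclideanSpace ℝ (Fin n))
    (fun x : M ↦ TangentSpace (𝓡 n) x)]
  [MeasurableSpace M] [BorelSpace M]
  {N : Type*} [TopologicalSpace N]
  [ChartedSpace (EuclideanSpace ℝ (Fin m)) N] [IsManifold (𝓡 m) ∞ N]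
  [RiemannianBundle (fun x : N ↦ TangentSpace (𝓡 m) x)]
  [IsContMDiffRiemannianBundle (𝓡 m) ∞ (EuclideanSpace ℝ (Fin m))
    (fun x : N ↦ TangentSpace (𝓡 m) x)]
  {f : M → N} {θ : Π x : M, TangentSpace (𝓡 n) x →L[ℝ] ℝ}
  {φ₀ : Π x : M, TangentSpace (𝓡 n) x →L[ℝ] TangentSpace (𝓡 n) x →L[ℝ] ℝ}

theorem metricTrace_add {x : M} (A B : TangentSpace (𝓡 n) x →L[ℝ] TangentSpace (𝓡 n) x →L[ℝ] ℝ) :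
    metricTrace (A + B) = metricTrace A + metricTrace B := by
  simp only [metricTrace, FunLike.coe_add, Pi.add_apply, Finset.sum_add_distrib]

/-- The energy density is `-δθ` up to the trace of the divergence free part. -/
theorem energyDensity_eq_of_decomposition (hθ : IsSmoothOneForm (𝓡 n) θ)
    (hdec : ∀ x : M, pullbackMetric n m f x = deltaStar θ x + φ₀ x) (x : M) :
    energyDensity n m f x = -deltaOne θ x + metricTrace (φ₀ x) := by
  rw [energyDensity, hdec, metricTrace_add,
    deltaOne_eq_neg_metricTrace (mdifferentiableAt_sharp hθ x), neg_neg]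

/-- The heart of the argument: the conservation law gives `2δδ^*θ = -d e(f)`, harmonicity of `θ^♯`
gives `2δδ^*θ = dδθ`, and `trace_g φ₀ = e(f) + δθ`. -/
theorem mvfderiv_metricTrace_eq_zero (hf : IsHarmonicMap n m f) (hθ : IsSmoothOneForm (𝓡 n) θ)
    (hφ₀ : IsSmoothSymmTwoForm (𝓡 n) φ₀)
    (hdiv : ∀ (x : M) (w : TangentSpace (𝓡 n) x), deltaTwo φ₀ x w = 0)
    (hdec : ∀ x : M, pullbackMetric n m f x = deltaStar θ x + φ₀ x)
    (hξ : IsInfinitesimalHarmonicTransformation θ) (x : M) :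
    mvfderiv (𝓡 n) (fun x ↦ metricTrace (φ₀ x)) x = 0 := by
  ext w
  have h1 := hf.deltaTwo_pullbackMetric x w
  rw [show pullbackMetric n m f = fun x ↦ deltaStar θ x + φ₀ x from funext hdec,
    deltaTwo_add (hasSmoothComponents_deltaStar hθ) hφ₀.hasSmoothComponents, hdiv, add_zero] at h1
  have h2 := hξ x w
  rw [sampsonLaplacian, h1] at h2
  have he : (fun x ↦ metricTrace (φ₀ x)) = energyDensity n m f + deltaOne θ := by
    funext x
    rw [Pi.add_apply, energyDensity_eq_of_decomposition hθ hdec]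
    ring
  rw [he, mvfderiv_add ((contMDiff_energyDensity hf.1).mdifferentiable (by simp) x)
    ((contMDiff_deltaOne hθ).mdifferentiable (by simp) x)]
  simp only [FunLike.coe_add, Pi.add_apply, FunLike.coe_zero, Pi.zero_apply]
  linarith

theorem energyDensity_nonneg (x : M) : 0 ≤ energyDensity n m f x := by
  rw [energyDensity, metricTrace]
  exact Finset.sum_nonneg fun i _ ↦ by
    rw [pullbackMetric_apply, metricForm_apply]
    exact real_inner_self_nonneg

end BergerEbin

end RiemannianGeometry

end

/-! ### The theorem. -/

theorem corollary1 {n m : ℕ} (hn : 3 ≤ n) (hm : 2 ≤ m)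
    -- the compact connected Riemannian manifold `(M, g)` of dimension `n`
    {M : Type*} [TopologicalSpace M] [T2Space M] [CompactSpace M] [ConnectedSpace M]
    [ChartedSpace (EuclideanSpace ℝ (Fin n)) M] [IsManifold (𝓡 n) ∞ M]
    [RiemannianBundle (fun x : M ↦ TangentSpace (𝓡 n) x)]
    [IsContMDiffRiemannianBundle (𝓡 n) ∞ (EuclideanSpace ℝ (Fin n))
      (fun x : M ↦ TangentSpace (𝓡 n) x)]
    [MeasurableSpace M] [BorelSpace M]
    -- the complete Riemannian manifold of dimension `m`
    {N : Type*} [EMetricSpace N]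
    [ChartedSpace (EuclideanSpace ℝ (Fin m)) N] [IsManifold (𝓡 m) ∞ N]
    [RiemannianBundle (fun x : N ↦ TangentSpace (𝓡 m) x)]
    [IsContMDiffRiemannianBundle (𝓡 m) ∞ (EuclideanSpace ℝ (Fin m))
      (fun x : N ↦ TangentSpace (𝓡 m) x)]
    [IsRiemannianManifold (𝓡 m) N] [CompleteSpace N]
    -- the harmonic map `f`
    (f : M → N) (hf : RiemannianGeometry.IsHarmonicMap n m f)
    -- the Berger-Ebin decomposition of the pullback metric
    (θ : Π x : M, TangentSpace (𝓡 n) x →L[ℝ] ℝ)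
    (hθ : RiemannianGeometry.IsSmoothOneForm (𝓡 n) θ)
    (φ₀ : Π x : M, TangentSpace (𝓡 n) x →L[ℝ] TangentSpace (𝓡 n) x →L[ℝ] ℝ)
    (hφ₀ : RiemannianGeometry.IsSmoothSymmTwoForm (𝓡 n) φ₀)
    (hdiv : ∀ (x : M) (w : TangentSpace (𝓡 n) x), RiemannianGeometry.deltaTwo φ₀ x w = 0)
    (hdec : ∀ x : M, RiemannianGeometry.pullbackMetric n m f x =
      RiemannianGeometry.deltaStar θ x + φ₀ x)
    -- `θ^♯` is an infinitesimal harmonic transformation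
    (hξ : RiemannianGeometry.IsInfinitesimalHarmonicTransformation θ) :
    ∃ C : ℝ, 0 ≤ C ∧
      (∀ x : M, RiemannianGeometry.energyDensity n m f x =
        -RiemannianGeometry.deltaOne θ x + C) ∧
      RiemannianGeometry.energy n m f =
        C / 2 * (RiemannianGeometry.riemannianVolume n M).real univ := by
  -- The constant is the trace of the divergence free part `φ₀`.
  obtain ⟨C, hC⟩ := RiemannianGeometry.exists_const_of_mvfderiv_eq_zero
    (RiemannianGeometry.contMDiff_metricTrace hφ₀.hasSmoothComponents)
    (RiemannianGeometry.mvfderiv_metricTrace_eq_zero hf hθ hφ₀ hdiv hdec hξ)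
  have he : ∀ x : M, RiemannianGeometry.energyDensity n m f x =
      -RiemannianGeometry.deltaOne θ x + C := fun x ↦ by
    rw [RiemannianGeometry.energyDensity_eq_of_decomposition hθ hdec, hC]
  have := RiemannianGeometry.isFiniteMeasure_riemannianVolume (n := n) (M := M)
  have hE : RiemannianGeometry.energy n m f =
      C / 2 * (RiemannianGeometry.riemannianVolume n M).real univ := by
    rw [RiemannianGeometry.energy]
    simp only [he]
    rw [integral_add _ (integrable_const C), integral_neg,
      RiemannianGeometry.integral_deltaOne hθ, integral_const, smul_eq_mul]
    · ring
    · exact (RiemannianGeometry.contMDiff_deltaOne hθ).continuous.neg.integrable_of_hasCompactSupport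
        (HasCompactSupport.of_compactSpace _)
  refine ⟨C, ?_, he, hE⟩
  have hvol : 0 < (RiemannianGeometry.riemannianVolume n M).real univ :=
    ENNReal.toReal_pos (RiemannianGeometry.riemannianVolume_univ_pos).ne' (measure_ne_top _ _)
  -- The sign of `C` comes from the total energy, not from a pointwise bound: `e(f) ≥ 0` alone does
  -- not control `δθ`, whose integral vanishes.
  have hnn : 0 ≤ RiemannianGeometry.energy n m f :=
    mul_nonneg (by norm_num)
      (integral_nonneg RiemannianGeometry.energyDensity_nonneg)
  rw [hE] at hnn
  have := nonneg_of_mul_nonneg_left hnn hvol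
  linarith
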